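/- **Setting.** Let $\Omega\subseteq\mathbb R^N$ be a bounded open set (not necessarily connected or regular). For $1<p<\infty$ let $W^{1,p}_0(\Omega)$ be the closure of $C^\infty_c(\Omega)$ in $W^{1,p}(\Omega)$ and set $$W^{1,p_-}_0(\Omega)=W^{1,p}(\Omega)\cap\bigcap_{1<s<p}W^{1,s}_0(\Omega).$$ Let $i$ be an index, defined for the nonempty compact symmetric ($K=-K$) subsets $K$ of real Hausdorff topological vector spaces with $0\notin K$, such that 1. $i(K)$ is an integer $\ge 1$; 2. if $X$ is a topological vector space and $K\subseteq X\setminus\{0\}$ is nonempty, compact and symmetric, there is an open subset $U$ of $X\setminus\{0\}$ with $K\subseteq U$ such that $i(\widehat K)\le i(K)$ for every nonempty compact symmetric $\widehat K\subseteq U$; 3. if $X,Y$ are topological vector spaces, $K\subseteq X\setminus\{0\}$ is nonempty, compact and symmetric, and $\pi:K\to Y\setminus\{0\}$ is continuous and odd, then $i(\pi(K))\ge i(K)$; 4. if $X$ is a real normed space with $1\le\dim X<\infty$, then $i(\{u\in X:\|u\|=1\})=\dim X$. For $1<p<\infty$ put $$M_p=\Big\{u\in W^{1,p}_0(\Omega):\int_\Omega|u|^p\,dx=1\Big\},\qquad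 \underline M_p=\Big\{u\in W^{1,p_-}_0(\Omega):\int_\Omega|u|^p\,dx=1\Big\},$$ both with the topology of $W^{1,p}(\Omega)$. For $m\ge1$ define $$\lambda_p^{(m)}=\inf\Big\{\max_{u\in K}\int_\Omega|\nabla u|^p\,dx:\ K\subseteq M_p\text{ nonempty, compact, symmetric, } i(K)\ge m\Big\},$$ and define $\underline\lambda_p^{(m)}$ in the same way with $\underline M_p$ in place of $M_p$ (values in $[0,\infty]$, with $\inf\emptyset=\infty$). **Theorem.** For every $1<p<\infty$ and every $m\ge1$, $$\lim_{s\to p^-}\underline\lambda_s^{(m)}=\lim_{s\to p^-}\lambda_s^{(m)}=\underline\lambda_p^{(m)},\qquad \lim_{s\to p^+}\underline\lambda_s^{(m)}=\lim_{s\to p^+}\lambda_s^{(m)}=\lambda_p^{(m)}.$$ -/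

import Mathlib

open MeasureTheory TopologicalSpace Filter Topology
open scoped ENNReal Distributions

namespace PLaplace

/-- An index `i`: a positive integer attached to every nonempty, compact, symmetric subset `K` of
a (real, Hausdorff) topological vector space with `0 ∉ K`. Values of `idx` on other sets are
irrelevant. -/
structure TopIndex : Type 1 where
  /-- the value `i(K)` -/
  idx : ∀ {X : Type} [AddCommGroup X] [Module ℝ X] [TopologicalSpace X]
    [IsTopologicalAddGroup X] [ContinuousSMul ℝ X] [T2Space X], Set X → ℕ
  /-- (i) `i(K)` is an integer `≥ 1` -/
  one_le : ∀ {X : Type} [AddCommGroup X] [Module ℝ X] [TopologicalSpace X]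
    [IsTopologicalAddGroup X] [ContinuousSMul ℝ X] [T2Space X] (K : Set X),
    K.Nonempty → IsCompact K → (∀ x ∈ K, -x ∈ K) → (0 : X) ∉ K → 1 ≤ idx K
  /-- (ii) upper semicontinuity -/
  exists_open : ∀ {X : Type} [AddCommGroup X] [Module ℝ X] [TopologicalSpace X]
    [IsTopologicalAddGroup X] [ContinuousSMul ℝ X] [T2Space X] (K : Set X),
    K.Nonempty → IsCompact K → (∀ x ∈ K, -x ∈ K) → (0 : X) ∉ K →
    ∃ U : Set X, IsOpen U ∧ (0 : X) ∉ U ∧ K ⊆ U ∧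
      ∀ K' : Set X, K'.Nonempty → IsCompact K' → (∀ x ∈ K', -x ∈ K') → K' ⊆ U → idx K' ≤ idx K
  /-- (iii) monotonicity under continuous odd maps `K → Y \ {0}` -/
  le_image : ∀ {X Y : Type} [AddCommGroup X] [Module ℝ X] [TopologicalSpace X]
    [IsTopologicalAddGroup X] [ContinuousSMul ℝ X] [T2Space X]
    [AddCommGroup Y] [Module ℝ Y] [TopologicalSpace Y]
    [IsTopologicalAddGroup Y] [ContinuousSMul ℝ Y] [T2Space Y] (K : Set X) (π : X → Y),
    K.Nonempty → IsCompact K → (∀ x ∈ K, -x ∈ K) → (0 : X) ∉ K →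
    ContinuousOn π K → (∀ x ∈ K, π (-x) = -π x) → (∀ x ∈ K, π x ≠ 0) →
    idx K ≤ idx (π '' K)
  /-- (iv) normalization on unit spheres of finite dimensional normed spaces -/
  sphere : ∀ {X : Type} [NormedAddCommGroup X] [NormedSpace ℝ X],
    FiniteDimensional ℝ X → 1 ≤ Module.finrank ℝ X →
    idx {x : X | ‖x‖ = 1} = Module.finrank ℝ X

variable {N : ℕ}

/-- Exponents `p ∈ (1, ∞)`. -/
abbrev Exponent : Type := Set.Ioi (1 : ℝ)

/-- The exponent `p` as an extended nonnegative real. -/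
noncomputable abbrev Exponent.toENNReal (p : Exponent) : ℝ≥0∞ := ENNReal.ofReal (p : ℝ)

instance (p : Exponent) : Fact (1 ≤ p.toENNReal) :=
  ⟨by simpa using ENNReal.ofReal_le_ofReal (le_of_lt p.2)⟩

/-- `L^p(Ω; F)`. -/
abbrev LpOn (Ω : Opens (EuclideanSpace ℝ (Fin N))) (F : Type) [NormedAddCommGroup F]
    (p : Exponent) : Type :=
  Lp F p.toENNReal (volume.restrict (Ω : Set (EuclideanSpace ℝ (Fin N))))

/-- `g` is the weak gradient of `u` on `Ω`:
`∫_Ω u ∂_v φ dx = - ∫_Ω (g · v) φ dx` for all `φ ∈ C_c^∞(Ω)` and all directions `v`. -/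
def IsWeakGradient (Ω : Opens (EuclideanSpace ℝ (Fin N))) (u : EuclideanSpace ℝ (Fin N) → ℝ)
    (g : EuclideanSpace ℝ (Fin N) → EuclideanSpace ℝ (Fin N)) : Prop :=
  ∀ (φ : 𝓓(Ω, ℝ)) (v : EuclideanSpace ℝ (Fin N)),
    ∫ x in (Ω : Set (EuclideanSpace ℝ (Fin N))), u x * fderiv ℝ φ x v =
      - ∫ x in (Ω : Set (EuclideanSpace ℝ (Fin N))), inner ℝ (g x) v * φ x

section integrability

variable {Ω : Opens (EuclideanSpace ℝ (Fin N))} {p : Exponent}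

lemma locallyIntegrable_coe {F : Type} [NormedAddCommGroup F] (u : LpOn Ω F p) :
    LocallyIntegrable u (volume.restrict (Ω : Set (EuclideanSpace ℝ (Fin N)))) :=
  (Lp.memLp u).locallyIntegrable (Fact.out : 1 ≤ p.toENNReal)

lemma integrable_mul_fderiv (u : LpOn Ω ℝ p) (φ : 𝓓(Ω, ℝ)) (v : EuclideanSpace ℝ (Fin N)) :
    IntegrableOn (fun x => u x * fderiv ℝ φ x v) (Ω : Set (EuclideanSpace ℝ (Fin N))) volume := by
  have hc : Continuous fun x => fderiv ℝ φ x v :=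
    (φ.contDiff.continuous_fderiv (by simp)).clm_apply continuous_const
  have hs : HasCompactSupport fun x => fderiv ℝ φ x v :=
    φ.hasCompactSupport.fderiv_apply ℝ v
  simpa [IntegrableOn, mul_comm] using
    (locallyIntegrable_coe u).integrable_smul_left_of_hasCompactSupport hc hs

lemma integrable_inner_mul (g : LpOn Ω (EuclideanSpace ℝ (Fin N)) p) (φ : 𝓓(Ω, ℝ))
    (v : EuclideanSpace ℝ (Fin N)) :
    IntegrableOn (fun x => inner ℝ (g x) v * φ x) (Ω : Set (EuclideanSpace ℝ (Fin N))) volume := by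
  have h := (locallyIntegrable_coe g).integrable_smul_left_of_hasCompactSupport
    φ.continuous φ.hasCompactSupport
  refine (h.inner_const (𝕜 := ℝ) v).congr (Eventually.of_forall fun x => ?_)
  simp [inner_smul_left, mul_comm]

end integrability

/-- The Sobolev space `W^{1,p}(Ω)`, each element `u` being recorded together with its
(unique) weak gradient as the pair `(u, ∇u) ∈ L^p(Ω) × L^p(Ω; ℝ^N)`. It inherits the norm
`max (‖u‖_p) (‖∇u‖_p)`, equivalent to the usual norm of `W^{1,p}(Ω)`. -/
def W1 (Ω : Opens (EuclideanSpace ℝ (Fin N))) (p : Exponent) :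
    Submodule ℝ (LpOn Ω ℝ p × LpOn Ω (EuclideanSpace ℝ (Fin N)) p) where
  carrier := {w | IsWeakGradient Ω w.1 w.2}
  zero_mem' := by
    intro φ v
    have h1 := Lp.coeFn_zero ℝ p.toENNReal
      (volume.restrict (Ω : Set (EuclideanSpace ℝ (Fin N))))
    have h2 := Lp.coeFn_zero (EuclideanSpace ℝ (Fin N)) p.toENNReal
      (volume.restrict (Ω : Set (EuclideanSpace ℝ (Fin N))))
    rw [integral_eq_zero_of_ae, integral_eq_zero_of_ae, neg_zero]
    · filter_upwards [h2] with x hx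
      simp only [Prod.snd_zero, hx]
      simp
    · filter_upwards [h1] with x hx
      simp only [Prod.fst_zero, hx]
      simp
  add_mem' := by
    intro a b ha hb φ v
    have h1 := Lp.coeFn_add a.1 b.1
    have h2 := Lp.coeFn_add a.2 b.2
    have e1 : ∫ x in (Ω : Set (EuclideanSpace ℝ (Fin N))), (a + b).1 x * fderiv ℝ φ x v =
        ∫ x in (Ω : Set (EuclideanSpace ℝ (Fin N))),
          (a.1 x * fderiv ℝ φ x v + b.1 x * fderiv ℝ φ x v) := by
      refine integral_congr_ae ?_
      filter_upwards [h1] with x hx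
      simp only [Prod.fst_add, hx, Pi.add_apply, add_mul]
    have e2 : ∫ x in (Ω : Set (EuclideanSpace ℝ (Fin N))), inner ℝ ((a + b).2 x) v * φ x =
        ∫ x in (Ω : Set (EuclideanSpace ℝ (Fin N))), (inner ℝ (a.2 x) v * φ x + inner ℝ (b.2 x) v * φ x) := by
      refine integral_congr_ae ?_
      filter_upwards [h2] with x hx
      simp only [Prod.snd_add, hx, Pi.add_apply, inner_add_left, add_mul]
    rw [e1, e2, integral_add (integrable_mul_fderiv _ φ v) (integrable_mul_fderiv _ φ v),
      integral_add (integrable_inner_mul _ φ v) (integrable_inner_mul _ φ v), ha φ v, hb φ v]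
    ring
  smul_mem' := by
    intro c a ha φ v
    have h1 := Lp.coeFn_smul c a.1
    have h2 := Lp.coeFn_smul c a.2
    have e1 : ∫ x in (Ω : Set (EuclideanSpace ℝ (Fin N))), (c • a).1 x * fderiv ℝ φ x v =
        ∫ x in (Ω : Set (EuclideanSpace ℝ (Fin N))), c * (a.1 x * fderiv ℝ φ x v) := by
      refine integral_congr_ae ?_
      filter_upwards [h1] with x hx
      simp only [Prod.smul_fst, hx, Pi.smul_apply, smul_eq_mul, mul_assoc]
    have e2 : ∫ x in (Ω : Set (EuclideanSpace ℝ (Fin N))), inner ℝ ((c • a).2 x) v * φ x =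
        ∫ x in (Ω : Set (EuclideanSpace ℝ (Fin N))), c * (inner ℝ (a.2 x) v * φ x) := by
      refine integral_congr_ae ?_
      filter_upwards [h2] with x hx
      simp only [Prod.smul_snd, hx, Pi.smul_apply, real_inner_smul_left, mul_assoc]
    rw [e1, e2, integral_const_mul, integral_const_mul, ha φ v]
    ring

/-- The underlying function of `u ∈ W^{1,p}(Ω)`. -/
noncomputable def sobVal {Ω : Opens (EuclideanSpace ℝ (Fin N))} {p : Exponent} (u : W1 Ω p) :
    EuclideanSpace ℝ (Fin N) → ℝ := u.1.1

/-- The weak gradient of `u ∈ W^{1,p}(Ω)`. -/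
noncomputable def sobGrad {Ω : Opens (EuclideanSpace ℝ (Fin N))} {p : Exponent} (u : W1 Ω p) :
    EuclideanSpace ℝ (Fin N) → EuclideanSpace ℝ (Fin N) := u.1.2

/-- `W^{1,p}_0(Ω)`: the closure of `C_c^∞(Ω)` in `W^{1,p}(Ω)`. -/
def W10 (Ω : Opens (EuclideanSpace ℝ (Fin N))) (p : Exponent) : Set (W1 Ω p) :=
  closure {u | ∃ φ : 𝓓(Ω, ℝ), sobVal u =ᵐ[volume.restrict (Ω : Set (EuclideanSpace ℝ (Fin N)))] φ}

/-- `W^{1,p₋}_0(Ω) = W^{1,p}(Ω) ∩ ⋂_{1<s<p} W^{1,s}_0(Ω)`. -/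
def W10minus (Ω : Opens (EuclideanSpace ℝ (Fin N))) (p : Exponent) : Set (W1 Ω p) :=
  {u | ∀ s : Exponent, s < p →
    ∃ w ∈ W10 Ω s, sobVal w =ᵐ[volume.restrict (Ω : Set (EuclideanSpace ℝ (Fin N)))] sobVal u}

/-- `∫_Ω |∇u|^p dx`. -/
noncomputable def energy {Ω : Opens (EuclideanSpace ℝ (Fin N))} {p : Exponent} (u : W1 Ω p) :
    ℝ≥0∞ :=
  ∫⁻ x in (Ω : Set (EuclideanSpace ℝ (Fin N))), ‖sobGrad u x‖ₑ ^ (p : ℝ)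

/-- The set of `u` in `V ⊆ W^{1,p}(Ω)` with `∫_Ω |u|^p dx = 1`. -/
def unitSet {Ω : Opens (EuclideanSpace ℝ (Fin N))} {p : Exponent} (V : Set (W1 Ω p)) :
    Set (W1 Ω p) :=
  {u | u ∈ V ∧ ∫⁻ x in (Ω : Set (EuclideanSpace ℝ (Fin N))), ‖sobVal u x‖ₑ ^ (p : ℝ) = 1}

/-- The `m`-th min-max value over `M ⊆ W^{1,p}(Ω)`: the infimum in `[0, ∞]` (with `inf ∅ = ∞`) of
`max_{u ∈ K} ∫_Ω |∇u|^p dx` over the nonempty, compact, symmetric `K ⊆ M` with `i(K) ≥ m`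
(compactness in the `W^{1,p}(Ω)`-topology; the supremum is a maximum, the energy being
continuous). -/
noncomputable def minmax (i : TopIndex) {Ω : Opens (EuclideanSpace ℝ (Fin N))} {p : Exponent}
    (M : Set (W1 Ω p)) (m : ℕ) : ℝ≥0∞ :=
  sInf {r | ∃ K : Set (W1 Ω p), K.Nonempty ∧ IsCompact K ∧ (∀ u ∈ K, -u ∈ K) ∧ K ⊆ M ∧
    m ≤ i.idx K ∧ r = ⨆ u ∈ K, energy u}

/-- The `m`-th variational eigenvalue `λ_p^{(m)}`, relative to `W^{1,p}_0(Ω)`. -/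
noncomputable def eigenvalue (i : TopIndex) (Ω : Opens (EuclideanSpace ℝ (Fin N)))
    (m : ℕ) (p : Exponent) : ℝ≥0∞ :=
  minmax i (unitSet (W10 Ω p)) m

/-- The `m`-th variational eigenvalue `λ̲_p^{(m)}`, relative to `W^{1,p₋}_0(Ω)`. -/
noncomputable def lowerEigenvalue (i : TopIndex) (Ω : Opens (EuclideanSpace ℝ (Fin N)))
    (m : ℕ) (p : Exponent) : ℝ≥0∞ :=
  minmax i (unitSet (W10minus Ω p)) m

end PLaplace

/-! Every inequality between min-max values comes from one mechanism (`minmax_le_of_odd_map`): a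
competitor `K` is carried by a continuous odd map into a subspace of another Sobolev space and
renormalised there. By `le_image` the index does not drop, so it suffices that the map nearly
preserves the normalisation and nearly does not increase the energy. Three comparisons near `p`
result.

(a) `exists_eigenvalue_le_of_lowerEigenvalue_lt`: for `q < s`, the eigenvalue at `q` is almost
bounded by the lower eigenvalue at `s`. The map is the inclusion, which sends `W10minus Ω s` into
`W10 Ω q` by definition. The energy is controlled by Young's inequality on a set of finite measure;
the real point is that the `L^q` norm cannot collapse. This non-concentration
(`exists_forall_le_powInt`) follows from a Poincaré-type estimate against averages over small balls,
whose constant does not depend on the exponent and which needs no regularity of `Ω`.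

(b) `exists_eigenvalue_le_of_gt`: for `s > p`, the eigenvalue at `s` is almost bounded by the one at
`p`. A compact subset of `W10 Ω p` is approximated by odd combinations of finitely many test
functions, whose gradients are uniformly bounded, so that raising the exponent costs little.

(c) `exists_lowerEigenvalue_le_of_lt`: for `s < p`, the lower eigenvalue at `p` is almost bounded by
the eigenvalue at `s`. By compactness (`exists_close_W10minus`), normalised functions of bounded
energy are `L^s`-close to elements of `W10minus Ω p` with the same energy bound. A weak limit as the
exponents increase to `p` lies in `W10 Ω r` for every `r < p`, but not necessarily in `W10 Ω p`;
hence the lower eigenvalue on the left. Odd combinations of such elements then give the map.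

Since the ambient spaces vary with the exponent, weak limits are taken in `L¹ × L¹`: minimising a
uniformly convex functional over convex hulls of tails yields a point in the closure of every convex
set that eventually contains the sequence. Upper and lower bounds on the left are (a), and (a)
followed by (c); on the right they are (b) and (a). -/

namespace PLaplace

/-! ### Power integrals: change of exponent, Fatou, interpolation -/

section PowInt

variable {α F : Type*} [MeasurableSpace α] [NormedAddCommGroup F] {μ : Measure α}

/-- The integral `∫ ‖f‖ ^ r`. -/
noncomputable def powInt (μ : Measure α) (r : ℝ) (f : α → F) : ℝ≥0∞ := ∫⁻ x, ‖f x‖ₑ ^ r ∂μ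

lemma enorm_rpow_eq_ofReal (x : F) {r : ℝ} (hr : 0 ≤ r) :
    ‖x‖ₑ ^ r = ENNReal.ofReal (‖x‖ ^ r) := by
  rw [← ofReal_norm, ENNReal.ofReal_rpow_of_nonneg (norm_nonneg _) hr]

/-- Weighted AM-GM applied to `a ^ s` and `1` with weights `q / s` and `1 - q / s`. The additive
form keeps the coefficient of `a ^ s` equal to `1` and has an error that vanishes as `q → s`. -/
lemma rpow_le_rpow_add {a q s : ℝ} (ha : 0 ≤ a) (hq : 0 < q) (hqs : q ≤ s) :
    a ^ q ≤ a ^ s + (1 - q / s) := by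
  have hs : 0 < s := hq.trans_le hqs
  have h1 : q / s ≤ 1 := (div_le_one hs).2 hqs
  have h := Real.geom_mean_le_arith_mean2_weighted (w₁ := q / s) (w₂ := 1 - q / s)
    (p₁ := a ^ s) (p₂ := 1) (by positivity) (by linarith) (by positivity) zero_le_one (by ring)
  rw [← Real.rpow_mul ha, mul_div_cancel₀ _ hs.ne', Real.one_rpow, mul_one, mul_one] at h
  have h2 : q / s * a ^ s ≤ 1 * a ^ s := mul_le_mul_of_nonneg_right h1 (by positivity)
  linarith

lemma powInt_congr {r : ℝ} {f g : α → F} (h : f =ᵐ[μ] g) : powInt μ r f = powInt μ r g :=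
  lintegral_congr_ae (h.mono fun x hx => by simp only [hx])

lemma aemeasurable_enorm_rpow {f : α → F} (hf : AEStronglyMeasurable f μ) (r : ℝ) :
    AEMeasurable (fun x => ‖f x‖ₑ ^ r) μ := hf.enorm.pow_const r

lemma powInt_le_add {q s : ℝ} (hq : 0 < q) (hqs : q ≤ s) {f : α → F}
    (hf : AEStronglyMeasurable f μ) :
    powInt μ q f ≤ powInt μ s f + ENNReal.ofReal (1 - q / s) * μ Set.univ := by
  have hs : 0 < s := hq.trans_le hqs
  have h1 : q / s ≤ 1 := (div_le_one hs).2 hqs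
  calc powInt μ q f ≤ ∫⁻ x, (‖f x‖ₑ ^ s + ENNReal.ofReal (1 - q / s)) ∂μ := by
        refine lintegral_mono fun x => ?_
        rw [enorm_rpow_eq_ofReal _ hq.le, enorm_rpow_eq_ofReal _ hs.le,
          ← ENNReal.ofReal_add (by positivity) (by linarith)]
        exact ENNReal.ofReal_le_ofReal (rpow_le_rpow_add (norm_nonneg _) hq hqs)
    _ = _ := by
        rw [lintegral_add_left' (aemeasurable_enorm_rpow hf s), lintegral_const]; rfl

lemma tendsto_ofReal_one_sub_div_mul {s : ℝ} (hs : 0 < s) {M : ℝ≥0∞} (hM : M ≠ ∞) :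
    Tendsto (fun t : ℝ => ENNReal.ofReal (1 - t / s) * M) (𝓝 s) (𝓝 0) := by
  have h : Tendsto (fun t : ℝ => ENNReal.ofReal (1 - t / s)) (𝓝 s) (𝓝 0) := by
    have : Tendsto (fun t : ℝ => 1 - t / s) (𝓝 s) (𝓝 (1 - s / s)) :=
      tendsto_const_nhds.sub (tendsto_id.div_const s)
    rw [div_self hs.ne', sub_self] at this
    simpa using ENNReal.tendsto_ofReal this
  simpa using ENNReal.Tendsto.mul_const h (Or.inr hM)

/-- Fatou's lemma as `t → s⁻`. This is how estimates known only below the critical exponent, as for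
elements of `W10minus`, are recovered at the exponent itself. -/
lemma powInt_le_of_lt {s : ℝ} (hs : 1 < s) {f : α → F} (hf : AEStronglyMeasurable f μ)
    {B M : ℝ≥0∞} (hM : M ≠ ∞)
    (h : ∀ t, 1 < t → t < s → powInt μ t f ≤ B + ENNReal.ofReal (1 - t / s) * M) :
    powInt μ s f ≤ B := by
  have hs0 : 0 < s := by linarith
  calc powInt μ s f = ∫⁻ x, liminf (fun t : ℝ => ‖f x‖ₑ ^ t) (𝓝[<] s) ∂μ := by
        refine lintegral_congr fun x => (Tendsto.liminf_eq ?_).symm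
        have : Tendsto (fun t : ℝ => ENNReal.ofReal (‖f x‖ ^ t)) (𝓝[<] s)
            (𝓝 (ENNReal.ofReal (‖f x‖ ^ s))) := by
          refine ENNReal.tendsto_ofReal (Tendsto.mono_left ?_ nhdsWithin_le_nhds)
          exact tendsto_const_nhds.rpow tendsto_id (Or.inr hs0)
        rw [enorm_rpow_eq_ofReal _ hs0.le]
        refine this.congr' ?_
        filter_upwards [Ioo_mem_nhdsLT hs] with t ht
        rw [enorm_rpow_eq_ofReal _ (by linarith [ht.1])]
    _ ≤ liminf (fun t : ℝ => ∫⁻ x, ‖f x‖ₑ ^ t ∂μ) (𝓝[<] s) :=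
        lintegral_liminf_le' fun t => aemeasurable_enorm_rpow hf t
    _ ≤ liminf (fun t : ℝ => B + ENNReal.ofReal (1 - t / s) * M) (𝓝[<] s) := by
        refine liminf_le_liminf ?_
        filter_upwards [Ioo_mem_nhdsLT hs] with t ht
        exact h t ht.1 ht.2
    _ = B := by
        refine Tendsto.liminf_eq ?_
        simpa using Tendsto.const_add B
          ((tendsto_ofReal_one_sub_div_mul hs0 hM).mono_left nhdsWithin_le_nhds)

/-- Pointwise split at height `L`: below it, `a ^ (r - 1)` is at most `L ^ (r - 1)`; above it, `a ^
(r - t)` is at most `L ^ (r - t)` because `r - t ≤ 0`. A large `L` makes the second coefficient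
small when `r < t`. -/
lemma powInt_interpolate {r t L : ℝ} (hr : 1 ≤ r) (hrt : r ≤ t) (hL : 0 < L) {f : α → F}
    (hf : AEStronglyMeasurable f μ) :
    powInt μ r f ≤ ENNReal.ofReal (L ^ (r - 1)) * powInt μ 1 f +
      ENNReal.ofReal (L ^ (r - t)) * powInt μ t f := by
  have key : ∀ a : ℝ, 0 ≤ a → a ^ r ≤ L ^ (r - 1) * a ^ (1 : ℝ) + L ^ (r - t) * a ^ t := by
    intro a ha
    rcases ha.eq_or_lt with rfl | ha
    · rw [Real.zero_rpow (by linarith)]; positivity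
    rcases le_total a L with h | h
    · have : a ^ r ≤ L ^ (r - 1) * a ^ (1 : ℝ) := by
        calc a ^ r = a ^ (r - 1) * a ^ (1 : ℝ) := by rw [← Real.rpow_add ha]; ring_nf
          _ ≤ _ := by gcongr
      have h2 : 0 ≤ L ^ (r - t) * a ^ t := by positivity
      linarith
    · have : a ^ r ≤ L ^ (r - t) * a ^ t := by
        calc a ^ r = a ^ (r - t) * a ^ t := by rw [← Real.rpow_add ha]; ring_nf
          _ ≤ _ := by
            refine mul_le_mul_of_nonneg_right ?_ (by positivity)
            exact Real.rpow_le_rpow_of_nonpos hL h (by linarith)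
      have h2 : 0 ≤ L ^ (r - 1) * a ^ (1 : ℝ) := by positivity
      linarith
  unfold powInt
  rw [← lintegral_const_mul'' _ (aemeasurable_enorm_rpow hf _),
    ← lintegral_const_mul'' _ (aemeasurable_enorm_rpow hf _),
    ← lintegral_add_left' ((aemeasurable_enorm_rpow hf _).const_mul _)]
  refine lintegral_mono fun x => ?_
  rw [enorm_rpow_eq_ofReal _ (by linarith : 0 ≤ r), enorm_rpow_eq_ofReal _ zero_le_one,
    enorm_rpow_eq_ofReal _ (by linarith : 0 ≤ t), ← ENNReal.ofReal_mul (by positivity),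
    ← ENNReal.ofReal_mul (by positivity), ← ENNReal.ofReal_add (by positivity) (by positivity)]
  exact ENNReal.ofReal_le_ofReal (key _ (norm_nonneg _))

lemma powInt_add_le {s : ℝ} (hs : 1 ≤ s) {f g : α → F} (hf : AEStronglyMeasurable f μ) :
    powInt μ s (fun x => f x + g x) ≤ 2 ^ s * (powInt μ s f + powInt μ s g) := by
  unfold powInt
  rw [← lintegral_add_left' (aemeasurable_enorm_rpow hf s),
    ← lintegral_const_mul' _ _ (by finiteness)]
  refine lintegral_mono fun x => ?_
  calc ‖f x + g x‖ₑ ^ s ≤ (‖f x‖ₑ + ‖g x‖ₑ) ^ s := by gcongr; exact enorm_add_le _ _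
    _ ≤ 2 ^ (s - 1) * (‖f x‖ₑ ^ s + ‖g x‖ₑ ^ s) := ENNReal.rpow_add_le_mul_rpow_add_rpow _ _ hs
    _ ≤ _ := by gcongr <;> norm_num

lemma powInt_neg (s : ℝ) (f : α → F) : powInt μ s (fun x => -f x) = powInt μ s f := by
  simp [powInt]

lemma powInt_sub_le {s : ℝ} (hs : 1 ≤ s) {f g : α → F} (hf : AEStronglyMeasurable f μ) :
    powInt μ s (fun x => f x - g x) ≤ 2 ^ s * (powInt μ s f + powInt μ s g) := by
  simpa only [sub_eq_add_neg, powInt_neg] using powInt_add_le (g := fun x => -g x) hs hf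

/-- Lower semicontinuity of `∫ ‖f‖ ^ t` along `L¹` convergence. -/
lemma powInt_le_of_tendsto_L1 {t : ℝ} {f : ℕ → Lp F 1 μ} {g : Lp F 1 μ}
    (h : Tendsto f atTop (𝓝 g)) {B : ℝ≥0∞} (hB : ∀ n, powInt μ t (f n) ≤ B) :
    powInt μ t g ≤ B := by
  obtain ⟨ns, -, hns⟩ := (tendstoInMeasure_of_tendsto_Lp h).exists_seq_tendsto_ae
  calc powInt μ t g = ∫⁻ x, liminf (fun n => ‖f (ns n) x‖ₑ ^ t) atTop ∂μ := by
        refine lintegral_congr_ae ?_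
        filter_upwards [hns] with x hx
        exact (((ENNReal.continuous_rpow_const (y := t)).tendsto _).comp hx.enorm).liminf_eq.symm
    _ ≤ liminf (fun n => ∫⁻ x, ‖f (ns n) x‖ₑ ^ t ∂μ) atTop :=
        lintegral_liminf_le' fun n => aemeasurable_enorm_rpow (Lp.aestronglyMeasurable _) t
    _ ≤ liminf (fun _ : ℕ => B) atTop :=
        liminf_le_liminf (Eventually.of_forall fun n => hB _)
    _ = B := by simp

end PowInt

/-! ### Inclusions between Lebesgue spaces over a finite measure -/

section Inclusion

variable {α F : Type*} [MeasurableSpace α] [NormedAddCommGroup F] [NormedSpace ℝ F]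
  {μ : Measure α} [IsFiniteMeasure μ]

/-- The inclusion `L^q ⊆ L^p` for `p ≤ q` over a finite measure. -/
noncomputable def lpIncl {p q : ℝ≥0∞} (h : p ≤ q) : Lp F q μ →ₗ[ℝ] Lp F p μ where
  toFun f := ⟨f.1, Lp.antitone h f.2⟩
  map_add' _ _ := rfl
  map_smul' _ _ := rfl

lemma lpIncl_coe {p q : ℝ≥0∞} (h : p ≤ q) (f : Lp F q μ) :
    (lpIncl h f : α → F) = f := rfl

lemma exists_norm_lpIncl_le {p q : ℝ≥0∞} (h : p ≤ q) :
    ∃ C : ℝ, 0 < C ∧ ∀ f : Lp F q μ, ‖lpIncl h f‖ ≤ C * ‖f‖ := by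
  set e : ℝ := 1 / p.toReal - 1 / q.toReal
  rcases eq_or_ne (μ Set.univ) 0 with h0 | h0
  · refine ⟨1, one_pos, fun f => ?_⟩
    have : μ = 0 := Measure.measure_univ_eq_zero.1 h0
    have h1 : ‖lpIncl h f‖ = 0 := by
      rw [Lp.norm_def]; subst this; simp
    rw [h1, one_mul, Lp.norm_def]; exact ENNReal.toReal_nonneg
  · have hfin : μ Set.univ ^ e ≠ ∞ := by
      intro hh
      rcases ENNReal.rpow_eq_top_iff.1 hh with ⟨h1, -⟩ | ⟨h1, -⟩
      · exact h0 h1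
      · exact measure_ne_top _ _ h1
    refine ⟨(μ Set.univ ^ e).toReal, ?_, fun f => ?_⟩
    · exact ENNReal.toReal_pos (ENNReal.rpow_pos (pos_iff_ne_zero.2 h0)
        (measure_ne_top _ _)).ne' hfin
    · rw [Lp.norm_def, Lp.norm_def, ← ENNReal.toReal_mul, lpIncl_coe]
      refine ENNReal.toReal_mono (ENNReal.mul_ne_top hfin (Lp.eLpNorm_ne_top f)) ?_
      rw [mul_comm]
      exact eLpNorm_le_eLpNorm_mul_rpow_measure_univ h (Lp.aestronglyMeasurable f)

lemma continuous_lpIncl {p q : ℝ≥0∞} [Fact (1 ≤ p)] [Fact (1 ≤ q)] (h : p ≤ q) :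
    Continuous (lpIncl h : Lp F q μ →ₗ[ℝ] Lp F p μ) := by
  obtain ⟨C, -, hC⟩ := exists_norm_lpIncl_le (F := F) (μ := μ) h
  exact AddMonoidHomClass.continuous_of_bound (lpIncl h) C hC

end Inclusion

/-! ### Forward convex combinations in place of weak compactness -/

section ForwardConvex

/-- A sequence on which a functional with a modulus of strict convexity is bounded has, by
forward convex combinations, a point lying in the closure of every convex set that eventually
contains the sequence. -/
lemma exists_mem_closure_of_eventually_mem_convex {X : Type*} [NormedAddCommGroup X]
    [NormedSpace ℝ X] [CompleteSpace X] (f : ℕ → X) (Φ : X → ℝ) {M : ℝ} (h0 : ∀ x, 0 ≤ Φ x)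
    (hM : ∀ n, Φ (f n) ≤ M)
    (H : ∀ ε > 0, ∃ δ > 0, ∀ a ∈ convexHull ℝ (Set.range f), ∀ b ∈ convexHull ℝ (Set.range f),
      Φ a + Φ b - 2 * Φ ((1 / 2 : ℝ) • a + (1 / 2 : ℝ) • b) ≤ δ → ‖a - b‖ ≤ ε) :
    ∃ x, ∀ G : Set X, Convex ℝ G → (∀ᶠ k in atTop, f k ∈ G) → x ∈ closure G := by
  set D : ℕ → Set X := fun n => convexHull ℝ (f '' Set.Ici n) with hD
  have hDanti : ∀ {n k}, n ≤ k → D k ⊆ D n := fun {n k} h =>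
    convexHull_mono (Set.image_mono (Set.Ici_subset_Ici.2 h))
  have hDr : ∀ n, D n ⊆ convexHull ℝ (Set.range f) := fun n =>
    convexHull_mono (Set.image_subset_range _ _)
  have hfD : ∀ n, f n ∈ D n := fun n => subset_convexHull ℝ _ ⟨n, Set.self_mem_Ici, rfl⟩
  have hbdd : ∀ n, BddBelow (Φ '' D n) := fun n => ⟨0, by rintro _ ⟨x, -, rfl⟩; exact h0 x⟩
  -- The infima of `Φ` over the shrinking hulls `D n` increase and are bounded by `M`, hence
  -- converge; near-minimisers `w n ∈ D n` will form a Cauchy sequence.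
  set m : ℕ → ℝ := fun n => sInf (Φ '' D n) with hm
  have hmle : ∀ n x, x ∈ D n → m n ≤ Φ x := fun n x hx => csInf_le (hbdd n) ⟨x, hx, rfl⟩
  have hmono : Monotone m := fun n k h =>
    csInf_le_csInf (hbdd n) ⟨_, f k, hfD k, rfl⟩ (Set.image_mono (hDanti h))
  have hmM : ∀ n, m n ≤ M := fun n => (hmle n _ (hfD n)).trans (hM n)
  have hlim : Tendsto m atTop (𝓝 (⨆ n, m n)) :=
    tendsto_atTop_ciSup hmono ⟨M, by rintro _ ⟨n, rfl⟩; exact hmM n⟩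
  have hle : ∀ n, m n ≤ ⨆ n, m n := fun n =>
    le_ciSup (f := m) ⟨M, by rintro _ ⟨n, rfl⟩; exact hmM n⟩ n
  have hw : ∀ n : ℕ, ∃ w ∈ D n, Φ w < m n + 1 / ((n : ℝ) + 1) := fun n => by
    obtain ⟨_, ⟨w, hw, rfl⟩, hlt⟩ := exists_lt_of_csInf_lt (s := Φ '' D n)
      ⟨_, f n, hfD n, rfl⟩ (lt_add_of_pos_right (sInf (Φ '' D n)) (Nat.one_div_pos_of_nat (n := n)))
    exact ⟨w, hw, hlt⟩
  choose w hwD hwlt using hw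
  have hc : CauchySeq w := by
    rw [Metric.cauchySeq_iff']
    intro ε hε
    obtain ⟨δ, hδ, hH⟩ := H (ε / 2) (half_pos hε)
    have ht : Tendsto (fun n : ℕ => ((⨆ n, m n) - m n) + 2 * (1 / ((n : ℝ) + 1))) atTop (𝓝 0) := by
      have := (tendsto_const_nhds (x := ⨆ n, m n)).sub hlim |>.add
        (tendsto_one_div_add_atTop_nhds_zero_nat.const_mul 2)
      simpa using this
    obtain ⟨n, hn⟩ := (ht.eventually (gt_mem_nhds hδ)).exists
    refine ⟨n, fun k hk => ?_⟩
    rw [dist_eq_norm]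
    refine lt_of_le_of_lt (hH _ (hDr _ (hwD k)) _ (hDr _ (hwD n)) ?_) (half_lt_self hε)
    -- The midpoint stays in `D n`, so `Φ` is at least `m n` there. The convexity defect of `w k`
    -- and `w n` is therefore at most `(sup m - m n) + 2 / (n + 1)`, which is below `δ`.
    have hmid : (1 / 2 : ℝ) • w k + (1 / 2 : ℝ) • w n ∈ D n :=
      (convex_convexHull ℝ _) (hDanti hk (hwD k)) (hwD n) (by norm_num) (by norm_num) (by norm_num)
    have h1 := hmle n _ hmid
    have h2 := hwlt k
    have h3 := hwlt n
    have h4 := hle k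
    have h5 : 1 / ((k : ℝ) + 1) ≤ 1 / ((n : ℝ) + 1) := Nat.one_div_le_one_div hk
    linarith
  obtain ⟨x, hx⟩ := cauchySeq_tendsto_of_complete hc
  refine ⟨x, fun G hG hev => mem_closure_of_tendsto hx ?_⟩
  obtain ⟨n, hn⟩ := eventually_atTop.1 hev
  filter_upwards [eventually_ge_atTop n] with k hk
  refine convexHull_min ?_ hG (hwD k)
  rintro _ ⟨j, hj, rfl⟩
  exact hn j (hk.trans hj)

end ForwardConvex

/-! ### The strictly convex functional `∫ √(1 + ‖f‖²)` on `L¹` -/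

section SqrtOne

variable {E : Type*} [NormedAddCommGroup E]

/-- The strictly convex function `√(1 + ‖x‖²)`. -/
noncomputable def sqrtOne (x : E) : ℝ := √(1 + ‖x‖ ^ 2)

lemma sqrtOne_sq (x : E) : sqrtOne x ^ 2 = 1 + ‖x‖ ^ 2 := Real.sq_sqrt (by positivity)

lemma one_le_sqrtOne (x : E) : 1 ≤ sqrtOne x := Real.one_le_sqrt.2 (by nlinarith [norm_nonneg x])

lemma sqrtOne_le (x : E) : sqrtOne x ≤ 1 + ‖x‖ :=
  Real.sqrt_le_iff.2 ⟨by positivity, by nlinarith [norm_nonneg x]⟩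

lemma continuous_sqrtOne : Continuous (sqrtOne : E → ℝ) := by unfold sqrtOne; fun_prop

end SqrtOne

section Integrability

variable {α E : Type*} [MeasurableSpace α] [NormedAddCommGroup E] {μ : Measure α}

lemma integrable_norm_rpow_of_powInt {t : ℝ} (ht : 0 ≤ t) {f : α → E}
    (hf : AEStronglyMeasurable f μ) {B : ℝ≥0∞} (hB : B ≠ ∞) (h : powInt μ t f ≤ B) :
    Integrable (fun x => ‖f x‖ ^ t) μ ∧ ∫ x, ‖f x‖ ^ t ∂μ ≤ B.toReal := by
  have hm : AEStronglyMeasurable (fun x => ‖f x‖ ^ t) μ :=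
    (hf.norm.aemeasurable.pow_const t).aestronglyMeasurable
  have h1 : ∫⁻ x, ENNReal.ofReal (‖f x‖ ^ t) ∂μ = powInt μ t f :=
    lintegral_congr fun x => (enorm_rpow_eq_ofReal _ ht).symm
  have hnn : 0 ≤ᵐ[μ] fun x => ‖f x‖ ^ t := Eventually.of_forall fun x => by positivity
  refine ⟨(lintegral_ofReal_ne_top_iff_integrable hm hnn).1
    (h1 ▸ (h.trans_lt hB.lt_top).ne), ?_⟩
  rw [integral_eq_lintegral_of_nonneg_ae hnn hm, h1]
  exact ENNReal.toReal_mono hB h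

/-- The integral functional `∫ √(1 + ‖f‖²)` on `L¹`. -/
noncomputable def sqrtOneInt (f : Lp E 1 μ) : ℝ := ∫ x, sqrtOne (f x) ∂μ

lemma sqrtOneInt_nonneg (f : Lp E 1 μ) : 0 ≤ sqrtOneInt f :=
  integral_nonneg fun _ => zero_le_one.trans (one_le_sqrtOne _)

lemma integrable_sqrtOne [IsFiniteMeasure μ] (f : Lp E 1 μ) : Integrable (fun x => sqrtOne (f x)) μ := by
  refine ((integrable_const 1).add (L1.integrable_coeFn f).norm).mono'
    (continuous_sqrtOne.comp_aestronglyMeasurable (Lp.aestronglyMeasurable f))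
    (Eventually.of_forall fun x => ?_)
  rw [Real.norm_of_nonneg (zero_le_one.trans (one_le_sqrtOne _))]
  exact sqrtOne_le _

lemma sqrtOneInt_le [IsFiniteMeasure μ] (f : Lp E 1 μ) : sqrtOneInt f ≤ μ.real Set.univ + ‖f‖ := by
  calc sqrtOneInt f ≤ ∫ x, (1 + ‖f x‖) ∂μ :=
        integral_mono (integrable_sqrtOne f) ((integrable_const 1).add
          (L1.integrable_coeFn f).norm) fun x => sqrtOne_le _
    _ = _ := by
        rw [integral_add (integrable_const 1) (L1.integrable_coeFn f).norm, L1.norm_eq_integral_norm]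
        simp

end Integrability

/-! ### Modulus of convexity on sets bounded in `L^t` -/

section StrictConvexity

variable {α E : Type*} [MeasurableSpace α] [NormedAddCommGroup E] [InnerProductSpace ℝ E]
  {μ : Measure α}

/-- The midpoint convexity defect of `sqrtOne`. -/
noncomputable def sqrtOneDefect (a b : E) : ℝ :=
  sqrtOne a + sqrtOne b - 2 * sqrtOne ((1 / 2 : ℝ) • a + (1 / 2 : ℝ) • b)

/-- `sqrtOne x` is the Euclidean norm of `(1, x)`. With `A`, `B` the norms of `(1, a)`, `(1, b)` and
`1 + p` their inner product, Cauchy-Schwarz for `a`, `b` gives `‖a - b‖² ≤ (A B)² - (1 + p)² ≤ 2 A B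
(A B - (1 + p))`. The last factor is half of `(A + B)² - (2 m)²`, which in turn is at most `2 (A +
B)` times the defect. -/
lemma norm_sub_sq_le_defect (a b : E) :
    ‖a - b‖ ^ 2 ≤ 2 * (sqrtOne a * sqrtOne b) * (sqrtOne a + sqrtOne b) * sqrtOneDefect a b := by
  set A := sqrtOne a
  set B := sqrtOne b
  set m := sqrtOne ((1 / 2 : ℝ) • a + (1 / 2 : ℝ) • b) with hm
  set p : ℝ := inner ℝ a b
  have hA : 1 ≤ A := one_le_sqrtOne a
  have hB : 1 ≤ B := one_le_sqrtOne b
  have hm1 : 1 ≤ m := one_le_sqrtOne _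
  have hA2 : A ^ 2 = 1 + ‖a‖ ^ 2 := sqrtOne_sq a
  have hB2 : B ^ 2 = 1 + ‖b‖ ^ 2 := sqrtOne_sq b
  have hm2 : 4 * m ^ 2 = 4 + ‖a‖ ^ 2 + 2 * p + ‖b‖ ^ 2 := by
    rw [hm, sqrtOne_sq, ← smul_add, norm_smul, mul_pow, norm_add_sq_real]; norm_num; ring
  have hsub : ‖a - b‖ ^ 2 = ‖a‖ ^ 2 - 2 * p + ‖b‖ ^ 2 := norm_sub_sq_real a b
  have hcs : p ^ 2 ≤ ‖a‖ ^ 2 * ‖b‖ ^ 2 := by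
    rw [← mul_pow]; exact sq_le_sq' (by linarith [neg_le_of_abs_le (abs_real_inner_le_norm a b)])
      (real_inner_le_norm a b)
  have hprod : (A * B) ^ 2 = (1 + ‖a‖ ^ 2) * (1 + ‖b‖ ^ 2) := by rw [mul_pow, hA2, hB2]
  have hAB : 1 ≤ A * B := one_le_mul_of_one_le_of_one_le hA hB
  have h1 : ‖a - b‖ ^ 2 ≤ (A * B) ^ 2 - (1 + p) ^ 2 := by rw [hprod, hsub]; nlinarith
  have h2 : 1 + p ≤ A * B := by
    refine le_of_abs_le (abs_le_of_sq_le_sq ?_ (by linarith))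
    nlinarith [sq_nonneg ‖a - b‖]
  have h3 : ‖a - b‖ ^ 2 ≤ 2 * (A * B) * (A * B - (1 + p)) := by
    nlinarith [sq_nonneg (A * B - (1 + p))]
  have h4 : (A + B) ^ 2 - (2 * m) ^ 2 = 2 * (A * B - (1 + p)) := by
    have : (A + B) ^ 2 = A ^ 2 + B ^ 2 + 2 * (A * B) := by ring
    rw [this, mul_pow, hA2, hB2]; linarith
  have h5 : 2 * m ≤ A + B := by
    refine le_of_abs_le (abs_le_of_sq_le_sq ?_ (by linarith))
    linarith
  have h6 : 2 * (A * B - (1 + p)) ≤ 2 * (A + B) * (A + B - 2 * m) := by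
    rw [← h4]; linarith [sq_nonneg (A + B - 2 * m)]
  have h7 : ‖a - b‖ ^ 2 ≤ (A * B) * (2 * (A + B) * (A + B - 2 * m)) := by
    refine h3.trans ?_
    have := mul_le_mul_of_nonneg_left h6 (by linarith : 0 ≤ A * B)
    linarith
  calc ‖a - b‖ ^ 2 ≤ _ := h7
    _ = _ := by simp only [sqrtOneDefect]; ring

lemma sqrtOneDefect_nonneg (a b : E) : 0 ≤ sqrtOneDefect a b := by
  have h := (sq_nonneg _).trans (norm_sub_sq_le_defect a b)
  have hA := one_le_sqrtOne a
  have hB := one_le_sqrtOne b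
  exact nonneg_of_mul_nonneg_right h (by positivity)

/-- When both norms are at most `L`, the quadratic bound has a constant depending only on `L`, and
`‖a - b‖ ≤ η + ‖a - b‖² / η` linearises it. Otherwise the larger of the two norms exceeds `L`, and
`‖c‖ ≤ L ^ (1 - t) * ‖c‖ ^ t` makes it a tail term, small for large `L` since `t > 1`. -/
lemma norm_sub_le_defect {t η L : ℝ} (ht : 1 < t) (hη : 0 < η) (hL : 1 ≤ L) (a b : E) :
    ‖a - b‖ ≤ η + 2 * (1 + L) ^ 2 * (2 * (1 + L)) / η * sqrtOneDefect a b +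
      2 * L ^ (1 - t) * (‖a‖ ^ t + ‖b‖ ^ t) := by
  have hd := sqrtOneDefect_nonneg a b
  have hL0 : 0 < L := by linarith
  by_cases h : ‖a‖ ≤ L ∧ ‖b‖ ≤ L
  · have h1 := norm_sub_sq_le_defect a b
    have hA := (sqrtOne_le a).trans (by linarith [h.1] : 1 + ‖a‖ ≤ 1 + L)
    have hB := (sqrtOne_le b).trans (by linarith [h.2] : 1 + ‖b‖ ≤ 1 + L)
    have hA1 := one_le_sqrtOne a
    have hB1 := one_le_sqrtOne b
    have h2 : ‖a - b‖ ^ 2 ≤ 2 * (1 + L) ^ 2 * (2 * (1 + L)) * sqrtOneDefect a b := by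
      refine h1.trans (mul_le_mul_of_nonneg_right ?_ hd)
      have : sqrtOne a * sqrtOne b ≤ (1 + L) ^ 2 := by rw [sq]; gcongr
      have : sqrtOne a + sqrtOne b ≤ 2 * (1 + L) := by linarith
      gcongr
    have h3 : ‖a - b‖ ≤ η + ‖a - b‖ ^ 2 / η := by
      rw [← sub_nonneg]
      have : η + ‖a - b‖ ^ 2 / η - ‖a - b‖ =
        ((η - ‖a - b‖ / 2) ^ 2 + 3 / 4 * ‖a - b‖ ^ 2) / η := by field_simp; ring
      rw [this]; positivity
    have h4 : ‖a - b‖ ^ 2 / η ≤ 2 * (1 + L) ^ 2 * (2 * (1 + L)) / η * sqrtOneDefect a b := by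
      rw [div_mul_eq_mul_div]; gcongr
    have h5 : 0 ≤ 2 * L ^ (1 - t) * (‖a‖ ^ t + ‖b‖ ^ t) := by positivity
    linarith
  · have key : ∀ c : E, L ≤ ‖c‖ → ‖c‖ ≤ L ^ (1 - t) * ‖c‖ ^ t := fun c hc => by
      have hc0 : 0 < ‖c‖ := by linarith
      calc ‖c‖ = ‖c‖ ^ (1 - t) * ‖c‖ ^ t := by
            rw [← Real.rpow_add hc0]; simp
        _ ≤ _ := mul_le_mul_of_nonneg_right
            (Real.rpow_le_rpow_of_nonpos hL0 hc (by linarith)) (by positivity)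
    have hmain : ‖a‖ + ‖b‖ ≤ 2 * L ^ (1 - t) * (‖a‖ ^ t + ‖b‖ ^ t) := by
      have e1 : 0 ≤ L ^ (1 - t) * ‖a‖ ^ t := by positivity
      have e2 : 0 ≤ L ^ (1 - t) * ‖b‖ ^ t := by positivity
      rcases le_total ‖a‖ ‖b‖ with hab | hab
      · have : L ≤ ‖b‖ := by
          by_contra hh; exact h ⟨by linarith, by linarith⟩
        linarith [key b this]
      · have : L ≤ ‖a‖ := by
          by_contra hh; exact h ⟨by linarith, by linarith⟩
        linarith [key a this]
    have h6 : 0 ≤ 2 * (1 + L) ^ 2 * (2 * (1 + L)) / η * sqrtOneDefect a b := by positivity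
    linarith [norm_sub_le a b]

lemma sqrtOne_midpoint_ae (a b : Lp E 1 μ) :
    (fun x => sqrtOne (((1 / 2 : ℝ) • a + (1 / 2 : ℝ) • b : Lp E 1 μ) x)) =ᵐ[μ]
      fun x => sqrtOne ((1 / 2 : ℝ) • a x + (1 / 2 : ℝ) • b x) := by
  filter_upwards [Lp.coeFn_add ((1 / 2 : ℝ) • a) ((1 / 2 : ℝ) • b),
    Lp.coeFn_smul (1 / 2 : ℝ) a, Lp.coeFn_smul (1 / 2 : ℝ) b] with x h1 h2 h3
  rw [h1, Pi.add_apply, h2, h3, Pi.smul_apply, Pi.smul_apply]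

variable [IsFiniteMeasure μ]

lemma integrable_sqrtOneDefect (a b : Lp E 1 μ) :
    Integrable (fun x => sqrtOneDefect (a x) (b x)) μ :=
  ((integrable_sqrtOne a).add (integrable_sqrtOne b)).sub
    (((integrable_sqrtOne _).congr (sqrtOne_midpoint_ae a b)).const_mul 2)

lemma sqrtOneInt_defect (a b : Lp E 1 μ) :
    sqrtOneInt a + sqrtOneInt b - 2 * sqrtOneInt ((1 / 2 : ℝ) • a + (1 / 2 : ℝ) • b) =
      ∫ x, sqrtOneDefect (a x) (b x) ∂μ := by
  unfold sqrtOneInt sqrtOneDefect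
  have e := sqrtOne_midpoint_ae a b
  have hi := (integrable_sqrtOne ((1 / 2 : ℝ) • a + (1 / 2 : ℝ) • b)).congr e
  rw [integral_congr_ae e, ← integral_const_mul,
    ← integral_add (integrable_sqrtOne a) (integrable_sqrtOne b)]
  exact (integral_sub ((integrable_sqrtOne a).add (integrable_sqrtOne b)) (hi.const_mul 2)).symm

lemma sqrtOneInt_defect_nonneg (a b : Lp E 1 μ) :
    0 ≤ sqrtOneInt a + sqrtOneInt b - 2 * sqrtOneInt ((1 / 2 : ℝ) • a + (1 / 2 : ℝ) • b) := by
  rw [sqrtOneInt_defect]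
  exact integral_nonneg fun _ => sqrtOneDefect_nonneg _ _

/-- The functional `∫ √(1 + ‖f‖²)` has a modulus of strict convexity, with respect to the `L¹`
norm, on sets bounded in `L^t`, `t > 1`. -/
lemma exists_sqrtOneInt_modulus {t : ℝ} (ht : 1 < t) {B : ℝ≥0∞} (hB : B ≠ ∞) {ε : ℝ} (hε : 0 < ε) :
    ∃ δ > 0, ∀ a b : Lp E 1 μ, powInt μ t a ≤ B → powInt μ t b ≤ B →
      sqrtOneInt a + sqrtOneInt b - 2 * sqrtOneInt ((1 / 2 : ℝ) • a + (1 / 2 : ℝ) • b) ≤ δ →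
        ‖a - b‖ ≤ ε := by
  set V := μ.real Set.univ
  have hV : 0 ≤ V := measureReal_nonneg
  -- The three terms of `norm_sub_le_defect` are to integrate to at most `ε / 3` each: `η` handles
  -- the constant term, `L` the tail through the `L^t` bound, and `δ = ε / (3 * C)` the defect.
  set η := ε / (3 * (V + 1)) with hη
  have hη0 : 0 < η := by positivity
  have hlim : Tendsto (fun L : ℝ => 2 * L ^ (1 - t) * (B.toReal + B.toReal)) atTop (𝓝 0) := by
    have := (tendsto_rpow_neg_atTop (by linarith : 0 < t - 1)).const_mul 2 |>.mul_const
      (B.toReal + B.toReal)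
    simpa using this
  obtain ⟨L, hL, hL1⟩ := ((hlim.eventually (gt_mem_nhds (by positivity : 0 < ε / 3))).and
    (eventually_ge_atTop 1)).exists
  set C := 2 * (1 + L) ^ 2 * (2 * (1 + L)) / η with hC
  have hC0 : 0 < C := by positivity
  refine ⟨ε / (3 * C), by positivity, fun a b ha hb hab => ?_⟩
  rw [sqrtOneInt_defect] at hab
  obtain ⟨ia, la⟩ := integrable_norm_rpow_of_powInt (by linarith) (Lp.aestronglyMeasurable a) hB ha
  obtain ⟨ib, lb⟩ := integrable_norm_rpow_of_powInt (by linarith) (Lp.aestronglyMeasurable b) hB hb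
  have hsub : ‖a - b‖ = ∫ x, ‖a x - b x‖ ∂μ := by
    rw [L1.norm_eq_integral_norm]
    refine integral_congr_ae ?_
    filter_upwards [Lp.coeFn_sub a b] with x hx
    rw [hx, Pi.sub_apply]
  have idef := integrable_sqrtOneDefect a b
  rw [hsub]
  calc ∫ x, ‖a x - b x‖ ∂μ ≤ ∫ x, (η + C * sqrtOneDefect (a x) (b x) +
        2 * L ^ (1 - t) * (‖a x‖ ^ t + ‖b x‖ ^ t)) ∂μ := by
        refine integral_mono ((L1.integrable_coeFn a).sub (L1.integrable_coeFn b)).norm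
          (((integrable_const η).add (idef.const_mul C)).add ((ia.add ib).const_mul _)) fun x => ?_
        exact norm_sub_le_defect ht hη0 hL1 _ _
    _ = η * V + C * ∫ x, sqrtOneDefect (a x) (b x) ∂μ +
        2 * L ^ (1 - t) * (∫ x, ‖a x‖ ^ t ∂μ + ∫ x, ‖b x‖ ^ t ∂μ) := by
        have e1 : ∫ _ : α, η ∂μ = η * V := by simp [V, mul_comm]
        rw [← integral_add ia ib, ← integral_const_mul, ← integral_const_mul, ← e1,
          ← integral_add (integrable_const η) (idef.const_mul C)]
        exact integral_add ((integrable_const η).add (idef.const_mul C)) ((ia.add ib).const_mul _)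
    _ ≤ ε / 3 + ε / 3 + ε / 3 := by
        have h1 : η * V ≤ ε / 3 := by
          rw [hη, div_mul_eq_mul_div, div_le_div_iff₀ (by positivity) (by norm_num)]
          nlinarith
        have h2 : C * ∫ x, sqrtOneDefect (a x) (b x) ∂μ ≤ ε / 3 := by
          calc _ ≤ C * (ε / (3 * C)) := by gcongr
            _ = _ := by field_simp
        have h3 : 2 * L ^ (1 - t) * (∫ x, ‖a x‖ ^ t ∂μ + ∫ x, ‖b x‖ ^ t ∂μ) ≤ ε / 3 := by
          refine le_trans ?_ hL.le
          gcongr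
        linarith
    _ = ε := by ring

end StrictConvexity

/-! ### Weak gradients and Sobolev functions -/

variable {N : ℕ} {Ω : Opens (EuclideanSpace ℝ (Fin N))}

/-- Lebesgue measure on `Ω`. -/
noncomputable abbrev volOn (Ω : Opens (EuclideanSpace ℝ (Fin N))) :
    Measure (EuclideanSpace ℝ (Fin N)) :=
  volume.restrict (Ω : Set (EuclideanSpace ℝ (Fin N)))

section WeakGradient

/-- Weak gradients are unique. -/
lemma IsWeakGradient.ae_eq {u₁ u₂ : EuclideanSpace ℝ (Fin N) → ℝ}
    {g₁ g₂ : EuclideanSpace ℝ (Fin N) → EuclideanSpace ℝ (Fin N)}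
    (h₁ : IsWeakGradient Ω u₁ g₁) (h₂ : IsWeakGradient Ω u₂ g₂) (hu : u₁ =ᵐ[volOn Ω] u₂)
    (i₁ : LocallyIntegrable g₁ (volOn Ω)) (i₂ : LocallyIntegrable g₂ (volOn Ω)) :
    g₁ =ᵐ[volOn Ω] g₂ := by
  have key : ∀ᵐ x ∂(volOn Ω), x ∈ (Ω : Set (EuclideanSpace ℝ (Fin N))) → (g₁ - g₂) x = 0 := by
    refine Ω.isOpen.ae_eq_zero_of_integral_contDiff_smul_eq_zero
      ((i₁.sub i₂).locallyIntegrableOn _) fun ψ hψ hc hs => ?_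
    let φ : 𝓓(Ω, ℝ) := ⟨ψ, hψ, hc, hs⟩
    have j₁ : Integrable (fun x => ψ x • g₁ x) (volOn Ω) :=
      i₁.integrable_smul_left_of_hasCompactSupport hψ.continuous hc
    have j₂ : Integrable (fun x => ψ x • g₂ x) (volOn Ω) :=
      i₂.integrable_smul_left_of_hasCompactSupport hψ.continuous hc
    have e : ∀ (g : EuclideanSpace ℝ (Fin N) → EuclideanSpace ℝ (Fin N))
        (_ : Integrable (fun x => ψ x • g x) (volOn Ω)) (v : EuclideanSpace ℝ (Fin N)),
        inner ℝ v (∫ x, ψ x • g x ∂(volOn Ω)) = ∫ x, inner ℝ (g x) v * φ x ∂(volOn Ω) := by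
      intro g hg v
      rw [← integral_inner hg]
      refine integral_congr_ae (Eventually.of_forall fun x => ?_)
      simp only [real_inner_smul_right, real_inner_comm v (g x)]
      exact mul_comm _ _
    simp only [Pi.sub_apply, smul_sub]
    rw [integral_sub j₁ j₂]
    refine ext_inner_left ℝ fun v => ?_
    rw [inner_sub_right, e g₁ j₁, e g₂ j₂, inner_zero_right]
    have a₁ := h₁ φ v
    have a₂ := h₂ φ v
    have a₃ : ∫ x, u₁ x * fderiv ℝ φ x v ∂(volOn Ω) = ∫ x, u₂ x * fderiv ℝ φ x v ∂(volOn Ω) :=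
      integral_congr_ae (hu.mono fun x hx => by simp only [hx])
    change ∫ x, u₁ x * fderiv ℝ φ x v ∂(volOn Ω) = _ at a₁
    change ∫ x, u₂ x * fderiv ℝ φ x v ∂(volOn Ω) = _ at a₂
    change _ = -∫ x, inner ℝ (g₁ x) v * φ x ∂(volOn Ω) at a₁
    change _ = -∫ x, inner ℝ (g₂ x) v * φ x ∂(volOn Ω) at a₂
    linarith
  filter_upwards [key, ae_restrict_mem Ω.isOpen.measurableSet] with x hx hxΩ
  simpa [sub_eq_zero] using hx hxΩ

lemma sobGrad_ae_eq {p q : Exponent} {w : W1 Ω p} {w' : W1 Ω q}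
    (h : sobVal w =ᵐ[volOn Ω] sobVal w') : sobGrad w =ᵐ[volOn Ω] sobGrad w' :=
  IsWeakGradient.ae_eq w.2 w'.2 h (locallyIntegrable_coe _) (locallyIntegrable_coe _)

/-- By uniqueness of weak gradients the second component is determined by the first. -/
lemma W1.ext_val {p : Exponent} {w w' : W1 Ω p} (h : sobVal w =ᵐ[volOn Ω] sobVal w') : w = w' :=
  Subtype.ext (Prod.ext (Lp.ext h) (Lp.ext (sobGrad_ae_eq h)))

end WeakGradient

lemma Exponent.pos (p : Exponent) : (0 : ℝ) < p := zero_lt_one.trans p.2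

lemma Exponent.toReal_toENNReal (p : Exponent) : p.toENNReal.toReal = p :=
  ENNReal.toReal_ofReal p.pos.le

lemma Exponent.toENNReal_le {q p : Exponent} (h : q ≤ p) : q.toENNReal ≤ p.toENNReal :=
  ENNReal.ofReal_le_ofReal h

lemma powInt_coe {F : Type} [NormedAddCommGroup F] {p : Exponent} (f : LpOn Ω F p) :
    powInt (volOn Ω) p f = ENNReal.ofReal (‖f‖ ^ (p : ℝ)) := by
  have hp := p.pos
  have h0 : p.toENNReal ≠ 0 := by simpa using hp
  rw [← ENNReal.ofReal_rpow_of_nonneg (norm_nonneg _) hp.le, ofReal_norm, Lp.enorm_def,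
    eLpNorm_eq_lintegral_rpow_enorm_toReal h0 ENNReal.ofReal_ne_top, p.toReal_toENNReal,
    ← ENNReal.rpow_mul, one_div, inv_mul_cancel₀ hp.ne', ENNReal.rpow_one]
  rfl

lemma energy_eq {p : Exponent} (u : W1 Ω p) : energy u = ENNReal.ofReal (‖u.1.2‖ ^ (p : ℝ)) :=
  powInt_coe u.1.2

lemma energy_eq_powInt {p : Exponent} (u : W1 Ω p) : energy u = powInt (volOn Ω) p (sobGrad u) :=
  rfl

lemma powInt_sobVal {p : Exponent} (u : W1 Ω p) :
    powInt (volOn Ω) p (sobVal u) = ENNReal.ofReal (‖u.1.1‖ ^ (p : ℝ)) := powInt_coe u.1.1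

lemma mem_unitSet {p : Exponent} {V : Set (W1 Ω p)} {u : W1 Ω p} :
    u ∈ unitSet V ↔ u ∈ V ∧ powInt (volOn Ω) p (sobVal u) = 1 := Iff.rfl

lemma W1.aestronglyMeasurable_val {p : Exponent} (u : W1 Ω p) :
    AEStronglyMeasurable (sobVal u) (volOn Ω) := Lp.aestronglyMeasurable _

lemma W1.aestronglyMeasurable_grad {p : Exponent} (u : W1 Ω p) :
    AEStronglyMeasurable (sobGrad u) (volOn Ω) := Lp.aestronglyMeasurable _

lemma sobVal_sub {p : Exponent} (u v : W1 Ω p) :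
    sobVal (u - v) =ᵐ[volOn Ω] fun x => sobVal u x - sobVal v x := Lp.coeFn_sub u.1.1 v.1.1

lemma sobGrad_sub {p : Exponent} (u v : W1 Ω p) :
    sobGrad (u - v) =ᵐ[volOn Ω] fun x => sobGrad u x - sobGrad v x := Lp.coeFn_sub u.1.2 v.1.2

/-! ### Test functions inside the Sobolev spaces -/

section TestFunctions

lemma memLp_test (φ : 𝓓(Ω, ℝ)) (p : ℝ≥0∞) : MemLp φ p (volOn Ω) :=
  φ.continuous.memLp_of_hasCompactSupport φ.hasCompactSupport

lemma continuous_gradient_test (φ : 𝓓(Ω, ℝ)) : Continuous (gradient φ) :=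
  (InnerProductSpace.toDual ℝ _).symm.continuous.comp (φ.contDiff.continuous_fderiv (by simp))

lemma hasCompactSupport_gradient_test (φ : 𝓓(Ω, ℝ)) : HasCompactSupport (gradient φ) :=
  (φ.hasCompactSupport.fderiv ℝ).comp_left (map_zero _)

lemma memLp_gradient_test (φ : 𝓓(Ω, ℝ)) (p : ℝ≥0∞) : MemLp (gradient φ) p (volOn Ω) :=
  (continuous_gradient_test φ).memLp_of_hasCompactSupport (hasCompactSupport_gradient_test φ)

lemma isWeakGradient_test (φ : 𝓓(Ω, ℝ)) : IsWeakGradient Ω φ (gradient φ) := by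
  intro ψ v
  have e1 : ∫ x in (Ω : Set (EuclideanSpace ℝ (Fin N))), φ x * fderiv ℝ ψ x v =
      ∫ x, φ x * fderiv ℝ ψ x v :=
    setIntegral_eq_integral_of_forall_compl_eq_zero fun x hx => by
      rw [image_eq_zero_of_notMem_tsupport fun h => hx (φ.tsupport_subset h), zero_mul]
  have e2 : ∫ x in (Ω : Set (EuclideanSpace ℝ (Fin N))), inner ℝ (gradient φ x) v * ψ x =
      ∫ x, fderiv ℝ φ x v * ψ x := by
    simp only [inner_gradient_left]
    exact setIntegral_eq_integral_of_forall_compl_eq_zero fun x hx => by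
      rw [image_eq_zero_of_notMem_tsupport (f := ψ) fun h => hx (ψ.tsupport_subset h), mul_zero]
  have hd : ∀ ψ : 𝓓(Ω, ℝ), Continuous fun x => fderiv ℝ ψ x v := fun ψ =>
    (ψ.contDiff.continuous_fderiv (by simp)).clm_apply continuous_const
  rw [e1, e2]
  exact integral_mul_fderiv_eq_neg_fderiv_mul_of_integrable
    (((hd φ).mul ψ.continuous).integrable_of_hasCompactSupport ψ.hasCompactSupport.mul_left)
    ((φ.continuous.mul (hd ψ)).integrable_of_hasCompactSupport φ.hasCompactSupport.mul_right)
    ((φ.continuous.mul ψ.continuous).integrable_of_hasCompactSupport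
      φ.hasCompactSupport.mul_right)
    (fun x _ => (φ.contDiff.differentiable (by simp)).differentiableAt)
    (fun x _ => (ψ.contDiff.differentiable (by simp)).differentiableAt)

/-- A test function as an element of `W^{1,p}(Ω)`. -/
noncomputable def testElt (p : Exponent) (φ : 𝓓(Ω, ℝ)) : W1 Ω p :=
  ⟨((memLp_test φ _).toLp φ, (memLp_gradient_test φ _).toLp _), fun ψ v => by
    refine Eq.trans (integral_congr_ae ?_) ((isWeakGradient_test φ ψ v).trans
      (congrArg Neg.neg (integral_congr_ae ?_)))
    · exact (memLp_test φ _).coeFn_toLp.mono fun x hx => congrArg (· * fderiv ℝ ψ x v) hx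
    · exact (memLp_gradient_test φ _).coeFn_toLp.mono fun x hx =>
        congrArg (fun y => inner ℝ y v * ψ x) hx.symm⟩

lemma sobVal_testElt (p : Exponent) (φ : 𝓓(Ω, ℝ)) : sobVal (testElt p φ) =ᵐ[volOn Ω] φ :=
  (memLp_test φ _).coeFn_toLp

lemma sobGrad_testElt (p : Exponent) (φ : 𝓓(Ω, ℝ)) :
    sobGrad (testElt p φ) =ᵐ[volOn Ω] gradient φ :=
  (memLp_gradient_test φ _).coeFn_toLp

variable (Ω) in
/-- The test functions as a subspace of `W^{1,p}(Ω)`. -/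
noncomputable def testSubmodule (p : Exponent) : Submodule ℝ (W1 Ω p) where
  carrier := {u | ∃ φ : 𝓓(Ω, ℝ), sobVal u =ᵐ[volOn Ω] φ}
  zero_mem' := ⟨0, Lp.coeFn_zero _ _ _⟩
  add_mem' := by
    rintro a b ⟨φ, hφ⟩ ⟨ψ, hψ⟩
    refine ⟨φ + ψ, (Lp.coeFn_add a.1.1 b.1.1).trans ?_⟩
    filter_upwards [hφ, hψ] with x h1 h2
    exact congrArg₂ (· + ·) h1 h2
  smul_mem' := by
    rintro c a ⟨φ, hφ⟩
    refine ⟨c • φ, (Lp.coeFn_smul c a.1.1).trans ?_⟩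
    filter_upwards [hφ] with x h1
    exact congrArg (c • ·) h1

lemma testElt_mem (p : Exponent) (φ : 𝓓(Ω, ℝ)) : testElt p φ ∈ testSubmodule Ω p :=
  ⟨φ, sobVal_testElt p φ⟩

lemma exists_eq_testElt {p : Exponent} {u : W1 Ω p} (h : u ∈ testSubmodule Ω p) :
    ∃ φ : 𝓓(Ω, ℝ), u = testElt p φ := by
  obtain ⟨φ, hφ⟩ := h
  exact ⟨φ, W1.ext_val (hφ.trans (sobVal_testElt p φ).symm)⟩

variable (Ω) in
/-- `W^{1,p}_0(Ω)` as a subspace. -/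
noncomputable def W10Submodule (p : Exponent) : Submodule ℝ (W1 Ω p) := (testSubmodule Ω p).topologicalClosure

lemma coe_W10Submodule (p : Exponent) : (W10Submodule Ω p : Set (W1 Ω p)) = W10 Ω p :=
  Submodule.topologicalClosure_coe _

lemma isClosed_W10 (p : Exponent) : IsClosed (W10 Ω p) := isClosed_closure

lemma testElt_mem_W10 (p : Exponent) (φ : 𝓓(Ω, ℝ)) : testElt p φ ∈ W10 Ω p :=
  subset_closure (testElt_mem p φ)

end TestFunctions

/-! ### Inclusions of Sobolev spaces and closedness of the weak gradient relation -/

section Inclusions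

variable [IsFiniteMeasure (volOn Ω)]

/-- The inclusion `W^{1,p}(Ω) ⊆ W^{1,q}(Ω)` for `q ≤ p`. -/
noncomputable def W1.incl {q p : Exponent} (h : q ≤ p) : W1 Ω p →ₗ[ℝ] W1 Ω q where
  -- The underlying functions do not change, so the weak gradient identity `w.2` is reused as it
  -- stands.
  toFun w := ⟨(lpIncl (Exponent.toENNReal_le h) w.1.1, lpIncl (Exponent.toENNReal_le h) w.1.2), w.2⟩
  map_add' _ _ := rfl
  map_smul' _ _ := rfl

@[simp] lemma sobGrad_incl {q p : Exponent} (h : q ≤ p) (w : W1 Ω p) :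
    sobGrad (W1.incl h w) = sobGrad w := rfl

lemma W1.continuous_incl {q p : Exponent} (h : q ≤ p) :
    Continuous (W1.incl h : W1 Ω p →ₗ[ℝ] W1 Ω q) := by
  refine Continuous.subtype_mk ?_ _
  exact ((continuous_lpIncl _).comp (continuous_fst.comp continuous_subtype_val)).prodMk
    ((continuous_lpIncl _).comp (continuous_snd.comp continuous_subtype_val))

lemma W1.incl_mem_W10 {q p : Exponent} (h : q ≤ p) {w : W1 Ω p} (hw : w ∈ W10 Ω p) :
    W1.incl h w ∈ W10 Ω q :=
  map_mem_closure (W1.continuous_incl h) hw fun _ hu => hu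

lemma mem_W10minus_iff {p : Exponent} {u : W1 Ω p} :
    u ∈ W10minus Ω p ↔ ∀ (s : Exponent) (h : s < p), W1.incl h.le u ∈ W10 Ω s := by
  constructor
  · intro hu s h
    obtain ⟨w, hw, hwu⟩ := hu s h
    rwa [W1.ext_val (w := W1.incl h.le u) (w' := w) hwu.symm]
  · exact fun hu s h => ⟨_, hu s h, EventuallyEq.rfl⟩

variable (Ω) in
/-- `W^{1,p₋}_0(Ω)` as a subspace. -/
noncomputable def W10minusSubmodule (p : Exponent) : Submodule ℝ (W1 Ω p) :=
  ⨅ (s : Exponent) (h : s < p), (W10Submodule Ω s).comap (W1.incl h.le)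

lemma coe_W10minusSubmodule (p : Exponent) :
    (W10minusSubmodule Ω p : Set (W1 Ω p)) = W10minus Ω p := by
  ext u
  rw [mem_W10minus_iff]
  simp only [W10minusSubmodule, SetLike.mem_coe, Submodule.mem_iInf, Submodule.mem_comap]
  simp only [← SetLike.mem_coe, coe_W10Submodule]

lemma W10_subset_W10minus (p : Exponent) : W10 Ω p ⊆ W10minus Ω p := fun _ hu =>
  mem_W10minus_iff.2 fun _ h => W1.incl_mem_W10 h.le hu

/-- Integration against a bounded function is continuous on `L¹`. -/
lemma continuous_integral_mul {α F : Type*} [MeasurableSpace α] [NormedAddCommGroup F]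
    [NormedSpace ℝ F] {μ : Measure α} (T : F →L[ℝ] ℝ) {ψ : α → ℝ} (hψ : AEStronglyMeasurable ψ μ)
    {C : ℝ} (hC : ∀ x, |ψ x| ≤ C) :
    Continuous fun u : Lp F 1 μ => ∫ x, T (u x) * ψ x ∂μ := by
  have hint : ∀ u : Lp F 1 μ, Integrable (fun x => T (u x) * ψ x) μ := fun u =>
    (T.integrable_comp (L1.integrable_coeFn u)).mul_bdd hψ (Eventually.of_forall hC)
  refine LipschitzWith.continuous (K := (‖T‖ * C).toNNReal)
    (LipschitzWith.of_dist_le_mul fun u v => ?_)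
  rw [Real.dist_eq, ← Real.norm_eq_abs, ← integral_sub (hint u) (hint v), dist_eq_norm, L1.norm_eq_integral_norm,
    ← integral_const_mul]
  refine norm_integral_le_of_norm_le ((L1.integrable_coeFn (u - v)).norm.const_mul _) ?_
  filter_upwards [Lp.coeFn_sub u v] with x hx
  rw [hx, Pi.sub_apply, ← sub_mul, ← map_sub, norm_mul]
  calc ‖T (u x - v x)‖ * ‖ψ x‖ ≤ (‖T‖ * ‖u x - v x‖) * C :=
        mul_le_mul (T.le_opNorm _) (hC x) (norm_nonneg _) (by positivity)
    _ = ‖T‖ * C * ‖u x - v x‖ := by ring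
    _ ≤ _ := mul_le_mul_of_nonneg_right (Real.le_coe_toNNReal _) (norm_nonneg _)

/-- The forgetful map from `L^p(Ω)` to `L¹(Ω)`. -/
noncomputable def toL1 {F : Type} [NormedAddCommGroup F] [NormedSpace ℝ F] (p : Exponent) :
    LpOn Ω F p →ₗ[ℝ] Lp F 1 (volOn Ω) := lpIncl (Fact.out : 1 ≤ p.toENNReal)

lemma continuous_toL1 {F : Type} [NormedAddCommGroup F] [NormedSpace ℝ F] (p : Exponent) :
    Continuous (toL1 p : LpOn Ω F p →ₗ[ℝ] Lp F 1 (volOn Ω)) := continuous_lpIncl _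

/-- For fixed `φ` and `v` both sides of the defining identity are integrals against bounded
functions, hence continuous already for the `L¹` topology. -/
lemma isClosed_W1 (p : Exponent) :
    IsClosed (W1 Ω p : Set (LpOn Ω ℝ p × LpOn Ω (EuclideanSpace ℝ (Fin N)) p)) := by
  have : (W1 Ω p : Set (LpOn Ω ℝ p × LpOn Ω (EuclideanSpace ℝ (Fin N)) p)) =
      ⋂ (φ : 𝓓(Ω, ℝ)) (v : EuclideanSpace ℝ (Fin N)),
        {w | ∫ x, w.1 x * fderiv ℝ φ x v ∂(volOn Ω) =
          -∫ x, inner ℝ (w.2 x) v * φ x ∂(volOn Ω)} := by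
    ext w
    simp only [Set.mem_iInter]
    exact Iff.rfl
  rw [this]
  refine isClosed_iInter fun φ => isClosed_iInter fun v => isClosed_eq ?_ ?_
  · have hc : Continuous fun x => fderiv ℝ φ x v :=
      (φ.contDiff.continuous_fderiv (by simp)).clm_apply continuous_const
    have hs : HasCompactSupport fun x => fderiv ℝ φ x v := φ.hasCompactSupport.fderiv_apply ℝ v
    obtain ⟨C, hC⟩ := hc.bounded_above_of_compact_support hs
    exact (continuous_integral_mul (ContinuousLinearMap.id ℝ ℝ) hc.aestronglyMeasurable hC).comp
      ((continuous_toL1 p).comp continuous_fst)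
  · obtain ⟨C, hC⟩ := φ.continuous.bounded_above_of_compact_support φ.hasCompactSupport
    have h := (continuous_integral_mul (μ := volOn Ω) (innerSL ℝ v)
      φ.continuous.aestronglyMeasurable hC).comp ((continuous_toL1 p).comp
        (continuous_snd (X := LpOn Ω ℝ p)))
    refine (h.congr fun w => ?_).neg
    refine integral_congr_ae (Eventually.of_forall fun x => ?_)
    simp only [innerSL_apply_apply]
    rw [real_inner_comm]
    rfl


end Inclusions

/-! ### Ball averages: a Poincaré-type estimate uniform in the exponent -/

section FiniteRank

variable {N : ℕ}

/-- Jensen's inequality for powers. -/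
lemma lintegral_rpow_le {α : Type*} [MeasurableSpace α] {P : Measure α} [IsProbabilityMeasure P]
    {f : α → ℝ≥0∞} (hf : AEMeasurable f P) {t : ℝ} (ht : 1 ≤ t) :
    (∫⁻ x, f x ∂P) ^ t ≤ ∫⁻ x, f x ^ t ∂P := by
  have ht0 : 0 < t := by linarith
  have h := eLpNorm_le_eLpNorm_of_exponent_le (μ := P) (p := 1) (q := ENNReal.ofReal t) (f := f)
    (by simpa using ENNReal.ofReal_le_ofReal ht) hf.aestronglyMeasurable
  rw [eLpNorm_one_eq_lintegral_enorm, eLpNorm_eq_lintegral_rpow_enorm_toReal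
    (by simpa using ht0) ENNReal.ofReal_ne_top, ENNReal.toReal_ofReal ht0.le] at h
  simp only [enorm_eq_self] at h
  calc (∫⁻ x, f x ∂P) ^ t ≤ ((∫⁻ x, f x ^ t ∂P) ^ (1 / t)) ^ t := ENNReal.rpow_le_rpow h ht0.le
    _ = _ := by rw [← ENNReal.rpow_mul, one_div, inv_mul_cancel₀ ht0.ne', ENNReal.rpow_one]

/-- The fundamental theorem of calculus along the segment from `x` to `x + h`, followed by Jensen's
inequality on `(0, 1]`. -/
lemma enorm_sub_rpow_le {φ : EuclideanSpace ℝ (Fin N) → ℝ} (hφ : ContDiff ℝ 1 φ)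
    (x h : EuclideanSpace ℝ (Fin N)) {t : ℝ} (ht : 1 ≤ t) :
    ‖φ (x + h) - φ x‖ₑ ^ t ≤
      ∫⁻ τ in Set.Ioc (0 : ℝ) 1, ‖h‖ₑ ^ t * ‖gradient φ (x + τ • h)‖ₑ ^ t := by
  have hcd : Continuous (fderiv ℝ φ) := hφ.continuous_fderiv (by simp)
  have hc : Continuous fun τ : ℝ => fderiv ℝ φ (x + τ • h) h := by fun_prop
  have e : φ (x + h) - φ x = ∫ τ in (0 : ℝ)..1, fderiv ℝ φ (x + τ • h) h := by
    rw [intervalIntegral.integral_eq_sub_of_hasDerivAt (f := fun τ : ℝ => φ (x + τ • h))]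
    · simp
    · intro τ _
      have h1 : HasDerivAt (fun τ : ℝ => x + τ • h) h τ := by
        simpa using ((hasDerivAt_id τ).smul_const h).const_add x
      exact ((hφ.differentiable (by simp)) _).hasFDerivAt.comp_hasDerivAt τ h1
    · exact hc.intervalIntegrable _ _
  rw [e, intervalIntegral.integral_of_le zero_le_one]
  have : IsProbabilityMeasure (volume.restrict (Set.Ioc (0 : ℝ) 1)) := ⟨by simp⟩
  calc ‖∫ τ in Set.Ioc (0 : ℝ) 1, fderiv ℝ φ (x + τ • h) h‖ₑ ^ t
      ≤ (∫⁻ τ in Set.Ioc (0 : ℝ) 1, ‖fderiv ℝ φ (x + τ • h) h‖ₑ) ^ t :=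
        ENNReal.rpow_le_rpow (enorm_integral_le_lintegral_enorm _) (by linarith)
    _ ≤ ∫⁻ τ in Set.Ioc (0 : ℝ) 1, ‖fderiv ℝ φ (x + τ • h) h‖ₑ ^ t :=
        lintegral_rpow_le hc.enorm.measurable.aemeasurable ht
    _ ≤ _ := by
        refine lintegral_mono fun τ => ?_
        rw [← ENNReal.mul_rpow_of_nonneg _ _ (by linarith)]
        refine ENNReal.rpow_le_rpow ?_ (by linarith)
        rw [← inner_gradient_left, mul_comm, ← ofReal_norm, ← ofReal_norm, ← ofReal_norm,
          ← ENNReal.ofReal_mul (norm_nonneg _)]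
        exact ENNReal.ofReal_le_ofReal (norm_inner_le_norm _ _)

/-- Integrating the pointwise bound in `x` and exchanging the integrals, translation invariance
removes the shift `τ • h`. -/
lemma powInt_translate_sub_le {φ : EuclideanSpace ℝ (Fin N) → ℝ} (hφ : ContDiff ℝ 1 φ)
    (h : EuclideanSpace ℝ (Fin N)) {t : ℝ} (ht : 1 ≤ t) :
    powInt volume t (fun x => φ (x + h) - φ x) ≤ ‖h‖ₑ ^ t * powInt volume t (gradient φ) := by
  have hcd : Continuous (gradient φ) :=
    (InnerProductSpace.toDual ℝ _).symm.continuous.comp (hφ.continuous_fderiv (by simp))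
  have hm : Measurable fun p : EuclideanSpace ℝ (Fin N) × ℝ =>
      ‖h‖ₑ ^ t * ‖gradient φ (p.1 + p.2 • h)‖ₑ ^ t := by
    have : Continuous fun p : EuclideanSpace ℝ (Fin N) × ℝ => gradient φ (p.1 + p.2 • h) := by
      fun_prop
    exact (this.enorm.measurable.pow_const t).const_mul _
  calc powInt volume t (fun x => φ (x + h) - φ x)
      ≤ ∫⁻ x, ∫⁻ τ in Set.Ioc (0 : ℝ) 1, ‖h‖ₑ ^ t * ‖gradient φ (x + τ • h)‖ₑ ^ t :=
        lintegral_mono fun x => enorm_sub_rpow_le hφ x h ht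
    _ = ∫⁻ τ in Set.Ioc (0 : ℝ) 1, ∫⁻ x, ‖h‖ₑ ^ t * ‖gradient φ (x + τ • h)‖ₑ ^ t :=
        lintegral_lintegral_swap hm.aemeasurable
    _ = ∫⁻ _ in Set.Ioc (0 : ℝ) 1, ‖h‖ₑ ^ t * powInt volume t (gradient φ) := by
        refine lintegral_congr fun τ => ?_
        rw [lintegral_const_mul' _ _ (by finiteness)]
        congr 1
        exact lintegral_add_right_eq_self (fun x => ‖gradient φ x‖ₑ ^ t) (τ • h)
    _ = _ := by simp

/-- The average over the ball of radius `ε` around `z` of the extension of `u` by zero outside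
`Ω`. -/
noncomputable def ballAvg (Ω : Opens (EuclideanSpace ℝ (Fin N))) (ε : ℝ)
    (u : EuclideanSpace ℝ (Fin N) → ℝ) (z : EuclideanSpace ℝ (Fin N)) : ℝ :=
  (volume.real (Metric.ball (0 : EuclideanSpace ℝ (Fin N)) ε))⁻¹ *
    ∫ x in Metric.ball z ε, u x ∂(volOn Ω)

variable {Ω : Opens (EuclideanSpace ℝ (Fin N))}

lemma ballAvg_congr {ε : ℝ} {u v : EuclideanSpace ℝ (Fin N) → ℝ} (h : u =ᵐ[volOn Ω] v)
    (z : EuclideanSpace ℝ (Fin N)) : ballAvg Ω ε u z = ballAvg Ω ε v z := by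
  unfold ballAvg
  rw [integral_congr_ae (ae_restrict_of_ae h)]

lemma ballAvg_sub {ε : ℝ} {u v : EuclideanSpace ℝ (Fin N) → ℝ} (hu : Integrable u (volOn Ω))
    (hv : Integrable v (volOn Ω)) (z : EuclideanSpace ℝ (Fin N)) :
    ballAvg Ω ε (fun x => u x - v x) z = ballAvg Ω ε u z - ballAvg Ω ε v z := by
  unfold ballAvg
  rw [integral_sub hu.integrableOn hv.integrableOn, mul_sub]

lemma abs_ballAvg_le {ε : ℝ} {u : EuclideanSpace ℝ (Fin N) → ℝ} (hu : Integrable u (volOn Ω))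
    (z : EuclideanSpace ℝ (Fin N)) :
    |ballAvg Ω ε u z| ≤ (volume.real (Metric.ball (0 : EuclideanSpace ℝ (Fin N)) ε))⁻¹ *
      ∫ x, |u x| ∂(volOn Ω) := by
  unfold ballAvg
  rw [abs_mul, abs_of_nonneg (inv_nonneg.2 measureReal_nonneg)]
  refine mul_le_mul_of_nonneg_left ?_ (inv_nonneg.2 measureReal_nonneg)
  calc |∫ x in Metric.ball z ε, u x ∂(volOn Ω)| ≤ ∫ x in Metric.ball z ε, |u x| ∂(volOn Ω) :=
        abs_integral_le_integral_abs
    _ ≤ _ := setIntegral_le_integral hu.abs (Eventually.of_forall fun x => abs_nonneg _)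

lemma continuous_ballAvg (ε : ℝ) (z : EuclideanSpace ℝ (Fin N)) :
    Continuous fun u : Lp ℝ 1 (volOn Ω) => ballAvg Ω ε u z := by
  have hm : AEStronglyMeasurable ((Metric.ball z ε).indicator fun _ => (1 : ℝ)) (volOn Ω) :=
    (aestronglyMeasurable_const).indicator measurableSet_ball
  have h := continuous_integral_mul (μ := volOn Ω) (ContinuousLinearMap.id ℝ ℝ) hm (C := 1)
    (fun x => by by_cases hx : x ∈ Metric.ball z ε <;> simp [hx])
  refine continuous_const.mul (h.congr fun u => ?_)
  rw [← integral_indicator measurableSet_ball]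
  refine integral_congr_ae (Eventually.of_forall fun x => ?_)
  by_cases hx : x ∈ Metric.ball z ε <;> simp [hx]

lemma ballAvg_test (φ : 𝓓(Ω, ℝ)) (ε : ℝ) (z : EuclideanSpace ℝ (Fin N)) :
    ballAvg Ω ε φ z = (volume.real (Metric.ball (0 : EuclideanSpace ℝ (Fin N)) ε))⁻¹ *
      ∫ x in Metric.ball z ε, φ x := by
  unfold ballAvg
  rw [volOn, Measure.restrict_restrict measurableSet_ball, Set.inter_comm,
    ← Measure.restrict_restrict Ω.isOpen.measurableSet]
  congr 1
  refine setIntegral_eq_integral_of_forall_compl_eq_zero fun x hx => ?_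
  exact image_eq_zero_of_notMem_tsupport fun h => hx (φ.tsupport_subset h)

/-- The left side is the mean of `φ x - φ w` over `w` in the `ε`-ball around `z`, so Jensen applies.
That ball lies in the `2 * ε`-ball around `x`, which after recentring makes the bound independent of
`z`. -/
lemma enorm_sub_ballAvg_rpow_le (φ : 𝓓(Ω, ℝ)) {ε : ℝ} (hε : 0 < ε)
    {x z : EuclideanSpace ℝ (Fin N)} (hxz : dist x z < ε) {t : ℝ} (ht : 1 ≤ t) :
    ‖φ x - ballAvg Ω ε φ z‖ₑ ^ t ≤
      (volume (Metric.ball (0 : EuclideanSpace ℝ (Fin N)) ε))⁻¹ *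
        ∫⁻ h in Metric.ball (0 : EuclideanSpace ℝ (Fin N)) (2 * ε), ‖φ (x + h) - φ x‖ₑ ^ t := by
  set V := volume (Metric.ball (0 : EuclideanSpace ℝ (Fin N)) ε) with hV
  have hV0 : V ≠ 0 := (Metric.measure_ball_pos volume _ hε).ne'
  have hVt : V ≠ ∞ := measure_ball_lt_top.ne
  have hVz : volume (Metric.ball z ε) = V := Measure.addHaar_ball_center _ _ _
  set P := V⁻¹ • volume.restrict (Metric.ball z ε) with hP
  have : IsProbabilityMeasure P := ⟨by
    rw [hP, Measure.smul_apply, Measure.restrict_apply_univ, hVz, smul_eq_mul,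
      ENNReal.inv_mul_cancel hV0 hVt]⟩
  have hi : Integrable φ P :=
    ((φ.continuous.integrable_of_hasCompactSupport φ.hasCompactSupport).integrableOn).smul_measure
      (ENNReal.inv_ne_top.2 hV0)
  have e : φ x - ballAvg Ω ε φ z = ∫ w, (φ x - φ w) ∂P := by
    rw [integral_sub (integrable_const _) hi, integral_const, probReal_univ, one_smul,
      ballAvg_test, hP, integral_smul_measure, smul_eq_mul, ENNReal.toReal_inv]
    rfl
  calc ‖φ x - ballAvg Ω ε φ z‖ₑ ^ t ≤ (∫⁻ w, ‖φ x - φ w‖ₑ ∂P) ^ t := by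
        rw [e]; exact ENNReal.rpow_le_rpow (enorm_integral_le_lintegral_enorm _) (by linarith)
    _ ≤ ∫⁻ w, ‖φ x - φ w‖ₑ ^ t ∂P :=
        lintegral_rpow_le (continuous_const.sub φ.continuous).enorm.measurable.aemeasurable ht
    _ = V⁻¹ * ∫⁻ w in Metric.ball z ε, ‖φ x - φ w‖ₑ ^ t := by
        rw [hP, lintegral_smul_measure, smul_eq_mul]
    _ ≤ V⁻¹ * ∫⁻ w in Metric.ball x (2 * ε), ‖φ x - φ w‖ₑ ^ t := by
        gcongr
        exact Metric.ball_subset_ball' (by rw [dist_comm]; linarith)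
    _ = _ := by
        congr 1
        rw [← lintegral_indicator measurableSet_ball, ← lintegral_indicator measurableSet_ball,
          ← lintegral_add_left_eq_self _ x]
        refine lintegral_congr fun h => ?_
        by_cases hh : h ∈ Metric.ball (0 : EuclideanSpace ℝ (Fin N)) (2 * ε)
        · rw [Set.indicator_of_mem hh, Set.indicator_of_mem (by simpa using hh), ← enorm_neg,
            neg_sub]
        · rw [Set.indicator_of_notMem hh, Set.indicator_of_notMem (by simpa using hh)]

/-- The pointwise bound does not involve the choice of `y x`, so Fubini reduces the estimate to
translations by `h` with `‖h‖ < 2 * ε`. The factor `2 ^ N` is the ratio of the volumes of the balls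
of radii `2 * ε` and `ε`. -/
lemma powInt_test_sub_ballAvg_le (φ : 𝓓(Ω, ℝ)) {ε : ℝ} (hε : 0 < ε)
    {y : EuclideanSpace ℝ (Fin N) → EuclideanSpace ℝ (Fin N)} (hy : ∀ x, dist x (y x) < ε)
    {t : ℝ} (ht : 1 ≤ t) :
    powInt (volOn Ω) t (fun x => φ x - ballAvg Ω ε φ (y x)) ≤
      ENNReal.ofReal (2 ^ N * (2 * ε) ^ t) * powInt (volOn Ω) t (gradient φ) := by
  set V := volume (Metric.ball (0 : EuclideanSpace ℝ (Fin N)) ε) with hV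
  have hV0 : V ≠ 0 := (Metric.measure_ball_pos volume _ hε).ne'
  have hVt : V ≠ ∞ := measure_ball_lt_top.ne
  have hV2 : volume (Metric.ball (0 : EuclideanSpace ℝ (Fin N)) (2 * ε)) =
      ENNReal.ofReal (2 ^ N) * V := by
    rw [Measure.addHaar_ball_mul_of_pos _ _ two_pos, finrank_euclideanSpace_fin]
  have hφ : ContDiff ℝ 1 φ := φ.contDiff.of_le (by norm_cast)
  have hgrad : powInt volume t (gradient φ) = powInt (volOn Ω) t (gradient φ) := by
    unfold powInt
    refine (setLIntegral_eq_of_support_subset ?_).symm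
    intro x hx
    by_contra hxΩ
    refine hx ?_
    have : fderiv ℝ φ x = 0 := by
      have : x ∉ tsupport (fderiv ℝ φ) := fun h =>
        hxΩ (φ.tsupport_subset (tsupport_fderiv_subset ℝ h))
      exact image_eq_zero_of_notMem_tsupport this
    simp only [gradient, this, map_zero, enorm_zero]
    exact ENNReal.zero_rpow_of_pos (by linarith)
  have hm : Measurable fun p : EuclideanSpace ℝ (Fin N) × EuclideanSpace ℝ (Fin N) =>
      ‖φ (p.1 + p.2) - φ p.1‖ₑ ^ t := by
    have : Continuous fun p : EuclideanSpace ℝ (Fin N) × EuclideanSpace ℝ (Fin N) =>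
      φ (p.1 + p.2) - φ p.1 := by fun_prop
    exact this.enorm.measurable.pow_const t
  calc powInt (volOn Ω) t (fun x => φ x - ballAvg Ω ε φ (y x))
      ≤ ∫⁻ x, V⁻¹ * (∫⁻ h in Metric.ball (0 : EuclideanSpace ℝ (Fin N)) (2 * ε),
          ‖φ (x + h) - φ x‖ₑ ^ t) :=
        (setLIntegral_le_lintegral _ _).trans
          (lintegral_mono fun x => enorm_sub_ballAvg_rpow_le φ hε (hy x) ht)
    _ = V⁻¹ * ∫⁻ h in Metric.ball (0 : EuclideanSpace ℝ (Fin N)) (2 * ε),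
          powInt volume t (fun x => φ (x + h) - φ x) := by
        rw [lintegral_const_mul' _ _ (ENNReal.inv_ne_top.2 hV0),
          lintegral_lintegral_swap hm.aemeasurable]
        rfl
    _ ≤ V⁻¹ * ∫⁻ _ in Metric.ball (0 : EuclideanSpace ℝ (Fin N)) (2 * ε),
          ENNReal.ofReal ((2 * ε) ^ t) * powInt (volOn Ω) t (gradient φ) := by
        refine mul_le_mul_right (setLIntegral_mono measurable_const fun h hh => ?_) _
        refine (powInt_translate_sub_le hφ h ht).trans ?_
        rw [hgrad, enorm_rpow_eq_ofReal _ (by linarith)]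
        gcongr
        exact (mem_ball_zero_iff.1 hh).le
    _ = _ := by
        rw [setLIntegral_const, hV2, ENNReal.ofReal_mul (by positivity)]
        calc _ = (V⁻¹ * V) * (ENNReal.ofReal (2 ^ N) * ENNReal.ofReal ((2 * ε) ^ t) *
              powInt (volOn Ω) t (gradient φ)) := by ring
          _ = _ := by rw [ENNReal.inv_mul_cancel hV0 hVt, one_mul]

lemma continuous_energy (p : Exponent) : Continuous (energy : W1 Ω p → ℝ≥0∞) := by
  simp only [funext fun u : W1 Ω p => energy_eq u]
  refine ENNReal.continuous_ofReal.comp (Continuous.rpow_const ?_ fun _ => Or.inr p.pos.le)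
  exact (continuous_snd.comp continuous_subtype_val).norm

/-- A measurable choice of a point `center (cell x)`, taking finitely many values on `Ω`, at
distance less than `ε` from `x`. -/
structure BallCells (Ω : Opens (EuclideanSpace ℝ (Fin N))) (ε : ℝ) where
  center : ℕ → EuclideanSpace ℝ (Fin N)
  cell : EuclideanSpace ℝ (Fin N) → ℕ
  bound : ℕ
  measurable_cell : Measurable cell
  dist_lt : ∀ x, dist x (center (cell x)) < ε
  cell_lt : ∀ x ∈ Ω, cell x < bound

lemma exists_ballCells (hΩ : Bornology.IsBounded (Ω : Set (EuclideanSpace ℝ (Fin N)))) {ε : ℝ}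
    (hε : 0 < ε) : Nonempty (BallCells Ω ε) := by
  classical
  set c := denseSeq (EuclideanSpace ℝ (Fin N))
  have hc : ∀ x, ∃ n, dist x (c n) < ε := fun x => by
    exact (denseRange_denseSeq (EuclideanSpace ℝ (Fin N))).exists_dist_lt x hε
  obtain ⟨T, hT⟩ := hΩ.isCompact_closure.elim_finite_subcover (fun n => Metric.ball (c n) ε)
    (fun n => Metric.isOpen_ball) fun x _ => Set.mem_iUnion.2 (hc x)
  -- Each point goes to the first centre within distance `ε`. A finite subcover of the compact
  -- closure of `Ω` bounds these indices on `Ω`; the `+ 1` is there because `cell_lt` is strict.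
  refine ⟨⟨c, fun x => Nat.find (hc x), T.sup id + 1, measurable_find _ fun n =>
    measurableSet_lt (measurable_id.dist measurable_const) measurable_const,
    fun x => Nat.find_spec (hc x), fun x hx => ?_⟩⟩
  obtain ⟨n, hn⟩ := Set.mem_iUnion.1 (hT (subset_closure hx))
  obtain ⟨hnT, hn⟩ := Set.mem_iUnion.1 hn
  exact Nat.lt_succ_of_le ((Nat.find_min' (hc x) hn).trans (Finset.le_sup (f := id) hnT))

/-- The function equal on each cell to the average of `u` over the associated ball. -/
noncomputable def BallCells.avg {ε : ℝ} (P : BallCells Ω ε) (u : EuclideanSpace ℝ (Fin N) → ℝ)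
    (x : EuclideanSpace ℝ (Fin N)) : ℝ := ballAvg Ω ε u (P.center (P.cell x))

lemma BallCells.measurable_avg {ε : ℝ} (P : BallCells Ω ε) (u : EuclideanSpace ℝ (Fin N) → ℝ) :
    Measurable (P.avg u) :=
  (measurable_from_nat (f := fun n => ballAvg Ω ε u (P.center n))).comp P.measurable_cell

variable [IsFiniteMeasure (volOn Ω)]

lemma W1.integrable_val {p : Exponent} (u : W1 Ω p) : Integrable (sobVal u) (volOn Ω) :=
  memLp_one_iff_integrable.1 ((Lp.memLp u.1.1).mono_exponent Fact.out)

lemma W1.continuous_ballAvg (p : Exponent) (ε : ℝ) (z : EuclideanSpace ℝ (Fin N)) :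
    Continuous fun u : W1 Ω p => ballAvg Ω ε (sobVal u) z :=
  (PLaplace.continuous_ballAvg ε z).comp ((continuous_toL1 p).comp
    (continuous_fst.comp continuous_subtype_val))

/-- Density of test functions: along an a.e. convergent subsequence the ball averages converge too,
being continuous in the Sobolev norm, so Fatou handles the left side while the energy is continuous
on the right. -/
lemma BallCells.powInt_sub_avg_le_of_mem_W10 {ε : ℝ} (hε : 0 < ε) (P : BallCells Ω ε)
    {t : Exponent} {u : W1 Ω t} (hu : u ∈ W10 Ω t) :
    powInt (volOn Ω) t (fun x => sobVal u x - P.avg (sobVal u) x) ≤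
      ENNReal.ofReal (2 ^ N * (2 * ε) ^ (t : ℝ)) * energy u := by
  obtain ⟨v, hv, hvu⟩ := mem_closure_iff_seq_limit.1 hu
  have hL1 : Tendsto (fun n => toL1 t (v n).1.1) atTop (𝓝 (toL1 t u.1.1)) :=
    (((continuous_toL1 t).comp (continuous_fst.comp continuous_subtype_val)).tendsto u).comp hvu
  obtain ⟨ns, hns, hae⟩ := (tendstoInMeasure_of_tendsto_Lp hL1).exists_seq_tendsto_ae
  have hsub := hns.tendsto_atTop
  set K := ENNReal.ofReal (2 ^ N * (2 * ε) ^ (t : ℝ))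
  calc powInt (volOn Ω) t (fun x => sobVal u x - P.avg (sobVal u) x)
      = ∫⁻ x, liminf (fun n => ‖sobVal (v (ns n)) x - P.avg (sobVal (v (ns n))) x‖ₑ ^ (t : ℝ))
          atTop ∂(volOn Ω) := by
        refine lintegral_congr_ae ?_
        filter_upwards [hae] with x hx
        have h1 : Tendsto (fun n => P.avg (sobVal (v (ns n))) x) atTop
            (𝓝 (P.avg (sobVal u) x)) :=
          ((W1.continuous_ballAvg t ε _).tendsto u).comp (hvu.comp hsub)
        exact (((ENNReal.continuous_rpow_const (y := (t : ℝ))).tendsto _).comp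
          (Tendsto.sub hx h1).enorm).liminf_eq.symm
    _ ≤ liminf (fun n => powInt (volOn Ω) t fun x =>
          sobVal (v (ns n)) x - P.avg (sobVal (v (ns n))) x) atTop :=
        lintegral_liminf_le' fun n => aemeasurable_enorm_rpow
          ((W1.aestronglyMeasurable_val _).sub (P.measurable_avg _).aestronglyMeasurable) _
    _ ≤ liminf (fun n => K * energy (v (ns n))) atTop := by
        refine liminf_le_liminf (Eventually.of_forall fun n => ?_)
        obtain ⟨φ, hφ⟩ := exists_eq_testElt (hv (ns n))
        rw [hφ, energy_eq_powInt, powInt_congr (sobGrad_testElt t φ)]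
        refine le_trans (le_of_eq (powInt_congr ?_))
          (powInt_test_sub_ballAvg_le φ hε P.dist_lt (le_of_lt t.2))
        filter_upwards [sobVal_testElt t φ] with x hx
        rw [hx, BallCells.avg, ballAvg_congr (sobVal_testElt t φ)]
    _ = K * energy u :=
        (ENNReal.Tendsto.const_mul (((continuous_energy t).tendsto u).comp (hvu.comp hsub))
          (Or.inr ENNReal.ofReal_ne_top)).liminf_eq

/-- For `t < s` the function lies in `W10 Ω t`, where the estimate is known; `powInt_le_of_lt`
passes to `t = s`. The condition `2 * ε ≤ 1` replaces `(2 * ε) ^ t` by `2 * ε`, so that one `ε`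
serves all exponents. -/
lemma BallCells.powInt_sub_avg_le {ε : ℝ} (hε : 0 < ε) (hε1 : 2 * ε ≤ 1) (P : BallCells Ω ε)
    {s : Exponent} {u : W1 Ω s} (hu : u ∈ W10minus Ω s) :
    powInt (volOn Ω) s (fun x => sobVal u x - P.avg (sobVal u) x) ≤
      ENNReal.ofReal (2 ^ N * (2 * ε)) * energy u := by
  refine powInt_le_of_lt (M := ENNReal.ofReal (2 ^ N * (2 * ε)) * volOn Ω Set.univ) s.2
    ((W1.aestronglyMeasurable_val u).sub (P.measurable_avg _).aestronglyMeasurable)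
    (ENNReal.mul_ne_top ENNReal.ofReal_ne_top (measure_ne_top _ _)) fun t ht hts => ?_
  have h := P.powInt_sub_avg_le_of_mem_W10 hε (mem_W10minus_iff.1 hu ⟨t, ht⟩ hts)
  refine h.trans ?_
  calc _ ≤ ENNReal.ofReal (2 ^ N * (2 * ε)) *
        (energy u + ENNReal.ofReal (1 - t / s) * volOn Ω Set.univ) := by
        refine mul_le_mul' (ENNReal.ofReal_le_ofReal ?_) ?_
        · refine mul_le_mul_of_nonneg_left ?_ (by positivity)
          simpa using Real.rpow_le_rpow_of_exponent_ge (by positivity) hε1 ht.le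
        · exact powInt_le_add (by linarith) hts.le (W1.aestronglyMeasurable_grad u)
    _ = _ := by ring

end FiniteRank

/-! ### Min-max values under odd maps, and comparison of nearby exponents -/

section MinMax

variable {N : ℕ} {Ω : Opens (EuclideanSpace ℝ (Fin N))}

lemma energy_le_iff {p : Exponent} {u : W1 Ω p} {c : ℝ} (hc : 0 ≤ c) :
    energy u ≤ ENNReal.ofReal c ↔ ‖u.1.2‖ ^ (p : ℝ) ≤ c := by
  rw [energy_eq, ENNReal.ofReal_le_ofReal_iff hc]

lemma le_powInt_iff {p : Exponent} {u : W1 Ω p} {c : ℝ} :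
    ENNReal.ofReal c ≤ powInt (volOn Ω) p (sobVal u) ↔ c ≤ ‖u.1.1‖ ^ (p : ℝ) := by
  rw [powInt_sobVal, ENNReal.ofReal_le_ofReal_iff (by positivity)]

lemma powInt_eq_one_iff {p : Exponent} {u : W1 Ω p} :
    powInt (volOn Ω) p (sobVal u) = 1 ↔ ‖u.1.1‖ = 1 := by
  rw [powInt_sobVal, ENNReal.ofReal_eq_one]
  refine ⟨fun h => Real.rpow_left_injOn p.pos.ne' (norm_nonneg _) (zero_le_one' ℝ) ?_, fun h => ?_⟩
  · exact h.trans (Real.one_rpow _).symm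
  · rw [h, Real.one_rpow]

lemma exists_of_minmax_lt {i : TopIndex} {p : Exponent} {M : Set (W1 Ω p)} {m : ℕ} {c : ℝ}
    (hc : 0 ≤ c) (h : minmax i M m < ENNReal.ofReal c) :
    ∃ K : Set (W1 Ω p), K.Nonempty ∧ IsCompact K ∧ (∀ u ∈ K, -u ∈ K) ∧ K ⊆ M ∧
      m ≤ i.idx K ∧ ∀ u ∈ K, ‖u.1.2‖ ^ (p : ℝ) ≤ c := by
  obtain ⟨r, ⟨K, h1, h2, h3, h4, h5, rfl⟩, hlt⟩ := sInf_lt_iff.1 h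
  exact ⟨K, h1, h2, h3, h4, h5, fun u hu =>
    (energy_le_iff hc).1 ((le_iSup₂ (f := fun u _ => energy u) u hu).trans hlt.le)⟩

/-- An odd continuous map of a competitor `K` into a subspace `V` bounds the min-max value
over the unit sphere of `V`. -/
lemma minmax_le_of_odd_map (i : TopIndex) {p q : Exponent} {m : ℕ} (V : Submodule ℝ (W1 Ω q))
    {K : Set (W1 Ω p)} (hne : K.Nonempty) (hK : IsCompact K) (hsym : ∀ u ∈ K, -u ∈ K)
    (h0 : (0 : W1 Ω p) ∉ K) (hm : m ≤ i.idx K) {π : W1 Ω p → W1 Ω q} (hπ : ContinuousOn π K)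
    (hodd : ∀ u ∈ K, π (-u) = -π u) (hV : ∀ u ∈ K, π u ∈ V) {a b : ℝ} (ha : 0 < a)
    (hpa : ∀ u ∈ K, a ≤ ‖(π u).1.1‖ ^ (q : ℝ)) (hpb : ∀ u ∈ K, ‖(π u).1.2‖ ^ (q : ℝ) ≤ b) :
    minmax i (unitSet (V : Set (W1 Ω q))) m ≤ ENNReal.ofReal (b / a) := by
  have hpos : ∀ u ∈ K, 0 < ‖(π u).1.1‖ := fun u hu => by
    refine (norm_nonneg _).lt_of_ne fun h => ?_
    have := hpa u hu
    rw [← h, Real.zero_rpow q.pos.ne'] at this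
    linarith
  -- Dividing by the `L^q` norm puts the image on the unit sphere and divides the energy by at least
  -- `a`.
  set π' : W1 Ω p → W1 Ω q := fun u => ‖(π u).1.1‖⁻¹ • π u with hπ'
  have hodd' : ∀ u ∈ K, π' (-u) = -π' u := fun u hu => by
    have : ‖(π (-u)).1.1‖ = ‖(π u).1.1‖ := by
      rw [hodd u hu]; exact norm_neg _
    simp only [hπ', this]
    rw [hodd u hu, smul_neg]
  have hcont : ContinuousOn π' K := by
    refine ContinuousOn.smul (ContinuousOn.inv₀ ?_ fun u hu => (hpos u hu).ne') hπ
    exact (continuous_fst.comp continuous_subtype_val).norm.comp_continuousOn hπ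
  have hval : ∀ u ∈ K, ‖(π' u).1.1‖ = 1 := fun u hu => by
    change ‖‖(π u).1.1‖⁻¹ • (π u).1.1‖ = 1
    rw [norm_smul, norm_inv, norm_norm, inv_mul_cancel₀ (hpos u hu).ne']
  have hn0 : ∀ u ∈ K, π' u ≠ 0 := fun u hu h => by
    have := hval u hu
    rw [h] at this
    exact zero_ne_one (norm_zero.symm.trans this)
  have hb : ∀ u ∈ K, ‖(π' u).1.2‖ ^ (q : ℝ) ≤ b / a := fun u hu => by
    change ‖‖(π u).1.1‖⁻¹ • (π u).1.2‖ ^ (q : ℝ) ≤ b / a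
    rw [norm_smul, norm_inv, norm_norm, Real.mul_rpow (by positivity) (norm_nonneg _),
      Real.inv_rpow (norm_nonneg _), inv_mul_eq_div]
    exact div_le_div₀ ((by positivity : (0 : ℝ) ≤ _).trans (hpb u hu)) (hpb u hu) ha (hpa u hu)
  refine sInf_le_of_le ⟨π' '' K, hne.image _, hK.image_of_continuousOn hcont, ?_, ?_,
    hm.trans (i.le_image K π' hne hK hsym h0 hcont hodd' hn0), rfl⟩ ?_
  · rintro _ ⟨u, hu, rfl⟩
    exact ⟨-u, hsym u hu, hodd' u hu⟩
  · rintro _ ⟨u, hu, rfl⟩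
    exact mem_unitSet.2 ⟨V.smul_mem _ (hV u hu), powInt_eq_one_iff.2 (hval u hu)⟩
  · refine iSup₂_le ?_
    rintro _ ⟨u, hu, rfl⟩
    rw [energy_eq]
    exact ENNReal.ofReal_le_ofReal (hb u hu)

lemma zero_notMem_of_subset_unitSet {p : Exponent} {V K : Set (W1 Ω p)} (h : K ⊆ unitSet V) :
    (0 : W1 Ω p) ∉ K := fun h0 => by
  have h1 := powInt_eq_one_iff.1 (mem_unitSet.1 (h h0)).2
  exact zero_ne_one (norm_zero.symm.trans h1)

lemma minmax_mono (i : TopIndex) {p : Exponent} {M M' : Set (W1 Ω p)} (h : M ⊆ M') (m : ℕ) :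
    minmax i M' m ≤ minmax i M m :=
  sInf_le_sInf (by rintro _ ⟨K, h1, h2, h3, h4, h5⟩; exact ⟨K, h1, h2, h3, h4.trans h, h5⟩)

variable [IsFiniteMeasure (volOn Ω)]

lemma lowerEigenvalue_le_eigenvalue (i : TopIndex) (m : ℕ) (p : Exponent) :
    lowerEigenvalue i Ω m p ≤ eigenvalue i Ω m p :=
  minmax_mono i (M := unitSet (W10 Ω p)) (M' := unitSet (W10minus Ω p))
    (fun _ hu => ⟨W10_subset_W10minus p hu.1, hu.2⟩) m

/-- Applied with `a = |u x|` and `d` the distance from `u x` to a bounded average: below height `A`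
raising the exponent costs `A ^ (s - q)`, above it the value is dominated by `d`. -/
lemma rpow_le_mul_rpow_add {a d A q s : ℝ} (ha : 0 ≤ a) (hA : 1 ≤ A) (hq : 0 < q)
    (hqs : q ≤ s) (h : A < a → a ≤ 2 * d) (hd : 0 ≤ d) :
    a ^ s ≤ A ^ (s - q) * a ^ q + 2 ^ s * d ^ s := by
  have hs : 0 < s := hq.trans_le hqs
  have h1 : 0 ≤ A ^ (s - q) * a ^ q := by positivity
  have h2 : 0 ≤ 2 ^ s * d ^ s := by positivity
  rcases le_or_gt a A with hle | hlt
  · have : a ^ s ≤ A ^ (s - q) * a ^ q := by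
      rcases ha.eq_or_lt with rfl | ha'
      · rw [Real.zero_rpow hs.ne']; exact h1
      calc a ^ s = a ^ (s - q) * a ^ q := by rw [← Real.rpow_add ha', sub_add_cancel]
        _ ≤ _ := by gcongr
    linarith
  · have : a ^ s ≤ 2 ^ s * d ^ s := by
      rw [← Real.mul_rpow zero_le_two hd]
      exact Real.rpow_le_rpow ha (h hlt) hs.le
    linarith

lemma exists_ballCells_of_pos (hΩ : Bornology.IsBounded (Ω : Set (EuclideanSpace ℝ (Fin N))))
    {κ : ℝ} (hκ : 0 < κ) : ∃ ε : ℝ, ∃ P : BallCells Ω ε, 0 < ε ∧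
      ∀ (s : Exponent) (u : W1 Ω s), u ∈ W10minus Ω s →
        powInt (volOn Ω) s (fun x => sobVal u x - P.avg (sobVal u) x) ≤
          ENNReal.ofReal κ * energy u := by
  set ε := min (1 / 2) (κ / (2 ^ N * 2)) with hεdef
  have hε : 0 < ε := by positivity
  obtain ⟨P⟩ := exists_ballCells hΩ hε
  refine ⟨ε, P, hε, fun s u hu => (P.powInt_sub_avg_le hε ?_ hu).trans ?_⟩
  · have : ε ≤ 1 / 2 := min_le_left _ _
    linarith
  · gcongr
    calc 2 ^ N * (2 * ε) ≤ 2 ^ N * (2 * (κ / (2 ^ N * 2))) := by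
          gcongr; exact min_le_right _ _
      _ = κ := by field_simp

lemma integral_abs_le_of_powInt_eq_one {s : Exponent} {u : W1 Ω s}
    (hu : powInt (volOn Ω) s (sobVal u) = 1) :
    ∫ x, |sobVal u x| ∂(volOn Ω) ≤ 1 + (volOn Ω).real Set.univ := by
  have h := powInt_le_add (μ := volOn Ω) one_pos s.2.le (W1.aestronglyMeasurable_val u)
  rw [hu] at h
  have h' : powInt (volOn Ω) 1 (sobVal u) ≤ ENNReal.ofReal (1 + (volOn Ω).real Set.univ) := by
    refine h.trans ?_
    rw [ENNReal.ofReal_add zero_le_one measureReal_nonneg, ENNReal.ofReal_one,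
      ofReal_measureReal (measure_ne_top _ _)]
    gcongr
    refine mul_le_of_le_one_left zero_le (ENNReal.ofReal_le_one.2 ?_)
    have : 0 ≤ 1 / (s : ℝ) := by have := s.pos; positivity
    linarith
  rw [integral_eq_lintegral_of_nonneg_ae (Eventually.of_forall fun _ => abs_nonneg _)
    (W1.aestronglyMeasurable_val u).norm]
  refine ENNReal.toReal_le_of_le_ofReal (by positivity) (le_trans (le_of_eq ?_) h')
  refine lintegral_congr fun x => ?_
  rw [ENNReal.rpow_one, Real.enorm_eq_ofReal_abs]

/-- On functions normalised in `L^s` and of bounded energy, the `L^q` norm is close to `1`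
when `q < s` are close to each other, uniformly for `s` in a bounded set. -/
lemma exists_forall_le_powInt (hΩ : Bornology.IsBounded (Ω : Set (EuclideanSpace ℝ (Fin N))))
    (p : Exponent) {c θ : ℝ} (hc : 0 ≤ c) (hθ : 0 < θ) :
    ∃ η > 0, ∀ q s : Exponent, q < s → |(q : ℝ) - p| < η → |(s : ℝ) - p| < η →
      ∀ u ∈ W10minus Ω s, powInt (volOn Ω) s (sobVal u) = 1 → energy u ≤ ENNReal.ofReal c →
        ENNReal.ofReal (1 - θ) ≤ powInt (volOn Ω) q (sobVal u) := by
  -- Chosen so that `2 ^ (p + 1) * κ * (c + 1) = θ / 2`, where `2 ^ (p + 1)` bounds `2 ^ s`; the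
  -- summand `1` in `c + 1` avoids a zero denominator.
  set κ := θ / (2 * (2 ^ ((p : ℝ) + 1) * (c + 1))) with hκ
  obtain ⟨ε, P, hε, hP⟩ := exists_ballCells_of_pos hΩ (κ := κ) (by positivity)
  set A₀ := (volume.real (Metric.ball (0 : EuclideanSpace ℝ (Fin N)) ε))⁻¹ *
    (1 + (volOn Ω).real Set.univ) with hA₀
  -- `A₀` bounds all ball averages. Where `|u| > A ≥ 2 * A₀` the average is at most half of `|u|`,
  -- hence `|u| ≤ 2 |u - avg|`.
  set A := max 1 (2 * A₀) with hA
  have hA1 : 1 ≤ A := le_max_left _ _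
  -- If the conclusion failed, the main estimate would give `1` at most the expression here, whose
  -- limit is `1 - θ / 2 < 1`. The exponent is `2 * η` because `q` and `s` are each within `η` of
  -- `p`.
  have hcont : Tendsto (fun η : ℝ => A ^ (2 * η) * (1 - θ) + θ / 2) (𝓝[>] 0) (𝓝 (1 - θ / 2)) := by
    have : Continuous fun η : ℝ => A ^ (2 * η) * (1 - θ) + θ / 2 :=
      ((continuous_const.rpow (continuous_const.mul continuous_id)
        fun _ => Or.inl (by positivity)).mul continuous_const).add continuous_const
    have h := (this.tendsto 0).mono_left (nhdsWithin_le_nhds (s := Set.Ioi 0))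
    convert h using 2
    simp; ring
  obtain ⟨η, hη, hη0, hη1⟩ := ((hcont.eventually (gt_mem_nhds (by linarith : 1 - θ / 2 < 1))).and
    (Ioc_mem_nhdsGT (zero_lt_one' ℝ))).exists
  refine ⟨η, hη0, fun q s hqs hq hs u hu hu1 hue => ?_⟩
  have hqs' : (q : ℝ) < s := hqs
  have hs1 : (s : ℝ) ≤ p + 1 := by linarith [(abs_lt.1 hs).2]
  have hsq : (s : ℝ) - q ≤ 2 * η := by linarith [(abs_lt.1 hs).2, (abs_lt.1 hq).1]
  have hbd : ∀ x, |P.avg (sobVal u) x| ≤ A₀ := fun x =>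
    (abs_ballAvg_le (W1.integrable_val u) _).trans (mul_le_mul_of_nonneg_left
      (integral_abs_le_of_powInt_eq_one hu1) (inv_nonneg.2 measureReal_nonneg))
  have hmain : (1 : ℝ≥0∞) ≤ ENNReal.ofReal (A ^ (2 * η)) * powInt (volOn Ω) q (sobVal u) +
      ENNReal.ofReal (θ / 2) := by
    calc (1 : ℝ≥0∞) = powInt (volOn Ω) s (sobVal u) := hu1.symm
      _ ≤ ∫⁻ x, (ENNReal.ofReal (A ^ (2 * η)) * ‖sobVal u x‖ₑ ^ (q : ℝ) +
            ENNReal.ofReal (2 ^ ((p : ℝ) + 1)) *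
              ‖sobVal u x - P.avg (sobVal u) x‖ₑ ^ (s : ℝ)) ∂(volOn Ω) := by
          refine lintegral_mono fun x => ?_
          rw [enorm_rpow_eq_ofReal _ s.pos.le, enorm_rpow_eq_ofReal _ q.pos.le,
            enorm_rpow_eq_ofReal _ s.pos.le, ← ENNReal.ofReal_mul (by positivity),
            ← ENNReal.ofReal_mul (by positivity),
            ← ENNReal.ofReal_add (by positivity) (by positivity)]
          refine ENNReal.ofReal_le_ofReal ((rpow_le_mul_rpow_add (norm_nonneg _) hA1 q.pos
            hqs'.le (fun hlt => ?_) (norm_nonneg (sobVal u x - P.avg (sobVal u) x))).trans ?_)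
          · have h1 := hbd x
            have h2 : 2 * A₀ ≤ A := le_max_right _ _
            have h3 := norm_sub_norm_le (sobVal u x) (P.avg (sobVal u) x)
            rw [Real.norm_eq_abs (P.avg _ _)] at h3
            linarith
          · gcongr
            · exact one_le_two
      _ = ENNReal.ofReal (A ^ (2 * η)) * powInt (volOn Ω) q (sobVal u) +
            ENNReal.ofReal (2 ^ ((p : ℝ) + 1)) *
              powInt (volOn Ω) s (fun x => sobVal u x - P.avg (sobVal u) x) := by
          rw [lintegral_add_left' ((aemeasurable_enorm_rpow (W1.aestronglyMeasurable_val u)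
            _).const_mul _), lintegral_const_mul' _ _ ENNReal.ofReal_ne_top,
            lintegral_const_mul' _ _ ENNReal.ofReal_ne_top]
          rfl
      _ ≤ _ := by
          gcongr
          calc _ ≤ ENNReal.ofReal (2 ^ ((p : ℝ) + 1)) *
                (ENNReal.ofReal κ * ENNReal.ofReal (c + 1)) := by
                gcongr
                exact (hP s u hu).trans (mul_le_mul_right (hue.trans
                  (ENNReal.ofReal_le_ofReal (by linarith))) _)
            _ = _ := by
                rw [← ENNReal.ofReal_mul (by positivity), ← ENNReal.ofReal_mul (by positivity)]
                congr 1
                rw [hκ]; field_simp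
  by_contra! hlt
  have hpos : 0 < 1 - θ := by
    by_contra! h
    rw [ENNReal.ofReal_of_nonpos h] at hlt
    exact not_lt_zero hlt
  refine absurd hmain (not_le.2 ?_)
  calc _ ≤ ENNReal.ofReal (A ^ (2 * η)) * ENNReal.ofReal (1 - θ) + ENNReal.ofReal (θ / 2) := by
        gcongr
    _ = ENNReal.ofReal (A ^ (2 * η) * (1 - θ) + θ / 2) := by
        rw [← ENNReal.ofReal_mul (by positivity), ← ENNReal.ofReal_add (by positivity)
          (by positivity)]
    _ < 1 := ENNReal.ofReal_lt_one.2 hη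

/-- Error budget for `minmax_le_of_odd_map`: energy at most `c + σ` and normalisation at least `1 -
σ` still give a value at most `c'`. -/
lemma exists_pos_div_le {c c' : ℝ} (h : c < c') : ∃ σ > 0, σ < 1 ∧ (c + σ) / (1 - σ) ≤ c' := by
  have ht : Tendsto (fun σ : ℝ => (c + σ) / (1 - σ)) (𝓝[>] 0) (𝓝 c) := by
    have : ContinuousAt (fun σ : ℝ => (c + σ) / (1 - σ)) 0 :=
      (continuousAt_const.add continuousAt_id).div (continuousAt_const.sub continuousAt_id)
        (by simp)
    have h2 := this.tendsto.mono_left (nhdsWithin_le_nhds (s := Set.Ioi 0))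
    simpa using h2
  obtain ⟨σ, h1, h2, h3⟩ := ((ht.eventually (gt_mem_nhds h)).and
    (Ioo_mem_nhdsGT (zero_lt_one' ℝ))).exists
  exact ⟨σ, h2, h3, h1.le⟩

/-- Near `p`, the eigenvalue at a smaller exponent is almost bounded by the lower eigenvalue at
a larger one. -/
lemma exists_eigenvalue_le_of_lowerEigenvalue_lt
    (hΩ : Bornology.IsBounded (Ω : Set (EuclideanSpace ℝ (Fin N)))) (i : TopIndex) (m : ℕ)
    (p : Exponent) {c c' : ℝ} (hc : 0 ≤ c) (hcc' : c < c') :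
    ∃ η > 0, ∀ q s : Exponent, q < s → |(q : ℝ) - p| < η → |(s : ℝ) - p| < η →
      lowerEigenvalue i Ω m s < ENNReal.ofReal c → eigenvalue i Ω m q ≤ ENNReal.ofReal c' := by
  obtain ⟨σ, hσ, hσ1, hσc⟩ := exists_pos_div_le hcc'
  obtain ⟨η₁, hη₁, H⟩ := exists_forall_le_powInt hΩ p hc hσ
  set v := (volOn Ω).real Set.univ with hv
  have hv0 : 0 ≤ v := measureReal_nonneg
  -- With both exponents this close to `p`, the Young error satisfies `(1 - q / s) * v ≤ (s - q) * v
  -- ≤ σ`, using `s > 1`.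
  refine ⟨min η₁ (σ / (2 * (v + 1))), by positivity, fun q s hqs hq hs hlt => ?_⟩
  have hqs' : (q : ℝ) < s := hqs
  obtain ⟨K, hne, hK, hsym, hKM, hm, hen⟩ := exists_of_minmax_lt hc hlt
  have hsq : (s : ℝ) - q ≤ σ / (v + 1) := by
    have h1 := (abs_lt.1 (hq.trans_le (min_le_right _ _))).1
    have h2 := (abs_lt.1 (hs.trans_le (min_le_right _ _))).2
    have h3 : σ / (v + 1) = 2 * (σ / (2 * (v + 1))) := by field_simp
    linarith
  unfold eigenvalue
  rw [← coe_W10Submodule]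
  refine (minmax_le_of_odd_map i (W10Submodule Ω q) hne hK hsym (zero_notMem_of_subset_unitSet hKM)
    hm (π := W1.incl hqs.le) (W1.continuous_incl _).continuousOn (fun u _ => map_neg _ u) ?_
    (a := 1 - σ) (b := c + σ) (by linarith) ?_ ?_).trans (ENNReal.ofReal_le_ofReal hσc)
  · intro u hu
    rw [← SetLike.mem_coe, coe_W10Submodule]
    exact mem_W10minus_iff.1 (hKM hu).1 q hqs
  · intro u hu
    rw [← le_powInt_iff]
    exact H q s hqs (hq.trans_le (min_le_left _ _)) (hs.trans_le (min_le_left _ _)) u (hKM hu).1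
      (hKM hu).2 ((energy_le_iff hc).2 (hen u hu))
  · intro u hu
    rw [← energy_le_iff (by linarith), energy_eq_powInt, sobGrad_incl]
    refine (powInt_le_add q.pos hqs'.le (W1.aestronglyMeasurable_grad u)).trans ?_
    rw [ENNReal.ofReal_add hc hσ.le, ← energy_eq_powInt]
    refine add_le_add ((energy_le_iff hc).2 (hen u hu)) ?_
    rw [← ofReal_measureReal (measure_ne_top _ _), ← ENNReal.ofReal_mul' hv0]
    refine ENNReal.ofReal_le_ofReal ?_
    have hs1 : (1 : ℝ) < s := s.2
    have h1 : 1 - (q : ℝ) / s ≤ σ / (v + 1) := by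
      rw [one_sub_div s.pos.ne']
      exact (div_le_self (by linarith) hs1.le).trans hsq
    calc (1 - (q : ℝ) / s) * v ≤ σ / (v + 1) * (v + 1) := by
          refine mul_le_mul h1 (by linarith) hv0 (by positivity)
      _ = σ := by field_simp

end MinMax

/-! ### Odd finite-dimensional approximation of compact symmetric sets -/

section OddApproximation

/-- A compact symmetric set whose image under `T` lies in the `δ`-neighbourhood of the points
`w j` is approximated by an odd map into the finite combinations of these points. -/
lemma exists_odd_combination {X L I : Type*} [NormedAddCommGroup X] [NormedAddCommGroup L]
    [NormedSpace ℝ L] {T : X → L} (hT : Continuous T) (hTodd : ∀ x, T (-x) = -T x) {K : Set X}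
    (hK : IsCompact K) (w : I → L) {δ : ℝ} (hw : ∀ u ∈ K, ∃ j, ‖T u - w j‖ < δ) :
    ∃ (t : Finset I) (c : I → X → ℝ), (∀ j, ContinuousOn (c j) K) ∧ (∀ j, ∀ u, c j (-u) = -c j u) ∧
      (∀ u ∈ K, ∑ j ∈ t, |c j u| ≤ 1) ∧ ∀ u ∈ K, ‖T u - ∑ j ∈ t, c j u • w j‖ ≤ δ := by
  obtain ⟨t, ht⟩ := hK.elim_finite_subcover (fun j => {u | ‖T u - w j‖ < δ})
    (fun j => isOpen_lt (hT.sub continuous_const).norm continuous_const)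
    fun u hu => Set.mem_iUnion.2 (hw u hu)
  set φ : I → X → ℝ := fun j u => max 0 (δ - ‖T u - w j‖) with hφ
  have hφ0 : ∀ j u, 0 ≤ φ j u := fun j u => le_max_left _ _
  have hφc : ∀ j, Continuous (φ j) := fun j =>
    continuous_const.max (continuous_const.sub (hT.sub continuous_const).norm)
  have hφs : ∀ j u, φ j u * ‖T u - w j‖ ≤ φ j u * δ := fun j u => by
    rcases le_or_gt (δ - ‖T u - w j‖) 0 with h | h
    · simp [hφ, max_eq_left h]
    · exact mul_le_mul_of_nonneg_left (by linarith) (hφ0 j u)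
  -- The bumps `φ j` are antisymmetrised in the numerator and symmetrised in the denominator. This
  -- makes the coefficients odd, with absolute values summing to at most `1`.
  set S : X → ℝ := fun u => ∑ j ∈ t, (φ j u + φ j (-u)) with hS
  have hSpos : ∀ u ∈ K, 0 < S u := fun u hu => by
    obtain ⟨j, hj⟩ := Set.mem_iUnion.1 (ht hu)
    obtain ⟨hjt, hj⟩ := Set.mem_iUnion.1 hj
    refine Finset.sum_pos' (fun j _ => add_nonneg (hφ0 _ _) (hφ0 _ _)) ⟨j, hjt, ?_⟩
    have : 0 < φ j u := lt_max_of_lt_right (sub_pos.2 hj)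
    linarith [hφ0 j (-u)]
  have hSc : Continuous S := continuous_finsetSum _ fun j _ =>
    (hφc j).add ((hφc j).comp continuous_neg)
  have hSneg : ∀ u, S (-u) = S u := fun u => by
    simp only [hS, neg_neg, add_comm]
  refine ⟨t, fun j u => (φ j u - φ j (-u)) / S u, fun j => ?_, fun j u => ?_, fun u hu => ?_,
    fun u hu => ?_⟩
  · exact ((hφc j).sub ((hφc j).comp continuous_neg)).continuousOn.div hSc.continuousOn
      fun u hu => (hSpos u hu).ne'
  · simp only [hSneg, neg_neg]; rw [← neg_div, neg_sub]
  · have h1 : ∀ j ∈ t, |(φ j u - φ j (-u)) / S u| ≤ (φ j u + φ j (-u)) / S u := fun j _ => by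
      rw [abs_div, abs_of_pos (hSpos u hu)]
      refine div_le_div_of_nonneg_right ?_ (hSpos u hu).le
      exact abs_le.2 ⟨by linarith [hφ0 j u], by linarith [hφ0 j (-u)]⟩
    refine (Finset.sum_le_sum h1).trans ?_
    rw [← Finset.sum_div, div_self (hSpos u hu).ne']
  -- The error is an average of `T u - w j`, weighted by `φ j u`, and of `T u + w j = -(T (-u) - w
  -- j)`, weighted by `φ j (-u)`. Each weight vanishes unless its vector has norm below `δ`.
  · have e : T u - ∑ j ∈ t, ((φ j u - φ j (-u)) / S u) • w j =
        (S u)⁻¹ • ∑ j ∈ t, (φ j u • (T u - w j) + φ j (-u) • (T u + w j)) := by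
      have h1 : T u = (S u)⁻¹ • ∑ j ∈ t, (φ j u + φ j (-u)) • T u := by
        rw [← Finset.sum_smul, smul_smul, inv_mul_cancel₀ (hSpos u hu).ne', one_smul]
      have h2 : ∑ j ∈ t, ((φ j u - φ j (-u)) / S u) • w j =
          (S u)⁻¹ • ∑ j ∈ t, (φ j u - φ j (-u)) • w j := by
        rw [Finset.smul_sum]
        exact Finset.sum_congr rfl fun j _ => by rw [smul_smul, div_eq_inv_mul]
      conv_lhs => rw [h1, h2]
      rw [← smul_sub, ← Finset.sum_sub_distrib]
      congr 1
      refine Finset.sum_congr rfl fun j _ => ?_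
      module
    rw [e, norm_smul, norm_inv, Real.norm_of_nonneg (hSpos u hu).le, inv_mul_le_iff₀ (hSpos u hu)]
    refine (norm_sum_le _ _).trans ?_
    rw [hS, Finset.sum_mul]
    refine Finset.sum_le_sum fun j _ => (norm_add_le _ _).trans ?_
    rw [norm_smul, norm_smul, Real.norm_of_nonneg (hφ0 _ _), Real.norm_of_nonneg (hφ0 _ _), add_mul]
    refine add_le_add (hφs j u) ?_
    have h := hφs j (-u)
    rwa [hTodd, ← norm_neg, neg_sub, sub_neg_eq_add, add_comm] at h

lemma sum_neg_smul {X I : Type*} [AddCommGroup X] [Module ℝ X] (t : Finset I) (c : I → ℝ)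
    (v : I → X) : ∑ j ∈ t, (-c j) • v j = -∑ j ∈ t, c j • v j := by
  simp only [neg_smul, Finset.sum_neg_distrib]

end OddApproximation

/-! ### Upper bound from the right by test functions -/

section UpperBoundRight

variable {N : ℕ} {Ω : Opens (EuclideanSpace ℝ (Fin N))}

lemma W1.norm_val_le {p : Exponent} (u : W1 Ω p) : ‖u.1.1‖ ≤ ‖u‖ := norm_fst_le u.1

lemma W1.norm_grad_le {p : Exponent} (u : W1 Ω p) : ‖u.1.2‖ ≤ ‖u‖ := norm_snd_le u.1

lemma W1.sum_smul_val {p : Exponent} {I : Type*} (t : Finset I) (c : I → ℝ) (v : I → W1 Ω p) :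
    (∑ j ∈ t, c j • v j : W1 Ω p).1.1 = ∑ j ∈ t, c j • (v j).1.1 := by
  simp [Prod.fst_sum]

lemma W1.sum_smul_grad {p : Exponent} {I : Type*} (t : Finset I) (c : I → ℝ) (v : I → W1 Ω p) :
    (∑ j ∈ t, c j • v j : W1 Ω p).1.2 = ∑ j ∈ t, c j • (v j).1.2 := by
  simp [Prod.snd_sum]

/-- The bound depends only on the finite family, not on the coefficients or on `s`; this is what
allows the exponent to be raised uniformly over the competitor. -/
lemma ae_norm_sobGrad_sum_testElt_le (t : Finset 𝓓(Ω, ℝ)) : ∃ Λ : ℝ, 1 ≤ Λ ∧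
    ∀ (s : Exponent) (c : 𝓓(Ω, ℝ) → ℝ), ∑ φ ∈ t, |c φ| ≤ 1 →
      ∀ᵐ x ∂(volOn Ω), ‖sobGrad (∑ φ ∈ t, c φ • testElt s φ) x‖ ≤ Λ := by
  have hb : ∀ φ : 𝓓(Ω, ℝ), ∃ C : ℝ, ∀ x, ‖gradient φ x‖ ≤ C := fun φ =>
    (continuous_gradient_test φ).bounded_above_of_compact_support
      (hasCompactSupport_gradient_test φ)
  choose C hC using hb
  have hC0 : ∀ φ, 0 ≤ C φ := fun φ => (norm_nonneg _).trans (hC φ 0)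
  have hs0 : 0 ≤ ∑ φ ∈ t, C φ := Finset.sum_nonneg fun φ _ => hC0 φ
  refine ⟨1 + ∑ φ ∈ t, C φ, by linarith, fun s c hc => ?_⟩
  have h1 : sobGrad (∑ φ ∈ t, c φ • testElt s φ) =ᵐ[volOn Ω]
      fun x => ∑ φ ∈ t, (c φ • (testElt s φ).1.2 : LpOn Ω (EuclideanSpace ℝ (Fin N)) s) x := by
    unfold sobGrad
    rw [W1.sum_smul_grad]
    exact Lp.coeFn_fun_finsetSum _ _
  have h2 : ∀ᵐ x ∂(volOn Ω), ∀ φ ∈ t,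
      (c φ • (testElt s φ).1.2 : LpOn Ω (EuclideanSpace ℝ (Fin N)) s) x = c φ • gradient φ x := by
    rw [Filter.eventually_all_finset]
    intro φ _
    filter_upwards [Lp.coeFn_smul (c φ) (testElt s φ).1.2, sobGrad_testElt s φ] with x h3 h4
    rw [h3, Pi.smul_apply, ← h4]
    rfl
  filter_upwards [h1, h2] with x h3 h4
  rw [h3, Finset.sum_congr rfl h4]
  refine (norm_sum_le _ _).trans (le_trans (b := ∑ φ ∈ t, |c φ| * ∑ φ ∈ t, C φ) ?_ ?_)
  · refine Finset.sum_le_sum fun φ hφ => ?_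
    rw [norm_smul, Real.norm_eq_abs]
    refine mul_le_mul_of_nonneg_left ((hC φ x).trans ?_) (abs_nonneg _)
    exact Finset.single_le_sum (f := C) (fun φ _ => hC0 φ) hφ
  · rw [← Finset.sum_mul]
    have := mul_le_mul_of_nonneg_right hc hs0
    linarith

lemma powInt_le_of_ae_bound {α F : Type*} [MeasurableSpace α] [NormedAddCommGroup F]
    {μ : Measure α} {f : α → F} {Λ q s : ℝ} (hΛ : 0 < Λ) (hq : 0 < q) (hqs : q ≤ s)
    (h : ∀ᵐ x ∂μ, ‖f x‖ ≤ Λ) :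
    powInt μ s f ≤ ENNReal.ofReal (Λ ^ (s - q)) * powInt μ q f := by
  unfold powInt
  rw [← lintegral_const_mul' _ _ ENNReal.ofReal_ne_top]
  refine lintegral_mono_ae (h.mono fun x hx => ?_)
  rw [enorm_rpow_eq_ofReal _ hq.le, enorm_rpow_eq_ofReal _ (hq.le.trans hqs),
    ← ENNReal.ofReal_mul (by positivity)]
  refine ENNReal.ofReal_le_ofReal ?_
  rcases (norm_nonneg (f x)).eq_or_lt with h0 | h0
  · rw [← h0, Real.zero_rpow (by linarith)]; positivity
  · calc ‖f x‖ ^ s = ‖f x‖ ^ (s - q) * ‖f x‖ ^ q := by rw [← Real.rpow_add h0, sub_add_cancel]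
      _ ≤ _ := by gcongr

variable [IsFiniteMeasure (volOn Ω)]

/-- The change of exponent for `L^p` norms, in real form. -/
lemma norm_lpIncl_rpow_le {F : Type} [NormedAddCommGroup F] [NormedSpace ℝ F] {q p : Exponent} (h : q ≤ p) (f : LpOn Ω F p) :
    ‖(lpIncl (Exponent.toENNReal_le h) f : LpOn Ω F q)‖ ^ (q : ℝ) ≤
      ‖f‖ ^ (p : ℝ) + (1 - (q : ℝ) / p) * (volOn Ω).real Set.univ := by
  have hle : (q : ℝ) / p ≤ 1 := (div_le_one p.pos).2 h
  have h1 := powInt_le_add (μ := volOn Ω) q.pos (show (q : ℝ) ≤ p from h)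
    (Lp.aestronglyMeasurable f)
  have hv : 0 ≤ (volOn Ω).real Set.univ := measureReal_nonneg
  have hm : 0 ≤ (1 - (q : ℝ) / p) * (volOn Ω).real Set.univ := mul_nonneg (by linarith) hv
  rw [← lpIncl_coe (Exponent.toENNReal_le h) f, powInt_coe, lpIncl_coe, powInt_coe,
    ← ofReal_measureReal (measure_ne_top _ _), ← ENNReal.ofReal_mul' hv,
    ← ENNReal.ofReal_add (by positivity) hm] at h1
  exact (ENNReal.ofReal_le_ofReal_iff (add_nonneg (by positivity) hm)).1 h1

lemma W1.incl_testElt {q p : Exponent} (h : q ≤ p) (φ : 𝓓(Ω, ℝ)) :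
    W1.incl h (testElt p φ) = testElt q φ :=
  W1.ext_val ((sobVal_testElt p φ).trans (sobVal_testElt q φ).symm)

/-- Upper semicontinuity from the right of the eigenvalues. -/
lemma exists_eigenvalue_le_of_gt (i : TopIndex) (m : ℕ) (p : Exponent) {c c' : ℝ} (hc : 0 ≤ c)
    (hcc' : c < c') (hlt : eigenvalue i Ω m p < ENNReal.ofReal c) :
    ∃ η > 0, ∀ s : Exponent, p < s → (s : ℝ) - p < η →
      eigenvalue i Ω m s ≤ ENNReal.ofReal c' := by
  obtain ⟨σ, hσ, hσ1, hσc⟩ := exists_pos_div_le hcc'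
  obtain ⟨K, hne, hK, hsym, hKM, hm, hen⟩ := exists_of_minmax_lt hc hlt
  set v := (volOn Ω).real Set.univ with hv
  have hv0 : 0 ≤ v := measureReal_nonneg
  have hp := p.pos
  obtain ⟨δ, ⟨hδ1, hδ2⟩, hδ0, hδle⟩ : ∃ δ : ℝ, ((c ^ (p : ℝ)⁻¹ + δ) ^ (p : ℝ) < c + σ / 2 ∧
      1 - σ / 2 < (1 - δ) ^ (p : ℝ)) ∧ 0 < δ ∧ δ < 1 := by
    have t1 : Tendsto (fun δ : ℝ => (c ^ (p : ℝ)⁻¹ + δ) ^ (p : ℝ)) (𝓝[>] 0) (𝓝 c) := by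
      have : Continuous fun δ : ℝ => (c ^ (p : ℝ)⁻¹ + δ) ^ (p : ℝ) :=
        (continuous_const.add continuous_id).rpow_const fun _ => Or.inr hp.le
      have h := (this.tendsto 0).mono_left (nhdsWithin_le_nhds (s := Set.Ioi 0))
      rwa [add_zero, ← Real.rpow_mul hc, inv_mul_cancel₀ hp.ne', Real.rpow_one] at h
    have t2 : Tendsto (fun δ : ℝ => (1 - δ) ^ (p : ℝ)) (𝓝[>] 0) (𝓝 1) := by
      have : Continuous fun δ : ℝ => (1 - δ) ^ (p : ℝ) :=
        (continuous_const.sub continuous_id).rpow_const fun _ => Or.inr hp.le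
      have h := (this.tendsto 0).mono_left (nhdsWithin_le_nhds (s := Set.Ioi 0))
      rwa [sub_zero, Real.one_rpow] at h
    exact (((t1.eventually (gt_mem_nhds (by linarith))).and
      (t2.eventually (lt_mem_nhds (by linarith)))).and (Ioo_mem_nhdsGT one_pos)).exists
  obtain ⟨t, a, hac, haodd, hasum, happ⟩ := exists_odd_combination (T := (id : W1 Ω p → W1 Ω p))
    continuous_id (fun _ => rfl) hK (fun φ : 𝓓(Ω, ℝ) => testElt p φ) (δ := δ) (fun u hu => by
      obtain ⟨w, hw, hd⟩ := Metric.mem_closure_iff.1 (hKM hu).1 δ hδ0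
      obtain ⟨φ, rfl⟩ := exists_eq_testElt hw
      exact ⟨φ, by rwa [← dist_eq_norm]⟩)
  obtain ⟨Λ, hΛ1, hΛ⟩ := ae_norm_sobGrad_sum_testElt_le t
  have hΛ0 : 0 < Λ := by linarith
  -- For a gradient bounded by `Λ`, passing from exponent `p` to `s` multiplies the energy by at
  -- most `Λ ^ (s - p) ≤ Λ ^ η`.
  obtain ⟨η, hη, hη0⟩ : ∃ η : ℝ, Λ ^ η * (c + σ / 2) < c + σ ∧ 0 < η := by
    have : Continuous fun η : ℝ => Λ ^ η * (c + σ / 2) :=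
      (continuous_const.rpow continuous_id fun _ => Or.inl hΛ0.ne').mul continuous_const
    have h := (this.tendsto 0).mono_left (nhdsWithin_le_nhds (s := Set.Ioi 0))
    rw [Real.rpow_zero, one_mul] at h
    exact ((h.eventually (gt_mem_nhds (by linarith))).and self_mem_nhdsWithin).exists
  refine ⟨min η (σ / (2 * (v + 1))), by positivity, fun s hps hs => ?_⟩
  have hps' : (p : ℝ) < s := hps
  have hsη : (s : ℝ) - p ≤ η := hs.le.trans (min_le_left _ _)
  have hsv : (1 - (p : ℝ) / s) * v ≤ σ / 2 := by
    have hs1 : (1 : ℝ) < s := s.2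
    have h1 : 1 - (p : ℝ) / s ≤ σ / (2 * (v + 1)) := by
      rw [one_sub_div s.pos.ne']
      exact (div_le_self (by linarith) hs1.le).trans (hs.le.trans (min_le_right _ _))
    calc (1 - (p : ℝ) / s) * v ≤ σ / (2 * (v + 1)) * (v + 1) :=
          mul_le_mul h1 (by linarith) hv0 (by positivity)
      _ = σ / 2 := by field_simp
  set π : W1 Ω p → W1 Ω s := fun u => ∑ φ ∈ t, a φ u • testElt s φ with hπ
  have hincl : ∀ u, W1.incl hps.le (π u) = ∑ φ ∈ t, a φ u • testElt p φ := fun u => by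
    simp only [hπ, map_sum, map_smul, W1.incl_testElt]
  have hclose : ∀ u ∈ K, ‖u - W1.incl hps.le (π u)‖ ≤ δ := fun u hu => by
    rw [hincl]; exact happ u hu
  unfold eigenvalue
  rw [← coe_W10Submodule]
  refine (minmax_le_of_odd_map i (W10Submodule Ω s) hne hK hsym (zero_notMem_of_subset_unitSet hKM)
    hm (π := π) ?_ ?_ ?_ (a := 1 - σ) (b := c + σ) (by linarith) ?_ ?_).trans
      (ENNReal.ofReal_le_ofReal hσc)
  · exact continuousOn_finsetSum _ fun φ _ => (hac φ).smul continuousOn_const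
  · intro u _
    simp only [hπ, haodd]
    exact sum_neg_smul t (fun φ => a φ u) fun φ => testElt s φ
  · intro u _
    refine Submodule.sum_mem _ fun φ _ => Submodule.smul_mem _ _ ?_
    rw [← SetLike.mem_coe, coe_W10Submodule]
    exact testElt_mem_W10 s φ
  · intro u hu
    have h1 : ‖u.1.1‖ = 1 := powInt_eq_one_iff.1 (hKM hu).2
    have h2 : ‖u.1.1 - (W1.incl hps.le (π u)).1.1‖ ≤ δ :=
      (W1.norm_val_le (u - W1.incl hps.le (π u))).trans (hclose u hu)
    have h3 : 1 - δ ≤ ‖(W1.incl hps.le (π u)).1.1‖ := by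
      have := norm_sub_norm_le u.1.1 (W1.incl hps.le (π u)).1.1
      linarith
    have h4 : (1 - δ) ^ (p : ℝ) ≤ ‖(W1.incl hps.le (π u)).1.1‖ ^ (p : ℝ) :=
      Real.rpow_le_rpow (by linarith) h3 hp.le
    -- Young's inequality is read backwards: the `L^p` norm stays near `1`, so the `L^s` norm cannot
    -- fall below it by more than the small error.
    have h5 := norm_lpIncl_rpow_le hps.le (π u).1.1
    change (1 - δ) ^ (p : ℝ) ≤ ‖(lpIncl (Exponent.toENNReal_le hps.le) (π u).1.1 : LpOn Ω ℝ p)‖ ^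
      (p : ℝ) at h4
    linarith
  · intro u hu
    have h2 : ‖u.1.2 - (W1.incl hps.le (π u)).1.2‖ ≤ δ :=
      (W1.norm_grad_le (u - W1.incl hps.le (π u))).trans (hclose u hu)
    have h1 : ‖u.1.2‖ ≤ c ^ (p : ℝ)⁻¹ := by
      rw [Real.le_rpow_inv_iff_of_pos (norm_nonneg _) hc hp]
      exact hen u hu
    have h3 : ‖(W1.incl hps.le (π u)).1.2‖ ≤ c ^ (p : ℝ)⁻¹ + δ := by
      have := norm_sub_norm_le (W1.incl hps.le (π u)).1.2 u.1.2
      rw [norm_sub_rev] at this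
      linarith
    have h4 : ‖(W1.incl hps.le (π u)).1.2‖ ^ (p : ℝ) ≤ c + σ / 2 :=
      (Real.rpow_le_rpow (norm_nonneg _) h3 hp.le).trans hδ1.le
    rw [← energy_le_iff (by linarith), energy_eq_powInt] at h4 ⊢
    rw [sobGrad_incl] at h4
    calc powInt (volOn Ω) s (sobGrad (π u))
        ≤ ENNReal.ofReal (Λ ^ ((s : ℝ) - p)) * powInt (volOn Ω) p (sobGrad (π u)) :=
          powInt_le_of_ae_bound hΛ0 hp hps'.le (hΛ s (fun φ => a φ u) (hasum u hu))
      _ ≤ ENNReal.ofReal (Λ ^ η) * ENNReal.ofReal (c + σ / 2) := by gcongr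
      _ ≤ _ := by
          rw [← ENNReal.ofReal_mul (by positivity)]
          exact ENNReal.ofReal_le_ofReal hη.le

end UpperBoundRight

/-! ### Limit points in `L¹ × L¹` of bounded Sobolev sequences -/

section Compactness

variable {N : ℕ} {Ω : Opens (EuclideanSpace ℝ (Fin N))}

lemma isLinearMap_ballAvg (ε : ℝ) (z : EuclideanSpace ℝ (Fin N)) :
    IsLinearMap ℝ fun u : Lp ℝ 1 (volOn Ω) => ballAvg Ω ε u z := by
  refine ⟨fun u v => ?_, fun a u => ?_⟩
  · rw [ballAvg_congr (Lp.coeFn_add u v)]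
    unfold ballAvg
    rw [← mul_add, ← integral_add (L1.integrable_coeFn u).integrableOn
      (L1.integrable_coeFn v).integrableOn]
    rfl
  · rw [ballAvg_congr (Lp.coeFn_smul a u)]
    unfold ballAvg
    simp only [Pi.smul_apply]
    rw [integral_smul, smul_eq_mul, smul_eq_mul]
    ring

lemma powInt_one_coe {F : Type} [NormedAddCommGroup F] (f : Lp F 1 (volOn Ω)) : powInt (volOn Ω) 1 f = ENNReal.ofReal ‖f‖ := by
  rw [ofReal_norm, Lp.enorm_def, eLpNorm_one_eq_lintegral_enorm]
  simp [powInt]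

variable [IsFiniteMeasure (volOn Ω)]

section Lp

variable {F : Type} [NormedAddCommGroup F] [NormedSpace ℝ F]

lemma norm_toL1_le {s : Exponent} (f : LpOn Ω F s) :
    ‖toL1 s f‖ ≤ ‖f‖ ^ (s : ℝ) + (volOn Ω).real Set.univ := by
  have h := powInt_le_add (μ := volOn Ω) one_pos s.2.le (Lp.aestronglyMeasurable (toL1 s f))
  rw [powInt_one_coe] at h
  change _ ≤ powInt (volOn Ω) s f + _ at h
  rw [powInt_coe] at h
  have hs : 0 ≤ 1 / (s : ℝ) := by have := s.pos; positivity
  refine (ENNReal.ofReal_le_ofReal_iff (by positivity)).1 (h.trans ?_)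
  rw [ENNReal.ofReal_add (by positivity) measureReal_nonneg, ofReal_measureReal (measure_ne_top _ _)]
  gcongr
  exact mul_le_of_le_one_left zero_le (ENNReal.ofReal_le_one.2 (by linarith))

/-- An `L¹` function with finite `t`-th power integral, as an element of `L^t`. -/
lemma exists_toL1_eq {t : Exponent} {f : Lp F 1 (volOn Ω)} (h : powInt (volOn Ω) t f ≠ ∞) :
    ∃ g : LpOn Ω F t, toL1 t g = f := by
  refine ⟨⟨f.1, ?_⟩, rfl⟩
  rw [Lp.mem_Lp_iff_eLpNorm_lt_top, eLpNorm_eq_lintegral_rpow_enorm_toReal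
    (by simpa using t.pos) ENNReal.ofReal_ne_top, t.toReal_toENNReal]
  exact ENNReal.rpow_lt_top_of_nonneg (by have := t.pos; positivity) h

/-- Interpolation between `L¹` and `L^t`: a large `L` makes the `L^t` contribution small uniformly
in `n`, and with `L` fixed the `L¹` contribution tends to zero. -/
lemma tendsto_lpIncl_zero {r t : Exponent} (hrt : r < t) {f : ℕ → LpOn Ω F t} {R : ℝ}
    (hR : ∀ n, ‖f n‖ ≤ R) (h : Tendsto (fun n => toL1 t (f n)) atTop (𝓝 0)) :
    Tendsto (fun n => (lpIncl (Exponent.toENNReal_le hrt.le) (f n) : LpOn Ω F r)) atTop (𝓝 0) := by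
  have hrt' : (r : ℝ) < t := hrt
  have hR0 : 0 ≤ R := (norm_nonneg _).trans (hR 0)
  have h1 : Tendsto (fun n => ‖toL1 t (f n)‖) atTop (𝓝 0) := by simpa using h.norm
  have key : ∀ L : ℝ, 0 < L → ∀ n,
      ‖(lpIncl (Exponent.toENNReal_le hrt.le) (f n) : LpOn Ω F r)‖ ^ (r : ℝ) ≤
        L ^ ((r : ℝ) - 1) * ‖toL1 t (f n)‖ + L ^ ((r : ℝ) - t) * R ^ (t : ℝ) := by
    intro L hL n
    have h2 := powInt_interpolate (μ := volOn Ω) (le_of_lt r.2) hrt'.le hL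
      (Lp.aestronglyMeasurable (f n))
    rw [← lpIncl_coe (Exponent.toENNReal_le hrt.le) (f n), powInt_coe, lpIncl_coe, powInt_coe] at h2
    change _ ≤ _ * powInt (volOn Ω) 1 (toL1 t (f n)) + _ at h2
    rw [powInt_one_coe, ← ENNReal.ofReal_mul (by positivity), ← ENNReal.ofReal_mul (by positivity),
      ← ENNReal.ofReal_add (by positivity) (by positivity),
      ENNReal.ofReal_le_ofReal_iff (by positivity)] at h2
    refine h2.trans ?_
    gcongr
    exacts [t.pos.le, hR n]
  have hpow : Tendsto (fun n =>
      ‖(lpIncl (Exponent.toENNReal_le hrt.le) (f n) : LpOn Ω F r)‖ ^ (r : ℝ)) atTop (𝓝 0) := by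
    refine tendsto_order.2 ⟨fun a ha => Eventually.of_forall fun n => ha.trans_le (by positivity),
      fun e he => ?_⟩
    have hL : Tendsto (fun L : ℝ => L ^ ((r : ℝ) - t) * R ^ (t : ℝ)) atTop (𝓝 0) := by
      have := (tendsto_rpow_neg_atTop (sub_pos.2 hrt')).mul_const (R ^ (t : ℝ))
      simpa using this
    obtain ⟨L, hL1, hL0⟩ := ((hL.eventually (gt_mem_nhds he)).and (eventually_gt_atTop 0)).exists
    have h3 := (h1.const_mul (L ^ ((r : ℝ) - 1))).add_const (L ^ ((r : ℝ) - t) * R ^ (t : ℝ))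
    rw [mul_zero, zero_add] at h3
    exact (h3.eventually (gt_mem_nhds hL1)).mono fun n hn => (key L hL0 n).trans_lt hn
  rw [tendsto_zero_iff_norm_tendsto_zero]
  have h4 := hpow.rpow_const (p := (r : ℝ)⁻¹) (Or.inr (by have := r.pos; positivity))
  rw [Real.zero_rpow (inv_ne_zero r.pos.ne')] at h4
  refine h4.congr fun n => ?_
  rw [← Real.rpow_mul (norm_nonneg _), mul_inv_cancel₀ r.pos.ne', Real.rpow_one]

/-- `L¹` convergence of a sequence bounded in `L^t` improves to `L^r` convergence, `r < t`. -/
lemma exists_tendsto_lpIncl {r t : Exponent} (hrt : r < t) {f : ℕ → LpOn Ω F t} {R : ℝ}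
    (hR : ∀ n, ‖f n‖ ≤ R) {z : Lp F 1 (volOn Ω)}
    (h : Tendsto (fun n => toL1 t (f n)) atTop (𝓝 z)) :
    powInt (volOn Ω) t z ≤ ENNReal.ofReal (R ^ (t : ℝ)) ∧ ∃ g : LpOn Ω F r, toL1 r g = z ∧
      Tendsto (fun n => (lpIncl (Exponent.toENNReal_le hrt.le) (f n) : LpOn Ω F r)) atTop
        (𝓝 g) := by
  have hz : powInt (volOn Ω) t z ≤ ENNReal.ofReal (R ^ (t : ℝ)) := by
    refine powInt_le_of_tendsto_L1 h fun n => ?_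
    change powInt (volOn Ω) t (f n) ≤ _
    rw [powInt_coe]
    exact ENNReal.ofReal_le_ofReal
      (Real.rpow_le_rpow (norm_nonneg _) (hR n) t.pos.le)
  obtain ⟨g, hg⟩ := exists_toL1_eq (ne_top_of_le_ne_top ENNReal.ofReal_ne_top hz)
  refine ⟨hz, lpIncl (Exponent.toENNReal_le hrt.le) g, hg, ?_⟩
  have h0 : Tendsto (fun n => toL1 t (f n - g)) atTop (𝓝 0) := by
    simp only [map_sub, hg]
    simpa using h.sub_const z
  have h1 := tendsto_lpIncl_zero hrt (fun n => (norm_sub_le (f n) g).trans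
    (add_le_add_left (hR n) _)) h0
  simp only [map_sub] at h1
  simpa using h1.add_const (lpIncl (Exponent.toENNReal_le hrt.le) g : LpOn Ω F r)

end Lp

/-- The pair `(u, ∇u)` in `L¹ × L¹`. -/
noncomputable def W1.toL1Pair (t : Exponent) :
    W1 Ω t →ₗ[ℝ] Lp ℝ 1 (volOn Ω) × Lp (EuclideanSpace ℝ (Fin N)) 1 (volOn Ω) :=
  ((toL1 t).prodMap (toL1 t)).comp (W1 Ω t).subtype

lemma W1.toL1Pair_fst {t : Exponent} (u : W1 Ω t) : (W1.toL1Pair t u).1 = toL1 t u.1.1 := rfl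

lemma W1.toL1Pair_snd {t : Exponent} (u : W1 Ω t) : (W1.toL1Pair t u).2 = toL1 t u.1.2 := rfl

variable (Ω) in
/-- The bounded part of `W^{1,t}_0(Ω)`, inside `L¹ × L¹`. -/
def boundedPart (t : Exponent) (R₁ R₂ : ℝ) :
    Set (Lp ℝ 1 (volOn Ω) × Lp (EuclideanSpace ℝ (Fin N)) 1 (volOn Ω)) :=
  W1.toL1Pair t '' {v | v ∈ W10 Ω t ∧ ‖v.1.1‖ ≤ R₁ ∧ ‖v.1.2‖ ≤ R₂}

lemma convex_boundedPart (t : Exponent) (R₁ R₂ : ℝ) : Convex ℝ (boundedPart Ω t R₁ R₂) := by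
  refine Convex.linear_image ?_ _
  intro v hv w hw a b ha hb hab
  refine ⟨?_, ?_, ?_⟩
  · have hv' := hv.1
    have hw' := hw.1
    rw [← coe_W10Submodule] at hv' hw' ⊢
    exact (W10Submodule Ω t).add_mem ((W10Submodule Ω t).smul_mem a hv')
      ((W10Submodule Ω t).smul_mem b hw')
  · have h1 : ‖a • v.1.1 + b • w.1.1‖ ≤ a * R₁ + b * R₁ := by
      refine (norm_add_le _ _).trans ?_
      rw [norm_smul, norm_smul, Real.norm_of_nonneg ha, Real.norm_of_nonneg hb]
      gcongr
      exacts [hv.2.1, hw.2.1]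
    rwa [← add_mul, hab, one_mul] at h1
  · have h1 : ‖a • v.1.2 + b • w.1.2‖ ≤ a * R₂ + b * R₂ := by
      refine (norm_add_le _ _).trans ?_
      rw [norm_smul, norm_smul, Real.norm_of_nonneg ha, Real.norm_of_nonneg hb]
      gcongr
      exacts [hv.2.2, hw.2.2]
    rwa [← add_mul, hab, one_mul] at h1

/-- The power bounds survive `L¹` limits by Fatou. Membership in the Sobolev space needs norm
convergence, available only in exponents `r < t`; the loss is harmless because `t` can be taken
arbitrarily close to `p`. -/
lemma of_mem_closure_boundedPart {r t : Exponent} (hrt : r < t) {R₁ R₂ : ℝ}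
    {x : Lp ℝ 1 (volOn Ω) × Lp (EuclideanSpace ℝ (Fin N)) 1 (volOn Ω)}
    (hx : x ∈ closure (boundedPart Ω t R₁ R₂)) :
    powInt (volOn Ω) t x.1 ≤ ENNReal.ofReal (R₁ ^ (t : ℝ)) ∧
      powInt (volOn Ω) t x.2 ≤ ENNReal.ofReal (R₂ ^ (t : ℝ)) ∧
      ∃ v ∈ W10 Ω r, W1.toL1Pair r v = x := by
  obtain ⟨z, hz, hzx⟩ := mem_closure_iff_seq_limit.1 hx
  choose v hv hvz using hz
  have e1 : Tendsto (fun n => toL1 t (v n).1.1) atTop (𝓝 x.1) :=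
    ((continuous_fst.tendsto x).comp hzx).congr fun n => by
      rw [Function.comp_apply, ← hvz n, W1.toL1Pair_fst]
  have e2 : Tendsto (fun n => toL1 t (v n).1.2) atTop (𝓝 x.2) :=
    ((continuous_snd.tendsto x).comp hzx).congr fun n => by
      rw [Function.comp_apply, ← hvz n, W1.toL1Pair_snd]
  obtain ⟨h1, g₁, hg₁, ht₁⟩ := exists_tendsto_lpIncl hrt (fun n => (hv n).2.1) e1
  obtain ⟨h2, g₂, hg₂, ht₂⟩ := exists_tendsto_lpIncl hrt (fun n => (hv n).2.2) e2
  have ht : Tendsto (fun n => ((W1.incl hrt.le (v n) : W1 Ω r) :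
      LpOn Ω ℝ r × LpOn Ω (EuclideanSpace ℝ (Fin N)) r)) atTop (𝓝 (g₁, g₂)) :=
    ht₁.prodMk_nhds ht₂
  have hmem : (g₁, g₂) ∈ W1 Ω r :=
    (isClosed_W1 r).mem_of_tendsto ht (Eventually.of_forall fun n => (W1.incl hrt.le (v n)).2)
  refine ⟨h1, h2, ⟨(g₁, g₂), hmem⟩, ?_, Prod.ext hg₁ hg₂⟩
  exact (isClosed_W10 r).mem_of_tendsto (tendsto_subtype_rng.2 ht)
    (Eventually.of_forall fun n => W1.incl_mem_W10 hrt.le (hv n).1)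

/-- A sequence bounded in `W^{1,s_n}_0(Ω)`, `s_n ≥ t₀ > 1`, has a weak limit point in the sense
of convex sets of `L¹ × L¹`. -/
lemma exists_convex_limit_point {t : Exponent} {R₁ R₂ : ℝ}
    {f : ℕ → Lp ℝ 1 (volOn Ω) × Lp (EuclideanSpace ℝ (Fin N)) 1 (volOn Ω)}
    (hf : ∀ n, f n ∈ boundedPart Ω t R₁ R₂) :
    ∃ x, ∀ G : Set (Lp ℝ 1 (volOn Ω) × Lp (EuclideanSpace ℝ (Fin N)) 1 (volOn Ω)),
      Convex ℝ G → (∀ᶠ k in atTop, f k ∈ G) → x ∈ closure G := by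
  set V := (volOn Ω).real Set.univ
  have hpow : ∀ x ∈ boundedPart Ω t R₁ R₂,
      powInt (volOn Ω) t x.1 ≤ ENNReal.ofReal (R₁ ^ (t : ℝ)) ∧
        powInt (volOn Ω) t x.2 ≤ ENNReal.ofReal (R₂ ^ (t : ℝ)) := by
    rintro _ ⟨v, hv, rfl⟩
    refine ⟨(powInt_coe v.1.1).trans_le ?_, (powInt_coe v.1.2).trans_le ?_⟩
    · exact ENNReal.ofReal_le_ofReal (Real.rpow_le_rpow (norm_nonneg _) hv.2.1 t.pos.le)
    · exact ENNReal.ofReal_le_ofReal (Real.rpow_le_rpow (norm_nonneg _) hv.2.2 t.pos.le)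
  have hhull : convexHull ℝ (Set.range f) ⊆ boundedPart Ω t R₁ R₂ :=
    convexHull_min (by rintro _ ⟨n, rfl⟩; exact hf n) (convex_boundedPart t R₁ R₂)
  refine exists_mem_closure_of_eventually_mem_convex f
    (fun x => sqrtOneInt x.1 + sqrtOneInt x.2)
    (M := (V + (R₁ ^ (t : ℝ) + V)) + (V + (R₂ ^ (t : ℝ) + V)))
    (fun x => add_nonneg (sqrtOneInt_nonneg _) (sqrtOneInt_nonneg _)) (fun n => ?_)
    fun ε hε => ?_
  · obtain ⟨v, hv, hvf⟩ := hf n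
    have h1 := Real.rpow_le_rpow (norm_nonneg _) hv.2.1 t.pos.le
    have h2 := Real.rpow_le_rpow (norm_nonneg _) hv.2.2 t.pos.le
    rw [← hvf]
    refine add_le_add ((sqrtOneInt_le _).trans ?_) ((sqrtOneInt_le _).trans ?_)
    · have h3 := norm_toL1_le v.1.1
      rw [W1.toL1Pair_fst]
      linarith
    · have h3 := norm_toL1_le v.1.2
      rw [W1.toL1Pair_snd]
      linarith
  · obtain ⟨δ₁, hδ₁, H₁⟩ := exists_sqrtOneInt_modulus (E := ℝ) (μ := volOn Ω) t.2
      (ENNReal.ofReal_ne_top (r := R₁ ^ (t : ℝ))) hε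
    obtain ⟨δ₂, hδ₂, H₂⟩ := exists_sqrtOneInt_modulus (E := EuclideanSpace ℝ (Fin N))
      (μ := volOn Ω) t.2 (ENNReal.ofReal_ne_top (r := R₂ ^ (t : ℝ))) hε
    refine ⟨min δ₁ δ₂, lt_min hδ₁ hδ₂, fun a ha b hb hab => ?_⟩
    have n1 := sqrtOneInt_defect_nonneg a.1 b.1
    have n2 := sqrtOneInt_defect_nonneg a.2 b.2
    have hab' : sqrtOneInt a.1 + sqrtOneInt a.2 + (sqrtOneInt b.1 + sqrtOneInt b.2) -
      2 * (sqrtOneInt ((1 / 2 : ℝ) • a.1 + (1 / 2 : ℝ) • b.1) +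
        sqrtOneInt ((1 / 2 : ℝ) • a.2 + (1 / 2 : ℝ) • b.2)) ≤ min δ₁ δ₂ := hab
    obtain ⟨l1, l2⟩ := le_min_iff.1 hab'
    have pa := hpow a (hhull ha)
    have pb := hpow b (hhull hb)
    exact norm_prod_le_iff.2 ⟨H₁ a.1 b.1 pa.1 pb.1 (by linarith), H₂ a.2 b.2 pa.2 pb.2 (by linarith)⟩

end Compactness

/-! ### Lower bound from the left by weak compactness -/

section LowerBoundLeft

variable {N : ℕ} {Ω : Opens (EuclideanSpace ℝ (Fin N))} [IsFiniteMeasure (volOn Ω)]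

lemma mem_W10minusSubmodule {p : Exponent} {u : W1 Ω p} :
    u ∈ W10minusSubmodule Ω p ↔ u ∈ W10minus Ω p := by
  rw [← SetLike.mem_coe, coe_W10minusSubmodule]

/-- Weak compactness: bounded sequences in `W^{1,s_n}_0(Ω)`, with `s_n → p` from below, have a
limit point in `W^{1,p₋}_0(Ω)` along which the ball averages at finitely many given points
converge and the energy is lower semicontinuous. -/
lemma exists_weak_limit {p t₀ : Exponent} {s : ℕ → Exponent} (ht₀ : ∀ n, t₀ ≤ s n)
    (hsp : ∀ n, s n < p) (hlim : Tendsto (fun n => (s n : ℝ)) atTop (𝓝 p)) {c : ℝ} (hc : 0 ≤ c)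
    (u : ∀ n, W1 Ω (s n)) (hu : ∀ n, u n ∈ W10 Ω (s n)) (hu1 : ∀ n, ‖(u n).1.1‖ = 1)
    (huc : ∀ n, ‖(u n).1.2‖ ^ (s n : ℝ) ≤ c) (ε : ℝ) {ι : Type*} (z : ι → EuclideanSpace ℝ (Fin N))
    {α : ι → ℝ} (hα : ∀ j, Tendsto (fun n => ballAvg Ω ε (sobVal (u n)) (z j)) atTop (𝓝 (α j))) :
    ∃ v ∈ W10minus Ω p, ‖v.1.2‖ ^ (p : ℝ) ≤ c ∧ ∀ j, ballAvg Ω ε (sobVal v) (z j) = α j := by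
  set V := (volOn Ω).real Set.univ with hV
  have hV0 : 0 ≤ V := measureReal_nonneg
  -- Bounds given by Young's inequality at an intermediate exponent `t ≤ s n`. The `t`-th power of
  -- `R₂ t` tends to `c` as `t → p`, so no energy is lost in the limit.
  set R₁ : Exponent → ℝ := fun t => (1 + V) ^ (t : ℝ)⁻¹ with hR₁
  set R₂ : Exponent → ℝ := fun t => (c + (1 - (t : ℝ) / p) * V) ^ (t : ℝ)⁻¹ with hR₂
  have hfrac : ∀ t : Exponent, t ≤ p → 0 ≤ 1 - (t : ℝ) / p := fun t ht => by
    have : (t : ℝ) / p ≤ 1 := (div_le_one p.pos).2 ht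
    linarith
  set f := fun n => W1.toL1Pair (s n) (u n) with hf
  have hmem : ∀ (t : Exponent) (n : ℕ), t ≤ s n → f n ∈ boundedPart Ω t (R₁ t) (R₂ t) := by
    intro t n htn
    have htp : t ≤ p := htn.trans (hsp n).le
    have hts : (t : ℝ) / p ≤ (t : ℝ) / s n :=
      div_le_div_of_nonneg_left t.pos.le (s n).pos (hsp n).le
    refine ⟨W1.incl htn (u n), ⟨W1.incl_mem_W10 htn (hu n), ?_, ?_⟩, rfl⟩
    · rw [hR₁, Real.le_rpow_inv_iff_of_pos (norm_nonneg _) (by positivity) t.pos]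
      refine (norm_lpIncl_rpow_le htn (u n).1.1).trans ?_
      rw [hu1 n, Real.one_rpow]
      have : 0 ≤ (t : ℝ) / s n := div_nonneg t.pos.le (s n).pos.le
      nlinarith
    · rw [hR₂, Real.le_rpow_inv_iff_of_pos (norm_nonneg _)
        (add_nonneg hc (mul_nonneg (hfrac t htp) hV0)) t.pos]
      refine (norm_lpIncl_rpow_le htn (u n).1.2).trans ?_
      gcongr
      exact huc n
  -- The single exponent `t₀ > 1` gives uniform convexity for the whole sequence. For each `t < p`
  -- the tail lies in the convex set `boundedPart Ω t`, so the one point `x` belongs to the closures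
  -- of all of them.
  obtain ⟨x, hx⟩ := exists_convex_limit_point fun n => hmem t₀ n (ht₀ n)
  have hcl : ∀ t : Exponent, t < p → x ∈ closure (boundedPart Ω t (R₁ t) (R₂ t)) := fun t ht =>
    hx _ (convex_boundedPart t _ _)
      ((hlim.eventually (lt_mem_nhds (show (t : ℝ) < p from ht))).mono fun n hn => hmem t n hn.le)
  have hbetween : ∀ r : Exponent, r < p → ∃ t : Exponent, r < t ∧ t < p := fun r hr => by
    obtain ⟨y, hy1, hy2⟩ := exists_between (show (r : ℝ) < p from hr)
    exact ⟨⟨y, lt_trans r.2 hy1⟩, hy1, hy2⟩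
  have hbelow : ∀ t : Exponent, ∃ r : Exponent, r < t := fun t => by
    obtain ⟨y, hy1, hy2⟩ := exists_between (show (1 : ℝ) < t from t.2)
    exact ⟨⟨y, hy1⟩, hy2⟩
  have hR₁pow : ∀ t : Exponent, R₁ t ^ (t : ℝ) = 1 + V := fun t =>
    Real.rpow_inv_rpow (by positivity) t.pos.ne'
  have hR₂pow : ∀ t : Exponent, t ≤ p → R₂ t ^ (t : ℝ) = c + (1 - (t : ℝ) / p) * V := fun t ht =>
    Real.rpow_inv_rpow (add_nonneg hc (mul_nonneg (hfrac t ht) hV0)) t.pos.ne'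
  have hx1 : powInt (volOn Ω) p x.1 ≤ ENNReal.ofReal (1 + V) := by
    refine powInt_le_of_lt (M := 0) p.2 (Lp.aestronglyMeasurable _) (by simp) fun t ht htp => ?_
    obtain ⟨r, hr⟩ := hbelow ⟨t, ht⟩
    have h := (of_mem_closure_boundedPart hr (hcl ⟨t, ht⟩ htp)).1
    rw [hR₁pow] at h
    simpa using h
  have hx2 : powInt (volOn Ω) p x.2 ≤ ENNReal.ofReal c := by
    refine powInt_le_of_lt (M := volOn Ω Set.univ) p.2 (Lp.aestronglyMeasurable _)
      (measure_ne_top _ _) fun t ht htp => ?_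
    obtain ⟨r, hr⟩ := hbelow ⟨t, ht⟩
    have h := (of_mem_closure_boundedPart hr (hcl ⟨t, ht⟩ htp)).2.1
    rw [hR₂pow ⟨t, ht⟩ (le_of_lt htp), ENNReal.ofReal_add hc (mul_nonneg (hfrac ⟨t, ht⟩
      (le_of_lt htp)) hV0), ENNReal.ofReal_mul' hV0, ofReal_measureReal (measure_ne_top _ _)] at h
    exact h
  obtain ⟨g₁, hg₁⟩ := exists_toL1_eq (ne_top_of_le_ne_top ENNReal.ofReal_ne_top hx1)
  obtain ⟨g₂, hg₂⟩ := exists_toL1_eq (ne_top_of_le_ne_top ENNReal.ofReal_ne_top hx2)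
  have hW : ∀ r : Exponent, r < p → ∃ w ∈ W10 Ω r, W1.toL1Pair r w = x := fun r hr => by
    obtain ⟨t, hrt, htp⟩ := hbetween r hr
    exact (of_mem_closure_boundedPart hrt (hcl t htp)).2.2
  have hval : ∀ (r : Exponent) (w : W1 Ω r), W1.toL1Pair r w = x →
      sobVal w = (g₁ : EuclideanSpace ℝ (Fin N) → ℝ) := fun r w hw =>
    congrArg (fun f : Lp ℝ 1 (volOn Ω) => (f : EuclideanSpace ℝ (Fin N) → ℝ))
      ((congrArg Prod.fst hw).trans hg₁.symm)
  have hgrad : ∀ (r : Exponent) (w : W1 Ω r), W1.toL1Pair r w = x →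
      sobGrad w = (g₂ : EuclideanSpace ℝ (Fin N) → EuclideanSpace ℝ (Fin N)) := fun r w hw =>
    congrArg (fun f : Lp (EuclideanSpace ℝ (Fin N)) 1 (volOn Ω) =>
      (f : EuclideanSpace ℝ (Fin N) → EuclideanSpace ℝ (Fin N)))
      ((congrArg Prod.snd hw).trans hg₂.symm)
  -- The pair `(g₁, g₂)` has the same underlying functions as some Sobolev element at an exponent `r
  -- < p`, and the weak gradient identity does not depend on the exponent.
  have hweak : IsWeakGradient Ω g₁ g₂ := by
    obtain ⟨r, hr⟩ := hbelow p
    obtain ⟨w, -, hw⟩ := hW r hr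
    rw [← hval r w hw, ← hgrad r w hw]
    exact w.2
  refine ⟨⟨(g₁, g₂), hweak⟩, fun r hr => ?_, ?_, fun j => ?_⟩
  · obtain ⟨w, hw, hwx⟩ := hW r hr
    exact ⟨w, hw, Eventually.of_forall fun y => congrFun (hval r w hwx) y⟩
  · rw [← hg₂] at hx2
    exact (ENNReal.ofReal_le_ofReal_iff hc).1 ((powInt_coe g₂).symm.trans_le hx2)
  · have hxj : ballAvg Ω ε x.1 (z j) = α j := by
      refine eq_of_forall_dist_le fun ρ hρ => ?_
      -- A slab on which the ball average is within `ρ` of its limit is closed and convex and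
      -- eventually contains the sequence, hence contains `x`.
      set G := (fun y : Lp ℝ 1 (volOn Ω) × Lp (EuclideanSpace ℝ (Fin N)) 1 (volOn Ω) =>
        ballAvg Ω ε y.1 (z j)) ⁻¹' Metric.closedBall (α j) ρ with hG
      have hGc : IsClosed G := Metric.isClosed_closedBall.preimage
        ((PLaplace.continuous_ballAvg ε (z j)).comp continuous_fst)
      have hGconv : Convex ℝ G := (convex_closedBall (α j) ρ).is_linear_preimage
        (⟨fun a b => (isLinearMap_ballAvg ε (z j)).map_add a.1 b.1,
          fun k a => (isLinearMap_ballAvg ε (z j)).map_smul k a.1⟩)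
      have h := hx G hGconv ((hα j).eventually (Metric.closedBall_mem_nhds _ hρ))
      rw [hGc.closure_eq] at h
      exact h
    rw [← hg₁] at hxj
    exact hxj

/-- Normalised functions of bounded energy in `W^{1,s}_0(Ω)` are close in `L^s`, when `s` is
close to `p` from below, to functions of `W^{1,p₋}_0(Ω)` with the same energy bound. -/
lemma exists_close_W10minus (hΩ : Bornology.IsBounded (Ω : Set (EuclideanSpace ℝ (Fin N))))
    (p : Exponent) {c δ : ℝ} (hc : 0 ≤ c) (hδ : 0 < δ) :
    ∃ η > 0, ∀ (s : Exponent) (h : s < p), (p : ℝ) - s < η → ∀ u ∈ W10 Ω s, ‖u.1.1‖ = 1 →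
      ‖u.1.2‖ ^ (s : ℝ) ≤ c → ∃ v ∈ W10minus Ω p, ‖v.1.2‖ ^ (p : ℝ) ≤ c ∧
        ‖u.1.1 - (W1.incl h.le v).1.1‖ < δ := by
  by_contra! H
  have hp1 : (1 : ℝ) < p := p.2
  have hp := p.pos
  set V := (volOn Ω).real Set.univ with hV
  have hV0 : 0 ≤ V := measureReal_nonneg
  -- A sequence of counterexamples with `s n → p`; the factor `(p - 1) / 2` keeps every `s n` above
  -- `(p + 1) / 2 > 1`.
  choose s hsp hsη u hu hu1 huc hfar using fun n : ℕ =>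
    H (((p : ℝ) - 1) / 2 * (1 / ((n : ℝ) + 1))) (mul_pos (by linarith) Nat.one_div_pos_of_nat)
  set D := (min δ 1) ^ (p : ℝ) with hD
  have hD0 : 0 < D := by positivity
  -- The contradiction is that the `r`-th power of the `L^r` norm of `w = u' - v'` is at least `D`
  -- but at most `2 / 3 * D`: one third from `w` minus its cell averages (through `κ`), one third
  -- from the averages (through `ρ`).
  set κ := D / (3 * (2 ^ (p : ℝ) * (2 ^ (p : ℝ) * (2 * c + V + 1)))) with hκ
  obtain ⟨ε, P, hε, hP⟩ := exists_ballCells_of_pos hΩ (κ := κ) (by positivity)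
  set A₀ := (volume.real (Metric.ball (0 : EuclideanSpace ℝ (Fin N)) ε))⁻¹ * (1 + V) with hA₀
  have hbd : ∀ n z, |ballAvg Ω ε (sobVal (u n)) z| ≤ A₀ := fun n z =>
    (abs_ballAvg_le (W1.integrable_val (u n)) _).trans (mul_le_mul_of_nonneg_left
      (integral_abs_le_of_powInt_eq_one (powInt_eq_one_iff.2 (hu1 n)))
      (inv_nonneg.2 measureReal_nonneg))
  have hA0 : 0 ≤ A₀ := (abs_nonneg _).trans (hbd 0 0)
  -- Only finitely many averages occur on `Ω`, and they are bounded, so a subsequence makes all of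
  -- them converge.
  obtain ⟨α, -, σ, hσ, hα⟩ := (isCompact_closedBall (0 : Fin P.bound → ℝ) A₀).tendsto_subseq
    (x := fun n (j : Fin P.bound) => ballAvg Ω ε (sobVal (u n)) (P.center j)) fun n => by
      rw [mem_closedBall_zero_iff, pi_norm_le_iff_of_nonneg hA0]
      exact fun j => hbd n _
  have hst : Tendsto (fun n => (s n : ℝ)) atTop (𝓝 p) := by
    have h0 : Tendsto (fun n : ℕ => (p : ℝ) - ((p : ℝ) - 1) / 2 * (1 / ((n : ℝ) + 1))) atTop
        (𝓝 p) := by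
      have := (tendsto_one_div_add_atTop_nhds_zero_nat (𝕜 := ℝ)).const_mul (((p : ℝ) - 1) / 2)
        |>.const_sub (p : ℝ)
      simpa using this
    exact tendsto_of_tendsto_of_tendsto_of_le_of_le h0 tendsto_const_nhds
      (fun n => by have := hsη n; simp only; linarith) fun n => le_of_lt (hsp n)
  obtain ⟨v, hv, hvc, hvα⟩ := exists_weak_limit (t₀ := ⟨((p : ℝ) + 1) / 2, by
      rw [Set.mem_Ioi]; linarith⟩) (s := s ∘ σ) (fun n => by
      have h1 := hsη (σ n)
      have h2 : 1 / ((σ n : ℝ) + 1) ≤ 1 := by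
        rw [div_le_one (by positivity)]
        linarith [(Nat.cast_nonneg (σ n) : (0 : ℝ) ≤ σ n)]
      have h3 : ((p : ℝ) - 1) / 2 * (1 / ((σ n : ℝ) + 1)) ≤ ((p : ℝ) - 1) / 2 :=
        mul_le_of_le_one_right (by linarith) h2
      change ((p : ℝ) + 1) / 2 ≤ s (σ n)
      linarith) (fun n => hsp (σ n)) (hst.comp hσ.tendsto_atTop) hc (fun n => u (σ n))
    (fun n => hu (σ n)) (fun n => hu1 (σ n)) (fun n => huc (σ n)) ε
    (fun j : Fin P.bound => P.center j) (α := α) fun j => (tendsto_pi_nhds.1 hα) j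
  set ρ := min 1 (D / (3 * (2 ^ (p : ℝ) * (V + 1)))) with hρ
  have hρ0 : 0 < ρ := by positivity
  obtain ⟨n, hn⟩ := (hα.eventually (Metric.closedBall_mem_nhds α hρ0)).exists
  set r := s (σ n) with hr
  have hrp : r < p := hsp (σ n)
  have hrp' : (r : ℝ) < p := hrp
  have hr1 : (1 : ℝ) ≤ r := le_of_lt r.2
  set u' : W1 Ω r := u (σ n) with hu'
  set v' : W1 Ω r := W1.incl hrp.le v with hv'
  have hfar' : δ ≤ ‖u'.1.1 - v'.1.1‖ := hfar (σ n) v hv hvc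
  set w := u' - v' with hw
  have hwmem : w ∈ W10minus Ω r := by
    refine W10_subset_W10minus r ?_
    have h1 := hu (σ n)
    have h2 := mem_W10minus_iff.1 hv r hrp
    rw [← coe_W10Submodule] at h1 h2 ⊢
    exact (W10Submodule Ω r).sub_mem h1 h2
  have hpow2 : (2 : ℝ≥0∞) ^ (r : ℝ) ≤ ENNReal.ofReal (2 ^ (p : ℝ)) := by
    rw [← ENNReal.ofReal_rpow_of_pos two_pos, ENNReal.ofReal_ofNat]
    exact ENNReal.rpow_le_rpow_of_exponent_le one_le_two hrp'.le
  have hE : energy w ≤ ENNReal.ofReal (2 ^ (p : ℝ) * (2 * c + V + 1)) := by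
    have e1 : powInt (volOn Ω) r (sobGrad u') ≤ ENNReal.ofReal c :=
      (energy_le_iff hc).2 (huc (σ n))
    have e2 : powInt (volOn Ω) r (sobGrad v') ≤ ENNReal.ofReal (c + V) := by
      rw [hv', sobGrad_incl]
      refine (powInt_le_add r.pos hrp'.le (W1.aestronglyMeasurable_grad v)).trans ?_
      rw [ENNReal.ofReal_add hc hV0, ofReal_measureReal (measure_ne_top _ _)]
      refine add_le_add ((energy_le_iff hc).2 hvc) (mul_le_of_le_one_left zero_le
        (ENNReal.ofReal_le_one.2 ?_))
      have : 0 ≤ (r : ℝ) / p := div_nonneg r.pos.le hp.le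
      linarith
    calc energy w = powInt (volOn Ω) r (fun x => sobGrad u' x - sobGrad v' x) :=
          powInt_congr (sobGrad_sub u' v')
      _ ≤ 2 ^ (r : ℝ) * (powInt (volOn Ω) r (sobGrad u') + powInt (volOn Ω) r (sobGrad v')) :=
          powInt_sub_le hr1 (W1.aestronglyMeasurable_grad u')
      _ ≤ ENNReal.ofReal (2 ^ (p : ℝ)) * (ENNReal.ofReal c + ENNReal.ofReal (c + V)) := by gcongr
      _ ≤ _ := by
          rw [← ENNReal.ofReal_add hc (by positivity), ← ENNReal.ofReal_mul (by positivity)]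
          refine ENNReal.ofReal_le_ofReal (mul_le_mul_of_nonneg_left ?_ (by positivity))
          linarith
  have havg : powInt (volOn Ω) r (P.avg (sobVal w)) ≤ ENNReal.ofReal (ρ * (V + 1)) := by
    have hpt : ∀ x ∈ (Ω : Set (EuclideanSpace ℝ (Fin N))), |P.avg (sobVal w) x| ≤ ρ := by
      intro x hx
      have h1 : P.avg (sobVal w) x = ballAvg Ω ε (sobVal u') (P.center (P.cell x)) -
          ballAvg Ω ε (sobVal v) (P.center (P.cell x)) := by
        rw [BallCells.avg, ballAvg_congr (sobVal_sub u' v'), ballAvg_sub (W1.integrable_val u')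
          (W1.integrable_val v')]
        rfl
      have h2 := (dist_pi_le_iff hρ0.le).1 hn ⟨P.cell x, P.cell_lt x hx⟩
      rw [h1, hvα ⟨P.cell x, P.cell_lt x hx⟩]
      exact h2
    calc powInt (volOn Ω) r (P.avg (sobVal w)) ≤ ∫⁻ _, ENNReal.ofReal ρ ∂(volOn Ω) := by
          refine lintegral_mono_ae ?_
          filter_upwards [ae_restrict_mem Ω.isOpen.measurableSet] with x hx
          rw [enorm_rpow_eq_ofReal _ r.pos.le]
          refine ENNReal.ofReal_le_ofReal ?_
          calc ‖P.avg (sobVal w) x‖ ^ (r : ℝ) ≤ ρ ^ (r : ℝ) :=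
                Real.rpow_le_rpow (norm_nonneg _) (hpt x hx) r.pos.le
            _ ≤ ρ ^ (1 : ℝ) :=
                Real.rpow_le_rpow_of_exponent_ge hρ0 (min_le_left _ _) hr1
            _ = ρ := Real.rpow_one _
      _ = ENNReal.ofReal ρ * ENNReal.ofReal V := by
          rw [lintegral_const, ofReal_measureReal (measure_ne_top _ _)]
      _ ≤ _ := by
          rw [← ENNReal.ofReal_mul hρ0.le]
          exact ENNReal.ofReal_le_ofReal (by nlinarith)
  have hfin : powInt (volOn Ω) r (sobVal w) ≤ ENNReal.ofReal (2 / 3 * D) := by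
    calc powInt (volOn Ω) r (sobVal w) = powInt (volOn Ω) r
          (fun x => (sobVal w x - P.avg (sobVal w) x) + P.avg (sobVal w) x) := by simp
      _ ≤ 2 ^ (r : ℝ) * (powInt (volOn Ω) r (fun x => sobVal w x - P.avg (sobVal w) x) +
            powInt (volOn Ω) r (P.avg (sobVal w))) :=
          powInt_add_le hr1 ((W1.aestronglyMeasurable_val w).sub
            (P.measurable_avg _).aestronglyMeasurable)
      _ ≤ ENNReal.ofReal (2 ^ (p : ℝ)) * (ENNReal.ofReal κ *
            ENNReal.ofReal (2 ^ (p : ℝ) * (2 * c + V + 1)) + ENNReal.ofReal (ρ * (V + 1))) := by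
          refine mul_le_mul' hpow2 (add_le_add ((hP r w hwmem).trans ?_) havg)
          exact mul_le_mul_right hE _
      _ = ENNReal.ofReal (2 ^ (p : ℝ) * (κ * (2 ^ (p : ℝ) * (2 * c + V + 1)) +
            ρ * (V + 1))) := by
          rw [← ENNReal.ofReal_mul (by positivity), ← ENNReal.ofReal_add (by positivity)
            (by positivity), ← ENNReal.ofReal_mul (by positivity)]
      _ ≤ _ := by
          refine ENNReal.ofReal_le_ofReal ?_
          have e1 : 2 ^ (p : ℝ) * (κ * (2 ^ (p : ℝ) * (2 * c + V + 1))) = D / 3 := by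
            rw [hκ]; field_simp
          have e2 : 2 ^ (p : ℝ) * (ρ * (V + 1)) ≤ D / 3 := by
            calc 2 ^ (p : ℝ) * (ρ * (V + 1)) ≤
                  2 ^ (p : ℝ) * (D / (3 * (2 ^ (p : ℝ) * (V + 1))) * (V + 1)) := by
                  gcongr; exact min_le_right _ _
              _ = D / 3 := by field_simp
          rw [mul_add]
          linarith
  rw [powInt_sobVal, ENNReal.ofReal_le_ofReal_iff (by positivity)] at hfin
  have hwδ : min δ 1 ≤ ‖w.1.1‖ := (min_le_left _ _).trans hfar'
  have : D ≤ ‖w.1.1‖ ^ (r : ℝ) := by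
    calc D ≤ (min δ 1) ^ (r : ℝ) :=
          Real.rpow_le_rpow_of_exponent_ge (by positivity) (min_le_right _ _) hrp'.le
      _ ≤ _ := Real.rpow_le_rpow (by positivity) hwδ r.pos.le
  linarith

/-- Lower semicontinuity from the left: near `p`, the eigenvalues below `p` almost bound the
lower eigenvalue at `p`. -/
lemma exists_lowerEigenvalue_le_of_lt
    (hΩ : Bornology.IsBounded (Ω : Set (EuclideanSpace ℝ (Fin N)))) (i : TopIndex) (m : ℕ)
    (p : Exponent) {c c' : ℝ} (hc : 0 ≤ c) (hcc' : c < c') :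
    ∃ η > 0, ∀ s : Exponent, s < p → (p : ℝ) - s < η →
      eigenvalue i Ω m s < ENNReal.ofReal c → lowerEigenvalue i Ω m p ≤ ENNReal.ofReal c' := by
  obtain ⟨σ, hσ, hσ1, hσc⟩ := exists_pos_div_le hcc'
  have hp := p.pos
  set v := (volOn Ω).real Set.univ with hv
  have hv0 : 0 ≤ v := measureReal_nonneg
  obtain ⟨δ, hδ2, hδ0, hδle⟩ : ∃ δ : ℝ, 1 - σ / 2 < (1 - δ) ^ (p : ℝ) ∧ 0 < δ ∧ δ < 1 := by
    have t2 : Tendsto (fun δ : ℝ => (1 - δ) ^ (p : ℝ)) (𝓝[>] 0) (𝓝 1) := by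
      have : Continuous fun δ : ℝ => (1 - δ) ^ (p : ℝ) :=
        (continuous_const.sub continuous_id).rpow_const fun _ => Or.inr hp.le
      have h := (this.tendsto 0).mono_left (nhdsWithin_le_nhds (s := Set.Ioi 0))
      rwa [sub_zero, Real.one_rpow] at h
    exact ((t2.eventually (lt_mem_nhds (by linarith))).and (Ioo_mem_nhdsGT one_pos)).exists
  obtain ⟨η₁, hη₁, H⟩ := exists_close_W10minus hΩ p hc hδ0
  refine ⟨min η₁ (σ / (2 * (v + 1))), by positivity, fun s hsp hs hlt => ?_⟩
  have hsp' : (s : ℝ) < p := hsp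
  have hsv : (1 - (s : ℝ) / p) * v ≤ σ / 2 := by
    have hp1 : (1 : ℝ) < p := p.2
    have h1 : 1 - (s : ℝ) / p ≤ σ / (2 * (v + 1)) := by
      rw [one_sub_div hp.ne']
      exact (div_le_self (by linarith) hp1.le).trans (hs.le.trans (min_le_right _ _))
    calc (1 - (s : ℝ) / p) * v ≤ σ / (2 * (v + 1)) * (v + 1) :=
          mul_le_mul h1 (by linarith) hv0 (by positivity)
      _ = σ / 2 := by field_simp
  obtain ⟨K, hne, hK, hsym, hKM, hm, hen⟩ := exists_of_minmax_lt hc hlt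
  -- Only the function values are approximated, not the gradients: the energy of the combination
  -- will follow from the bounds on its members.
  obtain ⟨t, a, hac, haodd, hasum, happ⟩ := exists_odd_combination
    (T := fun u : W1 Ω s => u.1.1) (continuous_fst.comp continuous_subtype_val) (fun _ => rfl) hK
    (fun w : {w : W1 Ω p // w ∈ W10minus Ω p ∧ ‖w.1.2‖ ^ (p : ℝ) ≤ c} =>
      (W1.incl hsp.le w.1).1.1) (δ := δ) (fun u hu => by
      obtain ⟨w, hw, hwc, hd⟩ := H s hsp (hs.trans_le (min_le_left _ _)) u (hKM hu).1
        (powInt_eq_one_iff.1 (hKM hu).2) (hen u hu)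
      exact ⟨⟨w, hw, hwc⟩, hd⟩)
  set π : W1 Ω s → W1 Ω p := fun u => ∑ w ∈ t, a w u • w.1 with hπ
  unfold lowerEigenvalue
  rw [← coe_W10minusSubmodule]
  refine (minmax_le_of_odd_map i (W10minusSubmodule Ω p) hne hK hsym
    (zero_notMem_of_subset_unitSet hKM) hm (π := π) ?_ ?_ ?_ (a := 1 - σ) (b := c + σ)
    (by linarith) ?_ ?_).trans (ENNReal.ofReal_le_ofReal hσc)
  · exact continuousOn_finsetSum _ fun w _ => (hac w).smul continuousOn_const
  · intro u _
    simp only [hπ, haodd]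
    exact sum_neg_smul t (fun w => a w u) fun w => w.1
  · exact fun u _ => Submodule.sum_mem _ fun w _ =>
      Submodule.smul_mem _ _ (mem_W10minusSubmodule.2 w.2.1)
  · intro u hu
    have h1 : ‖u.1.1‖ = 1 := powInt_eq_one_iff.1 (hKM hu).2
    have h2 : ‖u.1.1 - (W1.incl hsp.le (π u)).1.1‖ ≤ δ := by
      have e : (W1.incl hsp.le (π u)).1.1 = ∑ w ∈ t, a w u • (W1.incl hsp.le w.1).1.1 := by
        rw [← W1.sum_smul_val t (fun w => a w u) fun w => W1.incl hsp.le w.1]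
        simp only [hπ, map_sum, map_smul]
      rw [e]
      exact happ u hu
    have h3 : 1 - δ ≤ ‖(W1.incl hsp.le (π u)).1.1‖ := by
      have := norm_sub_norm_le u.1.1 (W1.incl hsp.le (π u)).1.1
      linarith
    -- The base `1 - δ` lies in `(0, 1)`, so lowering the exponent from `p` to `s` only increases
    -- the power.
    have h4 : (1 - δ) ^ (p : ℝ) ≤ ‖(W1.incl hsp.le (π u)).1.1‖ ^ (s : ℝ) :=
      (Real.rpow_le_rpow_of_exponent_ge (by linarith) (by linarith) hsp'.le).trans
        (Real.rpow_le_rpow (by linarith) h3 s.pos.le)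
    have h5 := norm_lpIncl_rpow_le hsp.le (π u).1.1
    change _ ≤ ‖(π u).1.1‖ ^ (p : ℝ) + _ at h5
    change _ ≤ ‖(lpIncl (Exponent.toENNReal_le hsp.le) (π u).1.1 : LpOn Ω ℝ s)‖ ^ (s : ℝ) at h4
    linarith
  · intro u hu
    -- The triangle inequality with `∑ |a w u| ≤ 1` keeps the gradient norm within the common bound
    -- `c ^ p⁻¹`.
    have h1 : ‖(π u).1.2‖ ≤ c ^ (p : ℝ)⁻¹ := by
      have e : (π u).1.2 = ∑ w ∈ t, a w u • w.1.1.2 :=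
        W1.sum_smul_grad t (fun w => a w u) fun w => w.1
      rw [e]
      refine (norm_sum_le _ _).trans ((Finset.sum_le_sum (g := fun w => |a w u| * c ^ (p : ℝ)⁻¹)
        fun w _ => ?_).trans ?_)
      · rw [norm_smul, Real.norm_eq_abs]
        refine mul_le_mul_of_nonneg_left ?_ (abs_nonneg _)
        rw [Real.le_rpow_inv_iff_of_pos (norm_nonneg _) hc hp]
        exact w.2.2
      · rw [← Finset.sum_mul]
        exact mul_le_of_le_one_left (by positivity) (hasum u hu)
    rw [Real.le_rpow_inv_iff_of_pos (norm_nonneg _) hc hp] at h1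
    linarith

end LowerBoundLeft

/-! ### Passage to the limits -/

section Limits

lemma exists_real_btwn_pair {l a : ℝ≥0∞} (h : l < a) :
    ∃ c c' : ℝ, 0 ≤ c ∧ c < c' ∧ l < ENNReal.ofReal c ∧ ENNReal.ofReal c' < a := by
  obtain ⟨c, hc, hlc, hca⟩ := ENNReal.lt_iff_exists_real_btwn.1 h
  obtain ⟨c', -, hcc', hca'⟩ := ENNReal.lt_iff_exists_real_btwn.1 hca
  exact ⟨c, c', hc, (ENNReal.ofReal_lt_ofReal_iff_of_nonneg hc).1 hcc', hlc, hca'⟩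

lemma eventually_abs_sub_lt (p : Exponent) {η : ℝ} (hη : 0 < η) :
    ∀ᶠ s : Exponent in 𝓝 p, |(s : ℝ) - p| < η :=
  (Metric.ball_mem_nhds p hη)

end Limits

end PLaplace

open PLaplace in
theorem theorem6p1 {N : ℕ} (Ω : Opens (EuclideanSpace ℝ (Fin N)))
    (hΩ : Bornology.IsBounded (Ω : Set (EuclideanSpace ℝ (Fin N))))
    (i : PLaplace.TopIndex) (p : PLaplace.Exponent) (m : ℕ) (hm : 1 ≤ m) :
    (Tendsto (fun s : PLaplace.Exponent => PLaplace.lowerEigenvalue i Ω m s) (𝓝[<] p)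
        (𝓝 (PLaplace.lowerEigenvalue i Ω m p)) ∧
      Tendsto (fun s : PLaplace.Exponent => PLaplace.eigenvalue i Ω m s) (𝓝[<] p)
        (𝓝 (PLaplace.lowerEigenvalue i Ω m p))) ∧
    (Tendsto (fun s : PLaplace.Exponent => PLaplace.lowerEigenvalue i Ω m s) (𝓝[>] p)
        (𝓝 (PLaplace.eigenvalue i Ω m p)) ∧
      Tendsto (fun s : PLaplace.Exponent => PLaplace.eigenvalue i Ω m s) (𝓝[>] p)
        (𝓝 (PLaplace.eigenvalue i Ω m p))) := by
  have hfin : IsFiniteMeasure (volOn Ω) :=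
    ⟨by rw [Measure.restrict_apply_univ]; exact hΩ.measure_lt_top⟩
  have hLE : ∀ s, lowerEigenvalue i Ω m s ≤ eigenvalue i Ω m s := fun s =>
    lowerEigenvalue_le_eigenvalue i m s
  have leftUpper : ∀ a, lowerEigenvalue i Ω m p < a → ∀ᶠ s in 𝓝[<] p, eigenvalue i Ω m s < a := by
    intro a ha
    obtain ⟨c, c', hc, hcc', hl, hr⟩ := exists_real_btwn_pair ha
    -- Comparison (a) with `p` itself as the larger exponent.
    obtain ⟨η, hη, H⟩ := exists_eigenvalue_le_of_lowerEigenvalue_lt hΩ i m p hc hcc'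
    filter_upwards [self_mem_nhdsWithin,
      (eventually_abs_sub_lt p hη).filter_mono nhdsWithin_le_nhds] with s hs hsη
    exact (H s p hs hsη (by simpa using hη) hl).trans_lt hr
  have leftLower : ∀ a, a < lowerEigenvalue i Ω m p →
      ∀ᶠ s in 𝓝[<] p, a < lowerEigenvalue i Ω m s := by
    intro a ha
    obtain ⟨c, c', hc, hcc', hl, hr⟩ := exists_real_btwn_pair ha
    -- Two comparisons are chained: from the lower eigenvalue at `s` to the eigenvalue at some `q <
    -- s`, then to the lower eigenvalue at `p`. The gap `d < d'` turns the non-strict output of one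
    -- into the strict input of the other.
    obtain ⟨d, hcd, hdc'⟩ := exists_between hcc'
    obtain ⟨d', hdd', hdc''⟩ := exists_between hdc'
    have hd : 0 ≤ d := hc.trans hcd.le
    obtain ⟨η₁, hη₁, H₁⟩ := exists_eigenvalue_le_of_lowerEigenvalue_lt hΩ i m p hc hcd
    obtain ⟨η₂, hη₂, H₂⟩ := exists_lowerEigenvalue_le_of_lt hΩ i m p (hd.trans hdd'.le) hdc''
    filter_upwards [self_mem_nhdsWithin,
      (eventually_abs_sub_lt p (lt_min hη₁ hη₂)).filter_mono nhdsWithin_le_nhds] with s hs hsη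
    by_contra! hle
    have hsp : (s : ℝ) < p := hs
    -- The auxiliary exponent must exceed `1`, stay below `s` and remain within both thresholds of
    -- `p`.
    obtain ⟨y, hy1, hy2⟩ := exists_between
      (show max 1 ((p : ℝ) - min η₁ η₂) < s from max_lt s.2 (by linarith [(abs_lt.1 hsη).1]))
    obtain ⟨hy1, hyη⟩ := max_lt_iff.1 hy1
    set q : Exponent := ⟨y, hy1⟩
    have hqη : |(q : ℝ) - p| < min η₁ η₂ := abs_lt.2 ⟨by change _ < y - p; linarith, by
      change y - p < _; linarith [lt_min hη₁ hη₂]⟩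
    have h1 := H₁ q s hy2 (hqη.trans_le (min_le_left _ _)) (hsη.trans_le (min_le_left _ _))
      (hle.trans_lt hl)
    have h2 := H₂ q (show y < p by linarith)
      (by rw [abs_sub_comm] at hqη; exact (le_abs_self _).trans_lt (hqη.trans_le (min_le_right _ _)))
      (h1.trans_lt ((ENNReal.ofReal_lt_ofReal_iff_of_nonneg hd).2 hdd'))
    exact absurd (h2.trans_lt hr) (lt_irrefl _)
  have rightUpper : ∀ a, eigenvalue i Ω m p < a → ∀ᶠ s in 𝓝[>] p, eigenvalue i Ω m s < a := by
    intro a ha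
    obtain ⟨c, c', hc, hcc', hl, hr⟩ := exists_real_btwn_pair ha
    obtain ⟨η, hη, H⟩ := exists_eigenvalue_le_of_gt i m p hc hcc' hl
    filter_upwards [self_mem_nhdsWithin,
      (eventually_abs_sub_lt p hη).filter_mono nhdsWithin_le_nhds] with s hs hsη
    exact (H s hs ((le_abs_self _).trans_lt hsη)).trans_lt hr
  have rightLower : ∀ a, a < eigenvalue i Ω m p →
      ∀ᶠ s in 𝓝[>] p, a < lowerEigenvalue i Ω m s := by
    intro a ha
    obtain ⟨c, c', hc, hcc', hl, hr⟩ := exists_real_btwn_pair ha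
    -- Comparison (a) with `p` itself as the smaller exponent.
    obtain ⟨η, hη, H⟩ := exists_eigenvalue_le_of_lowerEigenvalue_lt hΩ i m p hc hcc'
    filter_upwards [self_mem_nhdsWithin,
      (eventually_abs_sub_lt p hη).filter_mono nhdsWithin_le_nhds] with s hs hsη
    by_contra! hle
    exact absurd ((H p s hs (by simpa using hη) hsη (hle.trans_lt hl)).trans_lt hr) (lt_irrefl _)
  refine ⟨⟨tendsto_order.2 ⟨leftLower, fun a ha => ?_⟩, tendsto_order.2 ⟨fun a ha => ?_, leftUpper⟩⟩,
    ⟨tendsto_order.2 ⟨rightLower, fun a ha => ?_⟩, tendsto_order.2 ⟨fun a ha => ?_, rightUpper⟩⟩⟩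
  · exact (leftUpper a ha).mono fun s hs => (hLE s).trans_lt hs
  · exact (leftLower a ha).mono fun s hs => hs.trans_le (hLE s)
  · exact (rightUpper a ha).mono fun s hs => (hLE s).trans_lt hs
  · exact (rightLower a ha).mono fun s hs => hs.trans_le (hLE s)
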